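/- **Setting.** Let $p\ge 1$, let $\mathcal H_1,\dots,\mathcal H_p$ be separable real Hilbert spaces, $\mathcal H=\mathcal H_1\times\cdots\times\mathcal H_p$ their product Hilbert space, and write $\mathbf A=[\mathbf A_{ij}]$, $\mathbf A_{ij}:\mathcal H_j\to\mathcal H_i$, for operators on $\mathcal H$. Let $\|\cdot\|_2$ be the Hilbert–Schmidt (HS) norm, $\|\cdot\|$ the operator norm. Let $X=(X_1,\dots,X_p)$ be a random element of $\mathcal H$ with $\mathbb E\|X\|^2<\infty$, with covariance $\mathbf C_{ij}=\mathbb E[(X_i-\mathbb EX_i)\otimes(X_j-\mathbb EX_j)]$ and correlation operator matrix $\mathbf R$: $\mathbf R_{ii}=\mathbf I$ and, for $i\ne j$, $\mathbf R_{ij}$ is the bounded operator with $\mathbf C_{ij}=\mathbf C_{ii}^{1/2}\mathbf R_{ij}\mathbf C_{jj}^{1/2}$ that takes values in $\overline{\operatorname{ran}}\,\mathbf C_{ii}$ and vanishes on $(\operatorname{ran}\mathbf C_{jj})^\perp$. Put $\mathbf R_0=\mathbf R-\mathbf I$, $\mathbf H^*=\mathbf R^{-1}-\mathbf I$. The graph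 of an operator $\mathbf A$ on $\mathcal H$ is the graph on $\{1,\dots,p\}$ in which $i,j$ are adjacent iff $i=j$ or $\mathbf A_{ij}\neq\mathbf 0$; let $G$ be the graph of $\mathbf H^*$, $S$ the set of ordered pairs $(i,j)$ adjacent in $G$ (so $(i,i)\in S$), $S^c$ its complement, and $d$ the maximal number of neighbours of a vertex of $G$ (every vertex being its own neighbour). **Assumptions.** 1. *Equivalence / eigenvalue gap.* Either $X$ is Gaussian and its law is equivalent (mutually absolutely continuous) to $\otimes_j\mathbb P_{X_j}$; or $\mathbf R_0$ is HS and its eigenvalues satisfy $1+\inf_j\lambda_j(\mathbf R_0)>0$. 2. *Incoherence.* Let $\Gamma$ be the map $\Gamma\mathbf A=\mathbf R\mathbf A\mathbf R$, viewed as a matrix indexed by pairs, whose block from the HS operators $\mathcal H_l\to\mathcal H_k$ to the HS operators $\mathcal H_j\to\mathcal H_i$ is $\Gamma_{(i,j)(k,l)}:\mathbf B\mapsto\mathbf R_{ik}\mathbf B\mathbf R_{lj}$. For some $\alpha>0$, $$\sum_{e'\in S}\big\|\big(\Gamma_{eS}\Gamma_{SS}^{-1}\big)_{e'}\big\|\le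 1-\alpha\qquad\text{for all } e\in S^c,$$ where the norm of a block is its operator norm between the two Hilbert spaces of HS operators. 3. *Regularity.* For some $0<\beta\le1$, $\mathbf R_0=[\operatorname{dg}\mathbf C]^\beta\,\Phi\,[\operatorname{dg}\mathbf C]^\beta$ with an HS operator matrix $\Phi$ whose diagonal entries are zero, where $\operatorname{dg}\mathbf C$ is the diagonal part of $\mathbf C$. **Constants.** $\rho=1+\max_i\sum_j\|(\mathbf R_0)_{ij}\|_2$; $\gamma=1+\max_{e\in S}\sum_{e'\in S}\|\Lambda_{ee'}\|$, where $\Gamma_{SS}^{-1}=\mathbf I+\Lambda$ and the block norms are as in 2; $$\kappa=16\sqrt2\,\Big(\big[1\vee\max_{i\ne j}\|\mathbf R_{ij}\|_2\big]\vee\max_{i\ne j}\|\Phi_{ij}\|_2\,\big[2\vee2\max_j\|\mathbf C_{jj}\|\big]\Big);$$ $\theta=\min\{\|\mathbf H^*_{ij}\|_2:\mathbf H^*_{ij}\neq\mathbf0\}$ (with $1/\theta=0$ if $\mathbf H^*=\mathbf 0$). **Estimator.** Let $f:\mathbb N\times(0,\infty)\to[0,\infty)$ be nondecreasing in both arguments,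 $\delta_*>0$, and let $\hat{\mathbf C}=\hat{\mathbf C}_n$, $n\ge1$, be estimators of $\mathbf C$ such that the $\hat{\mathbf C}_{ii}$ are (almost surely) non-negative self-adjoint and, for all $n\ge1$, $0<\delta<\delta_*$ and $i,j$, $$\mathbb P\big[\|\hat{\mathbf C}_{ij}-\mathbf C_{ij}\|_2\ge\delta\big]\le 1/f(n,\delta).$$ Put $\bar n_f(\delta,r)=\max\{n:f(n,\delta)\le r\}$ and $\bar\delta_f(n,r)=\max\{\delta>0:f(n,\delta)\le r\}$. For $\epsilon_n,\lambda_n>0$ let $\hat{\mathbf R}_{ii}=\mathbf I$, $\hat{\mathbf R}_{ij}=[\epsilon_n\mathbf I+\hat{\mathbf C}_{ii}]^{-1/2}\hat{\mathbf C}_{ij}[\epsilon_n\mathbf I+\hat{\mathbf C}_{jj}]^{-1/2}$ for $i\neq j$, $\hat{\mathbf R}_0=\hat{\mathbf R}-\mathbf I$, let $\hat{\mathbf H}$ be the minimizer of $$\operatorname{tr}(\mathbf H\hat{\mathbf R}_0)-\log{\det}_2(\mathbf I+\mathbf H)+\lambda_n\sum_{i\ne j}\|\mathbf H_{ij}\|_2$$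 over the self-adjoint HS operators $\mathbf H$ on $\mathcal H$ with $\mathbf I+\mathbf H>\mathbf0$, where ${\det}_2(\mathbf I+\mathbf H)=\prod_j(1+\lambda_j)e^{-\lambda_j}$ over the eigenvalues $\lambda_j$ of $\mathbf H$, and let $\hat G$ be the graph of $\hat{\mathbf H}$. **Corollary (Model Selection Consistency).** Let $\tau>2$, let the maximum $\bar\delta_f(n,p^\tau)$ exist, and let $$\epsilon_n=\bar\delta_f(n,p^\tau)^{\frac1{1+\beta}},\qquad \lambda_n=\frac8\alpha\,\kappa\,\bar\delta_f(n,p^\tau)^{\frac\beta{1+\beta}}.$$ If the sample size $n$ satisfies $$n>\bar n_f\!\left(1\Big/\max\left\{\frac1{\delta_*},\Big[\frac{2\gamma\kappa}{\theta}\Big(1+\frac8\alpha\Big)\Big]^{1+\frac1\beta},\Big[12\,d\,\kappa\Big(1+\frac8\alpha\Big)^2\big[\rho\gamma\vee\rho^3\gamma^2\big]\Big]^{1+\frac1\beta}\right\},\;p^\tau\right),$$ then with probability at least $1-1/p^{\tau-2}$ the minimizer $\hat{\mathbf H}$ exists, is unique, and $\hat G=G$. -/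

import Mathlib

open MeasureTheory ProbabilityTheory
open scoped ENNReal

namespace FGL

noncomputable section

section Operators

variable {E F G : Type*}
  [NormedAddCommGroup E] [InnerProductSpace ℝ E] [CompleteSpace E]
  [NormedAddCommGroup F] [InnerProductSpace ℝ F] [CompleteSpace F]
  [NormedAddCommGroup G] [InnerProductSpace ℝ G] [CompleteSpace G]

/-- Index set of a fixed orthonormal basis of the Hilbert space `E`. -/
def onbIndex (E : Type*) [NormedAddCommGroup E] [InnerProductSpace ℝ E] [CompleteSpace E] :
    Set E :=
  (exists_hilbertBasis ℝ E).choose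

/-- A fixed orthonormal basis of the Hilbert space `E`. The Hilbert-Schmidt norm and the trace of
trace-class operators do not depend on it. -/
def onb (E : Type*) [NormedAddCommGroup E] [InnerProductSpace ℝ E] [CompleteSpace E] :
    HilbertBasis (onbIndex E) ℝ E :=
  (exists_hilbertBasis ℝ E).choose_spec.choose

/-- The Hilbert-Schmidt norm `(∑ₖ ‖A eₖ‖²)^{1/2}`, with the value `∞` if `A` is not
Hilbert-Schmidt. -/
def hsNorm (A : E →L[ℝ] F) : ℝ≥0∞ :=
  (∑' k : onbIndex E, ‖A (onb E k)‖ₑ ^ 2) ^ (1 / 2 : ℝ)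

/-- `A` is a Hilbert-Schmidt operator. -/
def IsHS (A : E →L[ℝ] F) : Prop := hsNorm A < ∞

/-- The trace `∑ₖ ⟨eₖ, A eₖ⟩` of a trace-class operator. -/
def opTrace (A : E →L[ℝ] E) : ℝ := ∑' k : onbIndex E, inner ℝ (onb E k) (A (onb E k))

open Classical in
/-- The function `φ(A)` of an operator `A` whose eigenvectors span a dense subspace (such as a
compact self-adjoint operator, or a scalar operator plus one): the bounded operator that multiplies
each eigenvector of eigenvalue `a` by `φ a`. -/
def opFun (φ : ℝ → ℝ) (A : E →L[ℝ] E) : E →L[ℝ] E :=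
  if h : ∃ B : E →L[ℝ] E, ∀ (a : ℝ) (v : E), A v = a • v → B v = φ a • v then h.choose else 0

/-- The power `A ^ s`. -/
def opPow (A : E →L[ℝ] E) (s : ℝ) : E →L[ℝ] E := opFun (fun a => a ^ s) A

/-- The Carleman-Fredholm determinant `det₂(I + A) = ∏ⱼ (1 + λⱼ) e^{-λⱼ}` of a self-adjoint
Hilbert-Schmidt operator `A`; the product runs over the eigenvalues, repeated according to
multiplicity (the eigenvalue `0` contributes the factor `1`). -/
def cfDet (A : E →L[ℝ] E) : ℝ :=
  ∏' a : ℝ, ((1 + a) * Real.exp (-a)) ^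
    Module.finrank ℝ (Module.End.eigenspace (A : E →ₗ[ℝ] E) a)

/-- `R` is the correlation operator of a cross-covariance `K` with respect to the covariances
`A` and `B`: `K = A^{1/2} R B^{1/2}`, where `R` takes its values in the closure of the range of `A`
and vanishes on the orthogonal complement of the range of `B`. -/
def IsCorrelation (A : E →L[ℝ] E) (B : F →L[ℝ] F) (K R : F →L[ℝ] E) : Prop :=
  K = opPow A (1 / 2) ∘L R ∘L opPow B (1 / 2) ∧
  (∀ x, R x ∈ (LinearMap.range (A : E →ₗ[ℝ] E)).topologicalClosure) ∧
  ∀ x ∈ (LinearMap.range (B : F →ₗ[ℝ] F))ᗮ, R x = 0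

open Classical in
/-- The correlation operator `A^{-1/2} K B^{-1/2}` (with pseudoinverses), which exists and is unique
when `A`, `B`, `K` are the entries of a covariance operator. -/
def correlation (A : E →L[ℝ] E) (B : F →L[ℝ] F) (K : F →L[ℝ] E) : F →L[ℝ] E :=
  if h : ∃ R, IsCorrelation A B K R then h.choose else 0

theorem isHS_iff (A : E →L[ℝ] F) :
    IsHS A ↔ ∑' k : onbIndex E, ‖A (onb E k)‖ₑ ^ 2 < ∞ := by
  simp [IsHS, hsNorm, ENNReal.rpow_lt_top_iff_of_pos]

theorem parseval (x : E) : ∑' k : onbIndex E, ‖inner ℝ (onb E k) x‖ₑ ^ 2 = ‖x‖ₑ ^ 2 := by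
  have h := (onb E).hasSum_inner_mul_inner x x
  have h2 : HasSum (fun k => ‖inner ℝ (onb E k) x‖ ^ 2) (‖x‖ ^ 2) := by
    rw [real_inner_self_eq_norm_sq] at h
    refine h.congr_fun fun k => ?_
    rw [real_inner_comm x (onb E k), Real.norm_eq_abs, sq_abs, sq]
  have h4 := ENNReal.ofReal_tsum_of_nonneg (fun k => sq_nonneg ‖inner ℝ (onb E k) x‖) h2.summable
  rw [h2.tsum_eq] at h4
  simp_rw [ENNReal.ofReal_pow (norm_nonneg _), ofReal_norm] at h4
  exact h4.symm

theorem hs_sum_adjoint (A : E →L[ℝ] F) :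
    ∑' k : onbIndex F, ‖(ContinuousLinearMap.adjoint A) (onb F k)‖ₑ ^ 2 =
      ∑' k : onbIndex E, ‖A (onb E k)‖ₑ ^ 2 := by
  calc ∑' k : onbIndex F, ‖(ContinuousLinearMap.adjoint A) (onb F k)‖ₑ ^ 2
      = ∑' (k : onbIndex F) (l : onbIndex E),
          ‖inner ℝ (onb E l) ((ContinuousLinearMap.adjoint A) (onb F k))‖ₑ ^ 2 :=
        tsum_congr fun k => (parseval _).symm
    _ = ∑' (l : onbIndex E) (k : onbIndex F), ‖inner ℝ (onb F k) (A (onb E l))‖ₑ ^ 2 := by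
        rw [ENNReal.tsum_comm]
        refine tsum_congr fun l => tsum_congr fun k => ?_
        rw [ContinuousLinearMap.adjoint_inner_right, real_inner_comm]
    _ = ∑' k : onbIndex E, ‖A (onb E k)‖ₑ ^ 2 := tsum_congr fun l => parseval _

theorem IsHS.comp_left {A : E →L[ℝ] F} (hA : IsHS A) (B : F →L[ℝ] G) : IsHS (B ∘L A) := by
  rw [isHS_iff] at *
  calc ∑' k : onbIndex E, ‖(B ∘L A) (onb E k)‖ₑ ^ 2
      ≤ ∑' k : onbIndex E, ‖B‖ₑ ^ 2 * ‖A (onb E k)‖ₑ ^ 2 := by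
        refine ENNReal.tsum_le_tsum fun k => ?_
        rw [← mul_pow]
        gcongr
        exact B.le_opENorm _
    _ = ‖B‖ₑ ^ 2 * ∑' k : onbIndex E, ‖A (onb E k)‖ₑ ^ 2 := ENNReal.tsum_mul_left
    _ < ∞ := ENNReal.mul_lt_top (by finiteness) hA

theorem IsHS.adjoint {A : E →L[ℝ] F} (hA : IsHS A) : IsHS (ContinuousLinearMap.adjoint A) := by
  rw [isHS_iff] at *
  rwa [hs_sum_adjoint]

theorem IsHS.comp_right {A : F →L[ℝ] G} (hA : IsHS A) (B : E →L[ℝ] F) : IsHS (A ∘L B) := by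
  have h := (hA.adjoint.comp_left (ContinuousLinearMap.adjoint B)).adjoint
  rwa [ContinuousLinearMap.adjoint_comp, ContinuousLinearMap.adjoint_adjoint,
    ContinuousLinearMap.adjoint_adjoint] at h

theorem isHS_add {A B : E →L[ℝ] F} (hA : IsHS A) (hB : IsHS B) : IsHS (A + B) := by
  rw [isHS_iff] at *
  calc ∑' k : onbIndex E, ‖(A + B) (onb E k)‖ₑ ^ 2
      ≤ ∑' k : onbIndex E, 2 * (‖A (onb E k)‖ₑ ^ 2 + ‖B (onb E k)‖ₑ ^ 2) := by
        refine ENNReal.tsum_le_tsum fun k => ?_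
        calc ‖(A + B) (onb E k)‖ₑ ^ 2 ≤ (‖A (onb E k)‖ₑ + ‖B (onb E k)‖ₑ) ^ 2 := by
              gcongr
              exact enorm_add_le _ _
          _ ≤ 2 * (‖A (onb E k)‖ₑ ^ 2 + ‖B (onb E k)‖ₑ ^ 2) := by
              have := ENNReal.rpow_add_le_mul_rpow_add_rpow (‖A (onb E k)‖ₑ) (‖B (onb E k)‖ₑ)
                (p := 2) (by norm_num)
              norm_num at this
              exact_mod_cast this
    _ = 2 * (∑' k : onbIndex E, ‖A (onb E k)‖ₑ ^ 2 + ∑' k : onbIndex E, ‖B (onb E k)‖ₑ ^ 2) := by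
        rw [ENNReal.tsum_mul_left, ENNReal.tsum_add]
    _ < ∞ := ENNReal.mul_lt_top (by finiteness) (ENNReal.add_lt_top.2 ⟨hA, hB⟩)

/-- The space of Hilbert-Schmidt operators from `E` to `F`. -/
def HSOp (E F : Type*) [NormedAddCommGroup E] [InnerProductSpace ℝ E] [CompleteSpace E]
    [NormedAddCommGroup F] [InnerProductSpace ℝ F] [CompleteSpace F] :
    Submodule ℝ (E →L[ℝ] F) where
  carrier := {A | IsHS A}
  add_mem' := isHS_add
  zero_mem' := by simp [isHS_iff]
  smul_mem' c A hA := by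
    have h : c • A = (c • ContinuousLinearMap.id ℝ F) ∘L A := by ext; simp
    rw [h]
    exact IsHS.comp_left hA _

/-- The norm of a linear map between spaces of Hilbert-Schmidt operators, as an operator between
these Hilbert spaces. -/
def hsOpNorm {E' F' : Type*}
    [NormedAddCommGroup E'] [InnerProductSpace ℝ E'] [CompleteSpace E']
    [NormedAddCommGroup F'] [InnerProductSpace ℝ F'] [CompleteSpace F']
    (T : HSOp E F →ₗ[ℝ] HSOp E' F') : ℝ≥0∞ :=
  ⨆ (B : HSOp E F) (_ : hsNorm (B : E →L[ℝ] F) ≤ 1), hsNorm (T B : E' →L[ℝ] F')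

/-- The map `A ↦ P A Q` on Hilbert-Schmidt operators. -/
def sandwich {E' F' : Type*}
    [NormedAddCommGroup E'] [InnerProductSpace ℝ E'] [CompleteSpace E']
    [NormedAddCommGroup F'] [InnerProductSpace ℝ F'] [CompleteSpace F']
    (P : F →L[ℝ] F') (Q : E' →L[ℝ] E) : HSOp E F →ₗ[ℝ] HSOp E' F' where
  toFun A := ⟨P ∘L (A : E →L[ℝ] F) ∘L Q, (A.2.comp_right Q).comp_left P⟩
  map_add' A B := by ext; simp
  map_smul' c A := by ext; simp

end Operators

section Matrices

variable {p : ℕ} {H : Fin p → Type*} [∀ i, NormedAddCommGroup (H i)]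
  [∀ i, InnerProductSpace ℝ (H i)] [∀ i, CompleteSpace (H i)]

/-- The inclusion of the `j`-th factor in the product Hilbert space. -/
def incl (H : Fin p → Type*) [∀ i, NormedAddCommGroup (H i)] [∀ i, InnerProductSpace ℝ (H i)]
    (j : Fin p) : H j →L[ℝ] PiLp 2 H :=
  ((PiLp.continuousLinearEquiv 2 ℝ H).symm : (∀ i, H i) →L[ℝ] PiLp 2 H) ∘L
    ContinuousLinearMap.single ℝ H j

/-- The `(i, j)` entry `H j → H i` of an operator on the product Hilbert space. -/
def entry (A : PiLp 2 H →L[ℝ] PiLp 2 H) (i j : Fin p) : H j →L[ℝ] H i :=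
  PiLp.proj 2 H i ∘L A ∘L incl H j

/-- The operator on the product Hilbert space given by an operator matrix. -/
def toOp (M : ∀ i j, H j →L[ℝ] H i) : PiLp 2 H →L[ℝ] PiLp 2 H :=
  ∑ i, ∑ j, incl H i ∘L M i j ∘L PiLp.proj 2 H j

/-- The covariance operator matrix `Cᵢⱼ = E[(Xᵢ - E Xᵢ) ⊗ (Xⱼ - E Xⱼ)]`. -/
def covMat {Ω : Type*} [MeasurableSpace Ω] (μ : Measure Ω) (X : ∀ i, Ω → H i) (i j : Fin p) :
    H j →L[ℝ] H i :=
  ∫ ω, InnerProductSpace.rankOne ℝ (X i ω - ∫ ω', X i ω' ∂μ) (X j ω - ∫ ω', X j ω' ∂μ) ∂μ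

/-- The correlation operator matrix: `Rᵢᵢ = I` and `Rᵢⱼ = Cᵢᵢ^{-1/2} Cᵢⱼ Cⱼⱼ^{-1/2}` off the
diagonal. -/
def corrMat (C : ∀ i j, H j →L[ℝ] H i) (i j : Fin p) : H j →L[ℝ] H i :=
  if i = j then entry 1 i j else correlation (C i i) (C j j) (C i j)

/-- The regularized estimator of the correlation operator matrix: `R̂ᵢᵢ = I` and
`R̂ᵢⱼ = (ε I + Ĉᵢᵢ)^{-1/2} Ĉᵢⱼ (ε I + Ĉⱼⱼ)^{-1/2}` off the diagonal. -/
def corrEst (ε : ℝ) (Chat : ∀ i j, H j →L[ℝ] H i) (i j : Fin p) : H j →L[ℝ] H i :=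
  if i = j then entry 1 i j
  else opPow (ε • 1 + Chat i i) (-1 / 2) ∘L Chat i j ∘L opPow (ε • 1 + Chat j j) (-1 / 2)

/-- The precision operator `H* = R⁻¹ - I`. -/
def precision (R : ∀ i j, H j →L[ℝ] H i) : PiLp 2 H →L[ℝ] PiLp 2 H :=
  Ring.inverse (toOp R) - 1

open Classical in
/-- The graph of a precision operator `A`, as the set of its ordered pairs of adjacent vertices:
`i` and `j` are adjacent if `i = j` or `Aᵢⱼ ≠ 0`. -/
def graph (A : PiLp 2 H →L[ℝ] PiLp 2 H) : Finset (Fin p × Fin p) :=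
  Finset.univ.filter fun e => e.1 = e.2 ∨ entry A e.1 e.2 ≠ 0

/-- The maximum degree of a graph on the vertices `Fin p`; a vertex that is adjacent to itself is
one of its own neighbours. -/
def maxDegree (S : Finset (Fin p × Fin p)) : ℕ :=
  Finset.univ.sup fun i : Fin p => (Finset.univ.filter fun j : Fin p => (i, j) ∈ S).card

/-- The row-sum norm `maxᵢ ∑ⱼ ‖Mᵢⱼ‖₂`. -/
def rowNorm (M : ∀ i j, H j →L[ℝ] H i) : ℝ := (⨆ i, ∑ j, hsNorm (M i j)).toReal

/-- `ρ = 1 + maxᵢ ∑ⱼ ‖(R - I)ᵢⱼ‖₂`. -/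
def rho (R : ∀ i j, H j →L[ℝ] H i) : ℝ := 1 + rowNorm (entry (toOp R - 1))

/-- Hilbert-Schmidt operator arrays indexed by the pairs in `S`. -/
abbrev HSArray (H : Fin p → Type*) [∀ i, NormedAddCommGroup (H i)]
    [∀ i, InnerProductSpace ℝ (H i)] [∀ i, CompleteSpace (H i)] (S : Finset (Fin p × Fin p)) :=
  ∀ e : S, HSOp (H e.1.2) (H e.1.1)

/-- The row `Γ_{eS}` of `Γ = R ⊗ R`: the block of `Γ A = R A R` that maps the entry
`A_{kl}` to the entry `(i, j)` is `A_{kl} ↦ R_{ik} A_{kl} R_{lj}`. -/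
def gammaRow (R : ∀ i j, H j →L[ℝ] H i) (S : Finset (Fin p × Fin p)) (e : Fin p × Fin p) :
    HSArray H S →ₗ[ℝ] HSOp (H e.2) (H e.1) :=
  ∑ e' : S, sandwich (R e.1 e'.1.1) (R e'.1.2 e.2) ∘ₗ LinearMap.proj e'

/-- The submatrix `Γ_{SS}`. -/
def gammaSS (R : ∀ i j, H j →L[ℝ] H i) (S : Finset (Fin p × Fin p)) :
    Module.End ℝ (HSArray H S) :=
  LinearMap.pi fun e : S => gammaRow R S e.1

/-- The sum over `e' ∈ S` of the norms of the entries (indexed by `e'`) of a row. -/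
def rowSum {e : Fin p × Fin p} {S : Finset (Fin p × Fin p)}
    (T : HSArray H S →ₗ[ℝ] HSOp (H e.2) (H e.1)) : ℝ≥0∞ :=
  ∑ e' : S, hsOpNorm (T ∘ₗ LinearMap.single ℝ (fun e : S => HSOp (H e.1.2) (H e.1.1)) e')

/-- `γ = 1 + max_{e ∈ S} ∑_{e' ∈ S} ‖Λ_{ee'}‖`, where `Γ_{SS}⁻¹ = I + Λ`. -/
def gammaConst (R : ∀ i j, H j →L[ℝ] H i) (S : Finset (Fin p × Fin p)) : ℝ :=
  1 + (⨆ e : S, rowSum (LinearMap.proj e ∘ₗ (Ring.inverse (gammaSS R S) - 1) :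
    HSArray H S →ₗ[ℝ] HSOp (H e.1.2) (H e.1.1))).toReal

/-- Incoherence: `max_{e ∉ S} ∑_{e' ∈ S} ‖(Γ_{eS} Γ_{SS}⁻¹)_{e'}‖ ≤ 1 - α`. -/
def Incoherent (R : ∀ i j, H j →L[ℝ] H i) (S : Finset (Fin p × Fin p)) (α : ℝ) : Prop :=
  ∀ e ∉ S, rowSum (gammaRow R S e ∘ₗ Ring.inverse (gammaSS R S)) + ENNReal.ofReal α ≤ 1

/-- Regularity: `R - I = (dg C)^β Φ (dg C)^β` with a Hilbert-Schmidt operator matrix `Φ` whose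
diagonal entries are zero. -/
def Regular (C R : ∀ i j, H j →L[ℝ] H i) (β : ℝ) (Φ : ∀ i j, H j →L[ℝ] H i) : Prop :=
  (∀ i, Φ i i = 0) ∧ (∀ i j, IsHS (Φ i j)) ∧
  ∀ i j, entry (toOp R - 1) i j = opPow (C i i) β ∘L Φ i j ∘L opPow (C j j) β

/-- Eigenvalue gap: `R - I` is Hilbert-Schmidt and `1 + inf λ > 0`, the infimum being over the
eigenvalues `λ` of `R - I`. -/
def EigenvalueGap (R : ∀ i j, H j →L[ℝ] H i) : Prop :=
  IsHS (toOp R - 1) ∧ ∃ c > 0, ∀ a : ℝ,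
    Module.End.HasEigenvalue ((toOp R - 1 : PiLp 2 H →L[ℝ] PiLp 2 H) : PiLp 2 H →ₗ[ℝ] PiLp 2 H) a →
      c ≤ 1 + a

/-- `X` is Gaussian, and its law is equivalent to the product of the laws of its components. -/
def GaussianEquivalence [∀ i, MeasurableSpace (H i)]
    {Ω : Type*} [MeasurableSpace Ω] (μ : Measure Ω) (X : ∀ i, Ω → H i) : Prop :=
  IsGaussian (μ.map fun ω i => X i ω) ∧
  (μ.map fun ω i => X i ω) ≪ Measure.pi (fun i => μ.map (X i)) ∧
  Measure.pi (fun i => μ.map (X i)) ≪ (μ.map fun ω i => X i ω)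

/-- `κ = 16√2 (1 ∨ max_{i ≠ j} ‖Rᵢⱼ‖₂ ∨ max_{i ≠ j} ‖Φᵢⱼ‖₂ (2 ∨ 2 maxⱼ ‖Cⱼⱼ‖))`. -/
def kappa (C R Φ : ∀ i j, H j →L[ℝ] H i) : ℝ :=
  16 * √2 * max (max 1 (⨆ e : {e : Fin p × Fin p // e.1 ≠ e.2}, (hsNorm (R e.1.1 e.1.2)).toReal))
    ((⨆ e : {e : Fin p × Fin p // e.1 ≠ e.2}, (hsNorm (Φ e.1.1 e.1.2)).toReal) *
      max 2 (2 * ⨆ j, ‖C j j‖))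

/-- `θ = min {‖Aᵢⱼ‖₂ : Aᵢⱼ ≠ 0}`. If all the entries are zero, this is `0`, and a quotient by it is
`0`, as for `θ = ∞`. -/
def minEntry (A : PiLp 2 H →L[ℝ] PiLp 2 H) : ℝ :=
  sInf {t | ∃ i j, entry A i j ≠ 0 ∧ t = (hsNorm (entry A i j)).toReal}

/-- The penalized objective functional
`tr(A R̂₀) - log det₂(I + A) + lam ∑_{i ≠ j} ‖Aᵢⱼ‖₂`, where `R̂₀ = R̂ - I`. -/
def objective (Rhat : ∀ i j, H j →L[ℝ] H i) (lam : ℝ) (A : PiLp 2 H →L[ℝ] PiLp 2 H) : ℝ :=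
  opTrace (A ∘L (toOp Rhat - 1)) - Real.log (cfDet A) +
    lam * ∑ e : {e : Fin p × Fin p // e.1 ≠ e.2}, (hsNorm (entry A e.1.1 e.1.2)).toReal

/-- The self-adjoint Hilbert-Schmidt operators `A` with `I + A > 0`. -/
def feasible (H : Fin p → Type*) [∀ i, NormedAddCommGroup (H i)] [∀ i, InnerProductSpace ℝ (H i)]
    [∀ i, CompleteSpace (H i)] : Set (PiLp 2 H →L[ℝ] PiLp 2 H) :=
  {A | IsHS A ∧ IsSelfAdjoint A ∧ ∀ x, x ≠ 0 → 0 < inner ℝ x ((1 + A) x)}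

/-- `A` minimizes the objective functional. -/
def IsEstimate (Rhat : ∀ i j, H j →L[ℝ] H i) (lam : ℝ) (A : PiLp 2 H →L[ℝ] PiLp 2 H) : Prop :=
  A ∈ feasible H ∧ IsMinOn (objective Rhat lam) (feasible H) A

end Matrices

/-- The requirements on a tail function `f : ℕ × (0, ∞) → [0, ∞)`: it is increasing in both
arguments. -/
def IsTailFunction (f : ℕ → ℝ → ℝ) : Prop :=
  (∀ n δ, 0 < δ → 0 ≤ f n δ) ∧
  ∀ m n δ δ', m ≤ n → 0 < δ → δ ≤ δ' → f m δ ≤ f n δ'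

/-- The tail condition with parameters `f` and `δstar` for a sequence `Chat` of estimators of
the operator matrix `C` (with `1 / 0 = ∞` on the right-hand side). -/
def TailCondition {p : ℕ} {H : Fin p → Type*} [∀ i, NormedAddCommGroup (H i)]
    [∀ i, InnerProductSpace ℝ (H i)] [∀ i, CompleteSpace (H i)]
    {Ω : Type*} [MeasurableSpace Ω] (μ : Measure Ω) (C : ∀ i j, H j →L[ℝ] H i)
    (Chat : ℕ → Ω → ∀ i j, H j →L[ℝ] H i) (f : ℕ → ℝ → ℝ) (δstar : ℝ) : Prop :=
  ∀ n, 1 ≤ n → ∀ δ, 0 < δ → δ < δstar → ∀ i j,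
    μ {ω | ENNReal.ofReal δ ≤ hsNorm (Chat n ω i j - C i j)} ≤ 1 / ENNReal.ofReal (f n δ)

/-- `max {n : f(n, δ) ≤ r}`, with the value `∞` if there are arbitrarily large such `n`. -/
def nBar (f : ℕ → ℝ → ℝ) (δ r : ℝ) : ℕ∞ := ⨆ (n : ℕ) (_ : f n δ ≤ r), (n : ℕ∞)

end

end FGL

open FGL

namespace FGL

noncomputable section

set_option linter.unusedSectionVars false

/-! ### Hilbert bases, diagonal operators and their functional calculus. -/

section Basis

variable {E F G : Type*}
  [NormedAddCommGroup E] [InnerProductSpace ℝ E] [CompleteSpace E]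
  [NormedAddCommGroup F] [InnerProductSpace ℝ F] [CompleteSpace F]
  [NormedAddCommGroup G] [InnerProductSpace ℝ G] [CompleteSpace G]
  {ι κ : Type*}

/-! The proof is a primal-dual witness argument. The gradient of `-log det₂(I + H)` is `I - (I +
H)⁻¹`, so without penalty and with the true `R` the objective is stationary exactly at `H* = R⁻¹ -
I`. Suppose the entries of `R̂ - R` are at most `w = κ δ^{β/(1+β)}` and `lam = 8 w / α`. One
minimizes the penalized objective over `H* + D` with `D` supported on the graph `S` and entries at
most `r = 2 γ (w + lam)`. If the minimizer is interior, it satisfies the stationarity equation on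
`S`. Expanding the inverse to first order turns this equation into `Γ_{SS} D` = remainder -
perturbation - penalty, whose entries are at most `7w/5 + lam`. Hence the entries of `D` are at most
`7r/10` (`Model.remainder_le`, `Model.apriori`). Since `r < θ`, no edge is lost. Off `S`,
incoherence bounds the residual gradient by `lam` (`Model.dual_le`), so it is a subgradient of the
penalty where the restricted solution vanishes. Strict convexity then makes that solution the unique
minimizer of the full problem (`Model.exists_unique_min`).

That the restricted minimizer is interior follows by continuation instead of a fixed point theorem.
Perturbation and penalty are multiplied by `s ∈ [0, 1]`. At `s = 0` the minimizer is `D = 0`. By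
uniform strong convexity the minimizers depend continuously on `s`, and the a priori bound forbids
sizes strictly between `7r/10` and `r`, so the size never passes `7r/10`
(`exists_min_of_continuation`). The convexity of `-log det₂` comes from writing its second-order
remainder as a sum over pairs of eigenvectors of scalar remainders of `x - log x`
(`hasSum_logdet_gap`).

The witness needs `R` bounded below. The scores `x ↦ ⟨x, X_i - E X_i⟩` define Hilbert-Schmidt
operators `U_i` into `L²` with `C_ij = U_i* U_j`. Polar decomposition `U_i = V_i C_ii^{1/2}` gives
`R_ij = V_i* V_j` off the diagonal, so `R ≥ 0`. A kernel vector of `R` produces limits of scores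
that sum to zero. If `X` is Gaussian and the product law is dominated by the joint law, the sum also
vanishes under the product law, where characteristic functions factorize, and this forces every
summand to be zero (`eq_zero_of_sum_scores_eq_zero`). As `R - I` is Hilbert-Schmidt, a trivial
kernel upgrades to a spectral gap.

Finally, if all entries of `Ĉ - C` are at most `δ`, the choice `ε = δ^{1/(1+β)}` balances the error
`δ/ε` of the regularized inverse roots against their bias `ε^β`, so `R̂` has error at most `w`
(`hs_corrEst_sub_le`). A union bound over the `p²` entries gives the probability. -/

theorem hasSum_sq_inner_basis (b : HilbertBasis ι ℝ E) (x : E) :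
    HasSum (fun k => inner ℝ (b k) x ^ 2) (‖x‖ ^ 2) := by
  have h := b.hasSum_inner_mul_inner x x
  rw [real_inner_self_eq_norm_sq] at h
  refine h.congr_fun fun k => ?_
  rw [real_inner_comm x (b k), sq]

theorem parseval_basis (b : HilbertBasis ι ℝ E) (x : E) :
    ∑' k, ‖inner ℝ (b k) x‖ₑ ^ 2 = ‖x‖ₑ ^ 2 := by
  have h2 := hasSum_sq_inner_basis b x
  have h4 := ENNReal.ofReal_tsum_of_nonneg (fun k => sq_nonneg (inner ℝ (b k) x)) h2.summable
  rw [h2.tsum_eq] at h4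
  simp_rw [← ofReal_norm, ← ENNReal.ofReal_pow (norm_nonneg _), Real.norm_eq_abs, sq_abs]
  exact h4.symm

theorem clm_ext_basis (b : HilbertBasis ι ℝ E) {A B : E →L[ℝ] F} (h : ∀ k, A (b k) = B (b k)) :
    A = B := by
  refine ContinuousLinearMap.ext_on (s := Set.range b) ?_ ?_
  · exact Submodule.dense_iff_topologicalClosure_eq_top.2 b.dense_span
  · rintro _ ⟨k, rfl⟩
    exact h k

theorem ext_inner_basis (b : HilbertBasis ι ℝ E) {x y : E}
    (h : ∀ k, inner ℝ (b k) x = inner ℝ (b k) y) : x = y := by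
  have := hasSum_sq_inner_basis b (x - y)
  simp only [inner_sub_right, h, sub_self] at this
  have h2 : ‖x - y‖ ^ 2 = 0 := this.unique (by simp)
  simpa [sub_eq_zero] using h2

/-- A family that satisfies a Bessel inequality is the image of a Hilbert basis under a bounded
operator. -/
theorem exists_clm_of_bessel (b : HilbertBasis ι ℝ E) (v : ι → F) {M : ℝ} (hM : 0 ≤ M)
    (h : ∀ (s : Finset ι) (c : ι → ℝ), ‖∑ k ∈ s, c k • v k‖ ^ 2 ≤ M ^ 2 * ∑ k ∈ s, c k ^ 2) :
    ∃ T : E →L[ℝ] F, (∀ k, T (b k) = v k) ∧ ‖T‖ ≤ M := by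
  have hs : ∀ x : E, Summable fun k => inner ℝ (b k) x • v k := by
    intro x
    rw [summable_iff_vanishing_norm]
    intro ε hε
    -- Cauchy's criterion for the squared coefficients is transported by the Bessel bound; the `+ 1`
    -- in `ε ^ 2 / (M ^ 2 + 1)` covers `M = 0`.
    have h2 := (summable_iff_vanishing_norm.1 (hasSum_sq_inner_basis b x).summable)
      (ε ^ 2 / (M ^ 2 + 1)) (by positivity)
    obtain ⟨s, hs⟩ := h2
    refine ⟨s, fun t ht => ?_⟩
    have h3 := hs t ht
    rw [Real.norm_eq_abs, abs_of_nonneg (Finset.sum_nonneg fun k _ => sq_nonneg _),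
      lt_div_iff₀ (by positivity)] at h3
    have h4 := h t fun k => inner ℝ (b k) x
    have h5 : 0 ≤ ∑ k ∈ t, inner ℝ (b k) x ^ 2 := Finset.sum_nonneg fun k _ => sq_nonneg _
    refine lt_of_pow_lt_pow_left₀ 2 hε.le ?_
    nlinarith
  let L : E →ₗ[ℝ] F :=
    { toFun := fun x => ∑' k, inner ℝ (b k) x • v k
      map_add' := fun x y => by
        simp only [inner_add_right, add_smul]
        exact (hs x).tsum_add (hs y)
      map_smul' := fun c x => by
        simp only [inner_smul_right, mul_smul, RingHom.id_apply]
        exact (hs x).tsum_const_smul c }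
  have hL : ∀ x, ‖L x‖ ≤ M * ‖x‖ := by
    intro x
    refine le_of_tendsto ((hs x).hasSum.norm) (Filter.Eventually.of_forall fun s => ?_)
    refine le_of_sq_le_sq ?_ (by positivity)
    rw [mul_pow]
    refine (h s _).trans ?_
    gcongr
    exact sum_le_hasSum _ (fun _ _ => sq_nonneg _) (hasSum_sq_inner_basis b x)
  refine ⟨L.mkContinuous M hL, fun k => ?_, L.mkContinuous_norm_le hM hL⟩
  change ∑' l, inner ℝ (b l) (b k) • v l = v k
  classical
  rw [tsum_eq_single k]
  · rw [real_inner_self_eq_norm_sq, b.orthonormal.1 k]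
    simp
  · intro l hl
    rw [b.orthonormal.2 hl, zero_smul]

/-- Diagonal operators. -/
theorem exists_diag (b : HilbertBasis ι ℝ E) (a : ι → ℝ) {M : ℝ} (hM : 0 ≤ M)
    (ha : ∀ k, |a k| ≤ M) :
    ∃ T : E →L[ℝ] E, (∀ k, T (b k) = a k • b k) ∧ ‖T‖ ≤ M := by
  refine exists_clm_of_bessel b _ hM fun s c => ?_
  simp_rw [smul_smul]
  rw [← real_inner_self_eq_norm_sq, b.orthonormal.inner_sum, Finset.mul_sum]
  refine Finset.sum_le_sum fun k _ => ?_
  rw [conj_trivial, ← sq, mul_pow, mul_comm]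
  exact mul_le_mul_of_nonneg_right (sq_le_sq.2 ((ha k).trans (le_abs_self M))) (sq_nonneg _)

/-- `A` is diagonal in the basis `b`, with eigenvalues `a`. -/
def IsEig (A : E →L[ℝ] E) (b : HilbertBasis ι ℝ E) (a : ι → ℝ) : Prop :=
  ∀ k, A (b k) = a k • b k

theorem IsEig.abs_le {A : E →L[ℝ] E} {b : HilbertBasis ι ℝ E} {a : ι → ℝ} (h : IsEig A b a)
    (k : ι) : |a k| ≤ ‖A‖ := by
  have := A.le_opNorm (b k)
  rwa [h k, norm_smul, b.orthonormal.1 k, mul_one, mul_one] at this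

theorem IsEig.inner_basis {A : E →L[ℝ] E} {b : HilbertBasis ι ℝ E} {a : ι → ℝ} (h : IsEig A b a)
    (k : ι) (x : E) : inner ℝ (b k) (A x) = a k * inner ℝ (b k) x := by
  have : (innerSL ℝ (b k)) ∘L A = a k • innerSL ℝ (b k) := by
    refine clm_ext_basis b fun l => ?_
    simp only [ContinuousLinearMap.comp_apply, h l, innerSL_apply_apply,
      smul_apply, inner_smul_right, smul_eq_mul]
    by_cases hkl : k = l
    · rw [hkl]
    · rw [b.orthonormal.2 hkl]; simp
  simpa using congrArg (fun T => T x) this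

theorem IsEig.isSelfAdjoint {A : E →L[ℝ] E} {b : HilbertBasis ι ℝ E} {a : ι → ℝ}
    (h : IsEig A b a) : IsSelfAdjoint A := by
  rw [ContinuousLinearMap.isSelfAdjoint_iff']
  refine clm_ext_basis b fun l => ext_inner_basis b fun k => ?_
  rw [ContinuousLinearMap.adjoint_inner_right, h k, h.inner_basis, inner_smul_left]
  rfl

theorem inner_apply_self_comm {A : E →L[ℝ] E} (hA : IsSelfAdjoint A) (x y : E) :
    inner ℝ (A x) y = inner ℝ x (A y) := by
  conv_lhs => rw [← ContinuousLinearMap.isSelfAdjoint_iff'.1 hA]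
  exact ContinuousLinearMap.adjoint_inner_left _ _ _

theorem IsEig.hasSum_inner {A : E →L[ℝ] E} {b : HilbertBasis ι ℝ E} {a : ι → ℝ} (h : IsEig A b a)
    (x : E) : HasSum (fun k => a k * inner ℝ (b k) x ^ 2) (inner ℝ x (A x)) := by
  refine (b.hasSum_inner_mul_inner x (A x)).congr_fun fun k => ?_
  rw [h.inner_basis, real_inner_comm x]
  ring

theorem IsEig.norm_le {A : E →L[ℝ] E} {b : HilbertBasis ι ℝ E} {a : ι → ℝ} (h : IsEig A b a)
    {M : ℝ} (hM : 0 ≤ M) (ha : ∀ k, |a k| ≤ M) : ‖A‖ ≤ M := by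
  obtain ⟨T, hT, hTM⟩ := exists_diag b a hM ha
  rwa [clm_ext_basis b fun k => (h k).trans (hT k).symm]

theorem IsEig.comp {A B : E →L[ℝ] E} {b : HilbertBasis ι ℝ E} {a a' : ι → ℝ} (h : IsEig A b a)
    (h' : IsEig B b a') : IsEig (A ∘L B) b (fun k => a k * a' k) := fun k => by
  rw [ContinuousLinearMap.comp_apply, h' k, map_smul, h k, smul_smul, mul_comm]

theorem IsEig.add {A B : E →L[ℝ] E} {b : HilbertBasis ι ℝ E} {a a' : ι → ℝ} (h : IsEig A b a)
    (h' : IsEig B b a') : IsEig (A + B) b (fun k => a k + a' k) := fun k => by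
  rw [add_apply, h' k, h k, add_smul]

theorem IsEig.sub {A B : E →L[ℝ] E} {b : HilbertBasis ι ℝ E} {a a' : ι → ℝ} (h : IsEig A b a)
    (h' : IsEig B b a') : IsEig (A - B) b (fun k => a k - a' k) := fun k => by
  rw [sub_apply, h' k, h k, sub_smul]

theorem isEig_one (b : HilbertBasis ι ℝ E) : IsEig 1 b (fun _ => 1) := fun k => by simp

theorem isEig_smul_one (c : ℝ) (b : HilbertBasis ι ℝ E) : IsEig (c • 1) b (fun _ => c) :=
  fun k => by simp

/-- Comparing coefficients, an eigenvector has no component along basis vectors of another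
eigenvalue. This makes the functional calculus independent of the eigenbasis. -/
theorem IsEig.mem_of_mul {A : E →L[ℝ] E} {b : HilbertBasis ι ℝ E} {a : ι → ℝ} (h : IsEig A b a)
    {c : ℝ} {v : E} (hv : A v = c • v) (k : ι) : a k = c ∨ inner ℝ (b k) v = 0 := by
  have h1 := h.inner_basis k v
  rw [hv, inner_smul_right] at h1
  have : (a k - c) * inner ℝ (b k) v = 0 := by linarith
  rcases mul_eq_zero.1 this with h2 | h2
  · left; linarith
  · right; exact h2

/-- The functional calculus of an operator with an orthonormal basis of eigenvectors. -/
theorem IsEig.opFun {A : E →L[ℝ] E} {b : HilbertBasis ι ℝ E} {a : ι → ℝ} (h : IsEig A b a)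
    (φ : ℝ → ℝ) {M : ℝ} (hM : ∀ k, |φ (a k)| ≤ M) :
    IsEig (opFun φ A) b (fun k => φ (a k)) := by
  -- The diagonal operator with entries `φ (a k)` acts correctly on every eigenvector, not only on
  -- the basis, so the choice in the definition of `opFun` is not the default `0`. Boundedness of
  -- `φ` on the eigenvalues is what makes it an operator.
  have hex : ∃ B : E →L[ℝ] E, ∀ (c : ℝ) (v : E), A v = c • v → B v = φ c • v := by
    obtain ⟨T, hT, -⟩ := exists_diag b (fun k => φ (a k)) (le_max_right M 0)
      (fun k => (hM k).trans (le_max_left _ _))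
    refine ⟨T, fun c v hv => ext_inner_basis b fun k => ?_⟩
    rw [IsEig.inner_basis (a := fun k => φ (a k)) hT, inner_smul_right]
    rcases h.mem_of_mul hv k with h2 | h2
    · rw [h2]
    · rw [h2]; simp
  intro k
  rw [FGL.opFun, dif_pos hex]
  exact hex.choose_spec _ _ (h k)

/-- The eigenvectors of a compact self-adjoint operator form an orthonormal basis. -/
theorem exists_isEig_of_isCompact {A : E →L[ℝ] E} (hA : IsSelfAdjoint A)
    (hc : IsCompactOperator A) :
    ∃ (b : HilbertBasis (Σ c : ℝ, onbIndex (Module.End.eigenspace (A : E →ₗ[ℝ] E) c)) ℝ E)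
      (a : (Σ c : ℝ, onbIndex (Module.End.eigenspace (A : E →ₗ[ℝ] E) c)) → ℝ), IsEig A b a := by
  have hsym : (A : E →ₗ[ℝ] E).IsSymmetric := ContinuousLinearMap.isSelfAdjoint_iff_isSymmetric.1 hA
  have hfam := hsym.orthogonalFamily_eigenspaces
  have hon := hfam.orthonormal_sigma_orthonormal
    (v_family := fun c => (onb (Module.End.eigenspace (A : E →ₗ[ℝ] E) c) : _ → _))
    (fun c => (onb _).orthonormal)
  have hbot := ContinuousLinearMap.orthogonalComplement_iSup_eigenspaces_eq_bot hc hsym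
  refine ⟨HilbertBasis.mkOfOrthogonalEqBot hon ?_, fun k => k.1, fun k => ?_⟩
  -- A vector orthogonal to the bases of all eigenspaces is orthogonal to the eigenspaces
  -- themselves, and for a compact self-adjoint operator only `0` is.
  · rw [eq_bot_iff, ← hbot]
    intro x hx
    rw [Submodule.mem_orthogonal] at hx
    rw [← Submodule.iInf_orthogonal, Submodule.mem_iInf]
    intro c
    rw [Submodule.mem_orthogonal']
    intro u hu
    have h1 : (innerSL ℝ x) ∘L (Submodule.subtypeL _) =
        (0 : Module.End.eigenspace (A : E →ₗ[ℝ] E) c →L[ℝ] ℝ) := by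
      refine clm_ext_basis (onb _) fun k => ?_
      have := hx _ (Submodule.subset_span ⟨⟨c, k⟩, rfl⟩)
      rw [real_inner_comm] at this
      simpa using this
    simpa using congrArg (fun T => T ⟨u, hu⟩) h1
  · rw [HilbertBasis.coe_mkOfOrthogonalEqBot]
    exact Module.End.mem_eigenspace_iff.1 (onb _ k.2).2

end Basis

/-! ### The Hilbert space of Hilbert-Schmidt operators. -/

section HilbertSchmidt

variable {E F G : Type*}
  [NormedAddCommGroup E] [InnerProductSpace ℝ E] [CompleteSpace E]
  [NormedAddCommGroup F] [InnerProductSpace ℝ F] [CompleteSpace F]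
  [NormedAddCommGroup G] [InnerProductSpace ℝ G] [CompleteSpace G]
  {ι κ : Type*}

/-- The Hilbert-Schmidt norm as a real number. -/
def hs (A : E →L[ℝ] F) : ℝ := (hsNorm A).toReal

/-- The Hilbert-Schmidt inner product. -/
def hsInner (A B : E →L[ℝ] F) : ℝ :=
  ∑' k : onbIndex E, inner ℝ (A (onb E k)) (B (onb E k))

theorem hs_nonneg (A : E →L[ℝ] F) : 0 ≤ hs A := ENNReal.toReal_nonneg

theorem hsNorm_sq (A : E →L[ℝ] F) : hsNorm A ^ 2 = ∑' k : onbIndex E, ‖A (onb E k)‖ₑ ^ 2 := by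
  rw [hsNorm, ← ENNReal.rpow_natCast, ← ENNReal.rpow_mul]
  norm_num

theorem hsNorm_adjoint (A : E →L[ℝ] F) : hsNorm (ContinuousLinearMap.adjoint A) = hsNorm A := by
  rw [hsNorm, hs_sum_adjoint, hsNorm]

theorem hs_adjoint (A : E →L[ℝ] F) : hs (ContinuousLinearMap.adjoint A) = hs A := by
  rw [hs, hsNorm_adjoint, hs]

/-- Parseval in the target gives a double series; summing over `k` first, again by Parseval, leaves
the sum for the adjoint over the fixed basis of `F`. Hence the norm can be computed in any
eigenbasis. -/
theorem tsum_enorm_basis (b : HilbertBasis ι ℝ E) (A : E →L[ℝ] F) :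
    ∑' k, ‖A (b k)‖ₑ ^ 2 = hsNorm A ^ 2 := by
  calc ∑' k, ‖A (b k)‖ₑ ^ 2
      = ∑' (k) (l : onbIndex F), ‖inner ℝ (onb F l) (A (b k))‖ₑ ^ 2 :=
        tsum_congr fun k => (parseval _).symm
    _ = ∑' (l : onbIndex F) (k), ‖inner ℝ (b k) (ContinuousLinearMap.adjoint A (onb F l))‖ₑ ^ 2 := by
        rw [ENNReal.tsum_comm]
        refine tsum_congr fun l => tsum_congr fun k => ?_
        rw [ContinuousLinearMap.adjoint_inner_right, real_inner_comm]
    _ = ∑' l : onbIndex F, ‖ContinuousLinearMap.adjoint A (onb F l)‖ₑ ^ 2 :=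
        tsum_congr fun l => parseval_basis b _
    _ = hsNorm A ^ 2 := by rw [hs_sum_adjoint, hsNorm_sq]

theorem IsHS.ofReal_hs {A : E →L[ℝ] F} (hA : IsHS A) : ENNReal.ofReal (hs A) = hsNorm A :=
  ENNReal.ofReal_toReal hA.ne

theorem IsHS.hasSum_sq {A : E →L[ℝ] F} (hA : IsHS A) (b : HilbertBasis ι ℝ E) :
    HasSum (fun k => ‖A (b k)‖ ^ 2) (hs A ^ 2) := by
  have h := tsum_enorm_basis b A
  have h2 : hs A ^ 2 = (hsNorm A ^ 2).toReal := by rw [hs, ENNReal.toReal_pow]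
  have h3 : ∑' k, ‖A (b k)‖ₑ ^ 2 ≠ ∞ := by
    rw [h]
    exact ENNReal.pow_ne_top (ne_of_lt hA)
  rw [h2, ← h, ENNReal.tsum_toReal_eq (fun k => ENNReal.ne_top_of_tsum_ne_top h3 k)]
  have := ENNReal.summable_toReal h3
  refine this.hasSum.congr_fun fun k => ?_
  simp

theorem isHS_of_summable {A : E →L[ℝ] F} (b : HilbertBasis ι ℝ E)
    (h : Summable fun k => ‖A (b k)‖ ^ 2) : IsHS A := by
  have h1 := ENNReal.ofReal_tsum_of_nonneg (fun k => sq_nonneg ‖A (b k)‖) h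
  simp_rw [ENNReal.ofReal_pow (norm_nonneg _), ofReal_norm] at h1
  rw [tsum_enorm_basis] at h1
  have : hsNorm A ^ 2 < ∞ := h1 ▸ ENNReal.ofReal_lt_top
  exact (ENNReal.pow_lt_top_iff.1 this).resolve_right (by norm_num)

/-- The Hilbert space of Hilbert-Schmidt operators, as a space of square summable families: an
operator is given by the images of the orthonormal basis. -/
abbrev HSL (E F : Type*) [NormedAddCommGroup E] [InnerProductSpace ℝ E] [CompleteSpace E]
    [NormedAddCommGroup F] [InnerProductSpace ℝ F] [CompleteSpace F] :=
  lp (fun _ : onbIndex E => F) 2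

theorem IsHS.memℓp {A : E →L[ℝ] F} (hA : IsHS A) :
    Memℓp (fun k : onbIndex E => A (onb E k)) 2 := by
  refine memℓp_gen ?_
  have := (hA.hasSum_sq (onb E)).summable
  simpa using this

/-- The point of the Hilbert space that represents a Hilbert-Schmidt operator. -/
def ofHS (A : E →L[ℝ] F) (hA : IsHS A) : HSL E F := ⟨fun k => A (onb E k), hA.memℓp⟩

theorem inner_ofHS {A B : E →L[ℝ] F} (hA : IsHS A) (hB : IsHS B) :
    inner ℝ (ofHS A hA) (ofHS B hB) = hsInner A B := lp.inner_eq_tsum _ _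

theorem hsInner_self {A : E →L[ℝ] F} (hA : IsHS A) : hsInner A A = hs A ^ 2 := by
  rw [← (hA.hasSum_sq (onb E)).tsum_eq, hsInner]
  exact tsum_congr fun k => real_inner_self_eq_norm_sq _

theorem norm_ofHS {A : E →L[ℝ] F} (hA : IsHS A) : ‖ofHS A hA‖ = hs A := by
  have h := inner_ofHS hA hA
  rw [hsInner_self hA, real_inner_self_eq_norm_sq] at h
  exact (pow_left_inj₀ (norm_nonneg _) (hs_nonneg A) two_ne_zero).1 h

theorem isHS_zero : IsHS (0 : E →L[ℝ] F) := (HSOp E F).zero_mem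
theorem isHS_smul (c : ℝ) {A : E →L[ℝ] F} (hA : IsHS A) : IsHS (c • A) := (HSOp E F).smul_mem c hA
theorem isHS_neg {A : E →L[ℝ] F} (hA : IsHS A) : IsHS (-A) := (HSOp E F).neg_mem hA
theorem isHS_sub {A B : E →L[ℝ] F} (hA : IsHS A) (hB : IsHS B) : IsHS (A - B) :=
  (HSOp E F).sub_mem hA hB
theorem isHS_sum {σ : Type*} {s : Finset σ} {A : σ → E →L[ℝ] F} (hA : ∀ i ∈ s, IsHS (A i)) :
    IsHS (∑ i ∈ s, A i) := (HSOp E F).sum_mem hA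

theorem ofHS_add {A B : E →L[ℝ] F} (hA : IsHS A) (hB : IsHS B) :
    ofHS (A + B) (isHS_add hA hB) = ofHS A hA + ofHS B hB := rfl
theorem ofHS_sub {A B : E →L[ℝ] F} (hA : IsHS A) (hB : IsHS B) :
    ofHS (A - B) (isHS_sub hA hB) = ofHS A hA - ofHS B hB := rfl
theorem ofHS_smul (c : ℝ) {A : E →L[ℝ] F} (hA : IsHS A) :
    ofHS (c • A) (isHS_smul c hA) = c • ofHS A hA := rfl

theorem hs_add_le {A B : E →L[ℝ] F} (hA : IsHS A) (hB : IsHS B) : hs (A + B) ≤ hs A + hs B := by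
  rw [← norm_ofHS hA, ← norm_ofHS hB, ← norm_ofHS (isHS_add hA hB), ofHS_add hA hB]
  exact norm_add_le _ _

theorem hs_sub_le {A B : E →L[ℝ] F} (hA : IsHS A) (hB : IsHS B) : hs (A - B) ≤ hs A + hs B := by
  rw [← norm_ofHS hA, ← norm_ofHS hB, ← norm_ofHS (isHS_sub hA hB), ofHS_sub hA hB]
  exact norm_sub_le _ _

theorem hs_smul (c : ℝ) {A : E →L[ℝ] F} (hA : IsHS A) : hs (c • A) = |c| * hs A := by
  rw [← norm_ofHS hA, ← norm_ofHS (isHS_smul c hA), ofHS_smul, norm_smul, Real.norm_eq_abs]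

theorem hs_zero : hs (0 : E →L[ℝ] F) = 0 := by
  simpa using hs_smul 0 (isHS_zero (E := E) (F := F))

theorem hs_sum_le {σ : Type*} (s : Finset σ) {A : σ → E →L[ℝ] F} (hA : ∀ i, IsHS (A i)) :
    hs (∑ i ∈ s, A i) ≤ ∑ i ∈ s, hs (A i) := by
  classical
  induction s using Finset.induction_on with
  | empty => simp [hs_zero]
  | insert i s hi ih =>
    rw [Finset.sum_insert hi, Finset.sum_insert hi]
    exact (hs_add_le (hA i) (isHS_sum fun j _ => hA j)).trans (by gcongr)

/-- The coefficients of `A x` are `⟨A* f_k, x⟩`; Cauchy-Schwarz in each of them leaves the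
Hilbert-Schmidt norm of the adjoint. -/
theorem norm_le_hs {A : E →L[ℝ] F} (hA : IsHS A) : ‖A‖ ≤ hs A := by
  refine A.opNorm_le_bound (hs_nonneg A) fun x => ?_
  refine le_of_sq_le_sq ?_ (mul_nonneg (hs_nonneg A) (norm_nonneg x))
  have h1 := (hA.adjoint.hasSum_sq (onb F))
  rw [hs_adjoint] at h1
  have h2 := hasSum_sq_inner_basis (onb F) (A x)
  rw [mul_pow]
  refine hasSum_le (fun k => ?_) h2 (h1.mul_right _)
  rw [← ContinuousLinearMap.adjoint_inner_left, ← mul_pow, ← sq_abs]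
  gcongr
  exact abs_real_inner_le_norm _ _

theorem eq_zero_of_hs_eq_zero {A : E →L[ℝ] F} (hA : IsHS A) (h : hs A = 0) : A = 0 :=
  norm_le_zero_iff.1 (h ▸ norm_le_hs hA)

theorem hs_pos {A : E →L[ℝ] F} (hA : IsHS A) (h : A ≠ 0) : 0 < hs A :=
  (hs_nonneg A).lt_of_ne fun h0 => h (eq_zero_of_hs_eq_zero hA h0.symm)

theorem hs_comp_left_le (B : F →L[ℝ] G) {A : E →L[ℝ] F} (hA : IsHS A) :
    hs (B ∘L A) ≤ ‖B‖ * hs A := by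
  refine le_of_sq_le_sq ?_ (mul_nonneg (norm_nonneg B) (hs_nonneg A))
  rw [mul_pow]
  refine hasSum_le (fun k => ?_) ((hA.comp_left B).hasSum_sq (onb E))
    ((hA.hasSum_sq (onb E)).mul_left _)
  rw [← mul_pow]
  gcongr
  exact B.le_opNorm _

theorem hs_comp_right_le {A : F →L[ℝ] G} (hA : IsHS A) (B : E →L[ℝ] F) :
    hs (A ∘L B) ≤ hs A * ‖B‖ := by
  rw [← hs_adjoint, ContinuousLinearMap.adjoint_comp, mul_comm]
  refine (hs_comp_left_le _ hA.adjoint).trans ?_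
  rw [hs_adjoint, LinearIsometryEquiv.norm_map]

theorem inner_eq_polar (x y : E) : inner ℝ x y = (‖x + y‖ ^ 2 - ‖x - y‖ ^ 2) / 4 := by
  rw [norm_add_sq_real, norm_sub_sq_real]
  ring

/-- Polarization carries basis independence and invariance under adjoints over from the norm to the
inner product. -/
theorem hsInner_eq_polar {A B : E →L[ℝ] F} (hA : IsHS A) (hB : IsHS B) :
    hsInner A B = (hs (A + B) ^ 2 - hs (A - B) ^ 2) / 4 := by
  rw [← inner_ofHS hA hB, ← norm_ofHS (isHS_add hA hB), ← norm_ofHS (isHS_sub hA hB),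
    ofHS_add hA hB, ofHS_sub hA hB, inner_eq_polar]

theorem hsInner_comm (A B : E →L[ℝ] F) : hsInner A B = hsInner B A :=
  tsum_congr fun _ => real_inner_comm _ _

theorem hsInner_adjoint {A B : E →L[ℝ] F} (hA : IsHS A) (hB : IsHS B) :
    hsInner (ContinuousLinearMap.adjoint A) (ContinuousLinearMap.adjoint B) = hsInner A B := by
  rw [hsInner_eq_polar hA hB, hsInner_eq_polar hA.adjoint hB.adjoint, ← map_add, ← map_sub,
    hs_adjoint, hs_adjoint]

theorem hsInner_add_left {A B C : E →L[ℝ] F} (hA : IsHS A) (hB : IsHS B) (hC : IsHS C) :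
    hsInner (A + B) C = hsInner A C + hsInner B C := by
  rw [← inner_ofHS hA hC, ← inner_ofHS hB hC, ← inner_ofHS (isHS_add hA hB) hC, ofHS_add hA hB,
    inner_add_left]

theorem hsInner_sub_left {A B C : E →L[ℝ] F} (hA : IsHS A) (hB : IsHS B) (hC : IsHS C) :
    hsInner (A - B) C = hsInner A C - hsInner B C := by
  rw [← inner_ofHS hA hC, ← inner_ofHS hB hC, ← inner_ofHS (isHS_sub hA hB) hC, ofHS_sub hA hB,
    inner_sub_left]

theorem hsInner_add_right {A B C : E →L[ℝ] F} (hA : IsHS A) (hB : IsHS B) (hC : IsHS C) :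
    hsInner A (B + C) = hsInner A B + hsInner A C := by
  rw [hsInner_comm, hsInner_add_left hB hC hA, hsInner_comm B, hsInner_comm C]

theorem hsInner_sub_right {A B C : E →L[ℝ] F} (hA : IsHS A) (hB : IsHS B) (hC : IsHS C) :
    hsInner A (B - C) = hsInner A B - hsInner A C := by
  rw [hsInner_comm, hsInner_sub_left hB hC hA, hsInner_comm B, hsInner_comm C]

theorem hsInner_smul_left (c : ℝ) (A B : E →L[ℝ] F) :
    hsInner (c • A) B = c * hsInner A B := by
  rw [hsInner, hsInner, ← tsum_mul_left]
  exact tsum_congr fun k => by simp [inner_smul_left]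

theorem hsInner_smul_right (c : ℝ) (A B : E →L[ℝ] F) :
    hsInner A (c • B) = c * hsInner A B := by
  rw [hsInner_comm, hsInner_smul_left, hsInner_comm]

theorem hsInner_zero_left (B : E →L[ℝ] F) : hsInner 0 B = 0 := by simp [hsInner]
theorem hsInner_zero_right (B : E →L[ℝ] F) : hsInner B 0 = 0 := by simp [hsInner]

theorem hsInner_sum_left {σ : Type*} (s : Finset σ) {A : σ → E →L[ℝ] F} {B : E →L[ℝ] F}
    (hA : ∀ i, IsHS (A i)) (hB : IsHS B) :
    hsInner (∑ i ∈ s, A i) B = ∑ i ∈ s, hsInner (A i) B := by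
  classical
  induction s using Finset.induction_on with
  | empty => simp [hsInner_zero_left]
  | insert i s hi ih =>
    rw [Finset.sum_insert hi, Finset.sum_insert hi,
      hsInner_add_left (hA i) (isHS_sum fun j _ => hA j) hB, ih]

theorem abs_hsInner_le {A B : E →L[ℝ] F} (hA : IsHS A) (hB : IsHS B) :
    |hsInner A B| ≤ hs A * hs B := by
  rw [← inner_ofHS hA hB, ← norm_ofHS hA, ← norm_ofHS hB]
  exact abs_real_inner_le_norm _ _

theorem hsInner_comp_left {P : F →L[ℝ] G} {A : E →L[ℝ] F} {B : E →L[ℝ] G} :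
    hsInner (P ∘L A) B = hsInner A (ContinuousLinearMap.adjoint P ∘L B) :=
  tsum_congr fun _ => (ContinuousLinearMap.adjoint_inner_right P _ _).symm

theorem hsInner_comp_right {Q : E →L[ℝ] F} {A : F →L[ℝ] G} {B : E →L[ℝ] G} (hA : IsHS A)
    (hB : IsHS B) : hsInner (A ∘L Q) B = hsInner A (B ∘L ContinuousLinearMap.adjoint Q) := by
  rw [← hsInner_adjoint (hA.comp_right Q) hB, ContinuousLinearMap.adjoint_comp, hsInner_comp_left,
    ← hsInner_adjoint hA (hB.comp_right _), ContinuousLinearMap.adjoint_comp]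

theorem IsHS.hasSum_double_sq {A : E →L[ℝ] F} (hA : IsHS A) (b : HilbertBasis ι ℝ E)
    (f : HilbertBasis κ ℝ F) :
    HasSum (fun q : ι × κ => inner ℝ (f q.2) (A (b q.1)) ^ 2) (hs A ^ 2) := by
  have h1 := fun k => hasSum_sq_inner_basis f (A (b k))
  have hs1 : Summable fun q : ι × κ => inner ℝ (f q.2) (A (b q.1)) ^ 2 := by
    refine (summable_prod_of_nonneg fun q => sq_nonneg _).2 ⟨fun k => (h1 k).summable, ?_⟩
    simp_rw [(h1 _).tsum_eq]
    exact (hA.hasSum_sq b).summable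
  have := hs1.hasSum.prod_fiberwise h1
  rw [← this.unique (hA.hasSum_sq b)]
  exact hs1.hasSum

theorem IsHS.hasSum_double {A B : E →L[ℝ] F} (hA : IsHS A) (hB : IsHS B) (b : HilbertBasis ι ℝ E)
    (f : HilbertBasis κ ℝ F) :
    HasSum (fun q : ι × κ => inner ℝ (f q.2) (A (b q.1)) * inner ℝ (f q.2) (B (b q.1)))
      (hsInner A B) := by
  rw [hsInner_eq_polar hA hB]
  refine ((((isHS_add hA hB).hasSum_double_sq b f).sub
    ((isHS_sub hA hB).hasSum_double_sq b f)).div_const 4).congr_fun fun q => ?_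
  rw [add_apply, sub_apply, inner_add_right, inner_sub_right]
  ring

theorem isHS_of_double_summable {A : E →L[ℝ] F} (b : HilbertBasis ι ℝ E) (f : HilbertBasis κ ℝ F)
    (h : Summable fun q : ι × κ => inner ℝ (f q.2) (A (b q.1)) ^ 2) : IsHS A := by
  refine isHS_of_summable b ?_
  have := ((summable_prod_of_nonneg fun q => sq_nonneg _).1 h).2
  exact this.congr fun k => (hasSum_sq_inner_basis f (A (b k))).tsum_eq

/-- An operator whose matrix is dominated by that of a Hilbert-Schmidt operator. -/
theorem isHS_and_hs_le_of_matrix_le {A B : E →L[ℝ] F} (b : HilbertBasis ι ℝ E)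
    (f : HilbertBasis κ ℝ F) {c : ℝ} (hc : 0 ≤ c) (hB : IsHS B)
    (h : ∀ k l, |inner ℝ (f l) (A (b k))| ≤ c * |inner ℝ (f l) (B (b k))|) :
    IsHS A ∧ hs A ≤ c * hs B := by
  have h1 := (hB.hasSum_double_sq b f).mul_left (c ^ 2)
  have h2 : ∀ q : ι × κ, inner ℝ (f q.2) (A (b q.1)) ^ 2 ≤
      c ^ 2 * inner ℝ (f q.2) (B (b q.1)) ^ 2 := by
    intro q
    rw [← mul_pow, ← sq_abs, ← sq_abs (c * _), abs_mul, abs_of_nonneg hc]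
    gcongr
    exact h q.1 q.2
  have hA : IsHS A := isHS_of_double_summable b f
    (Summable.of_nonneg_of_le (fun q => sq_nonneg _) h2 h1.summable)
  refine ⟨hA, le_of_sq_le_sq ?_ (mul_nonneg hc (hs_nonneg B))⟩
  rw [mul_pow]
  exact hasSum_le h2 (hA.hasSum_double_sq b f) h1

/-- By Cauchy-Schwarz a square summable family satisfies the Bessel inequality with its `ℓ²` norm as
constant. So every point of the complete space `HSL E F`, in which minimizers are sought, is an
operator. -/
theorem exists_opOf (u : HSL E F) : ∃ T : E →L[ℝ] F, ∀ k, T (onb E k) = u k := by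
  have hu : Summable fun k => ‖u k‖ ^ 2 := by
    have := (memℓp_gen_iff (p := 2) (by norm_num)).1 (lp.memℓp u)
    simpa using this
  obtain ⟨T, hT, -⟩ := exists_clm_of_bessel (onb E) (fun k => u k)
    (M := √(∑' k, ‖u k‖ ^ 2)) (Real.sqrt_nonneg _) (fun s c => by
      rw [Real.sq_sqrt (tsum_nonneg fun k => sq_nonneg _)]
      calc ‖∑ k ∈ s, c k • u k‖ ^ 2 ≤ (∑ k ∈ s, ‖u k‖ * |c k|) ^ 2 := by
            gcongr
            refine (norm_sum_le _ _).trans (le_of_eq (Finset.sum_congr rfl fun k _ => ?_))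
            rw [norm_smul, Real.norm_eq_abs, mul_comm]
        _ ≤ (∑ k ∈ s, ‖u k‖ ^ 2) * ∑ k ∈ s, |c k| ^ 2 := Finset.sum_mul_sq_le_sq_mul_sq _ _ _
        _ ≤ (∑' k, ‖u k‖ ^ 2) * ∑ k ∈ s, c k ^ 2 := by
            simp_rw [sq_abs]
            gcongr
            exact hu.sum_le_tsum s fun k _ => sq_nonneg (‖u k‖))
  exact ⟨T, hT⟩

/-- The operator represented by a point of the Hilbert space. -/
def opOf : HSL E F →ₗ[ℝ] E →L[ℝ] F where
  toFun u := (exists_opOf u).choose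
  map_add' u v := clm_ext_basis (onb E) fun k => by
    rw [add_apply, (exists_opOf _).choose_spec, (exists_opOf _).choose_spec,
      (exists_opOf _).choose_spec]
    rfl
  map_smul' c u := clm_ext_basis (onb E) fun k => by
    rw [RingHom.id_apply, smul_apply, (exists_opOf _).choose_spec, (exists_opOf _).choose_spec]
    rfl

theorem opOf_apply_onb (u : HSL E F) (k) : opOf u (onb E k) = u k := (exists_opOf u).choose_spec k

theorem isHS_opOf (u : HSL E F) : IsHS (opOf u) := by
  refine isHS_of_summable (onb E) ?_
  simp_rw [opOf_apply_onb]
  have := (memℓp_gen_iff (p := 2) (by norm_num)).1 (lp.memℓp u)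
  simpa using this

theorem ofHS_opOf (u : HSL E F) : ofHS (opOf u) (isHS_opOf u) = u := by
  ext k
  exact opOf_apply_onb u k

theorem opOf_ofHS {A : E →L[ℝ] F} (hA : IsHS A) : opOf (ofHS A hA) = A :=
  clm_ext_basis (onb E) fun k => opOf_apply_onb _ k

theorem inner_eq_hsInner (u v : HSL E F) : inner ℝ u v = hsInner (opOf u) (opOf v) := by
  rw [← inner_ofHS (isHS_opOf u) (isHS_opOf v), ofHS_opOf, ofHS_opOf]

theorem norm_eq_hs (u : HSL E F) : ‖u‖ = hs (opOf u) := by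
  rw [← norm_ofHS (isHS_opOf u), ofHS_opOf]

theorem norm_opOf_le (u : HSL E F) : ‖opOf u‖ ≤ ‖u‖ := by
  rw [norm_eq_hs]
  exact norm_le_hs (isHS_opOf u)

theorem continuous_opOf : Continuous (opOf : HSL E F → E →L[ℝ] F) :=
  (opOf.mkContinuous 1 fun u => by rw [one_mul]; exact norm_opOf_le u).continuous

/-- The truncations to finitely many basis vectors have finite rank, and their distance to `A` is at
most the root of a tail of the Hilbert-Schmidt series. -/
theorem IsHS.isCompactOperator {A : E →L[ℝ] F} (hA : IsHS A) : IsCompactOperator A := by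
  classical
  let T : Finset (onbIndex E) → E →L[ℝ] F := fun s =>
    ∑ k ∈ s, ContinuousLinearMap.toSpanSingleton ℝ (A (onb E k)) ∘L innerSL ℝ (onb E k)
  have hT : ∀ s, IsCompactOperator (T s) := by
    intro s
    have hk : ∀ k, ContinuousLinearMap.toSpanSingleton ℝ (A (onb E k)) ∘L innerSL ℝ (onb E k) ∈
        compactOperator (RingHom.id ℝ) E F := by
      intro k
      have h1 : IsCompactOperator (_root_.id : ℝ → ℝ) :=
        isCompactOperator_id
      exact (h1.comp_clm (innerSL ℝ (onb E k))).clm_comp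
        (ContinuousLinearMap.toSpanSingleton ℝ (A (onb E k)))
    have := Submodule.sum_mem (compactOperator (RingHom.id ℝ) E F)
      (fun k (_ : k ∈ s) => hk k)
    exact this
  have hTb : ∀ s k, (A - T s) (onb E k) = if k ∈ s then 0 else A (onb E k) := by
    intro s k
    simp only [T, sub_apply, sum_apply, ContinuousLinearMap.comp_apply, innerSL_apply_apply,
      ContinuousLinearMap.toSpanSingleton_apply]
    have : ∀ l, inner ℝ (onb E l) (onb E k) = if l = k then (1 : ℝ) else 0 :=
      fun l => orthonormal_iff_ite.1 (onb E).orthonormal l k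
    simp_rw [this, ite_smul, one_smul, zero_smul]
    rw [Finset.sum_ite_eq']
    split_ifs <;> simp
  have hlim : Filter.Tendsto T Filter.atTop (nhds A) := by
    rw [tendsto_iff_norm_sub_tendsto_zero]
    have hsq := hA.hasSum_sq (onb E)
    have h0 := tendsto_tsum_compl_atTop_zero fun k => ‖A (onb E k)‖ ^ 2
    have h2 : ∀ s, ‖T s - A‖ ≤ √(∑' k : { k // k ∉ s }, ‖A (onb E k)‖ ^ 2) := by
      intro s
      have e1 : (fun k => ‖(A - T s) (onb E k)‖ ^ 2) =
          Set.indicator {k | k ∉ s} fun k => ‖A (onb E k)‖ ^ 2 := by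
        ext k
        rw [hTb, Set.indicator_apply]
        by_cases hk : k ∈ s <;> simp [hk]
      have hs' : Summable fun k => ‖(A - T s) (onb E k)‖ ^ 2 := by
        rw [e1]
        exact hsq.summable.indicator _
      have hHS := isHS_of_summable (onb E) hs'
      rw [norm_sub_rev]
      refine (norm_le_hs hHS).trans (Real.le_sqrt_of_sq_le ?_)
      rw [← (hHS.hasSum_sq (onb E)).tsum_eq, e1]
      exact (tsum_subtype {k | k ∉ s} fun k => ‖A (onb E k)‖ ^ 2).ge
    refine squeeze_zero (fun _ => norm_nonneg _) h2 ?_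
    have := h0.sqrt
    rwa [Real.sqrt_zero] at this
  exact isClosed_setOfPred_isCompactOperator.mem_of_tendsto hlim (Filter.Eventually.of_forall hT)

/-- Self-adjoint Hilbert-Schmidt operators are diagonalizable. -/
theorem IsHS.exists_isEig {A : E →L[ℝ] E} (hA : IsHS A) (hsa : IsSelfAdjoint A) :
    ∃ (b : HilbertBasis (Σ c : ℝ, onbIndex (Module.End.eigenspace (A : E →ₗ[ℝ] E) c)) ℝ E)
      (a : (Σ c : ℝ, onbIndex (Module.End.eigenspace (A : E →ₗ[ℝ] E) c)) → ℝ), IsEig A b a :=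
  exists_isEig_of_isCompact hsa hA.isCompactOperator

theorem IsEig.isHS_iff {A : E →L[ℝ] E} {b : HilbertBasis ι ℝ E} {a : ι → ℝ} (h : IsEig A b a) :
    IsHS A ↔ Summable fun k => a k ^ 2 := by
  have e : ∀ k, ‖A (b k)‖ ^ 2 = a k ^ 2 := fun k => by
    rw [h k, norm_smul, b.orthonormal.1 k, mul_one, Real.norm_eq_abs, sq_abs]
  exact ⟨fun hA => (hA.hasSum_sq b).summable.congr e,
    fun hs => isHS_of_summable b (hs.congr fun k => (e k).symm)⟩

end HilbertSchmidt

/-! ### Scalar bounds for the second-order remainder of `x - log x`. -/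

theorem log_gap_lower {u v T : ℝ} (hu : 0 < u) (hv : 0 < v) (huT : u ≤ T) (hvT : v ≤ T) :
    1 / (4 * T ^ 2) * (v - u) ^ 2 ≤
      (v - Real.log v) - (u - Real.log u) - (1 - 1 / u) * (v - u) := by
  have hT : 0 < T := hu.trans_le huT
  -- The remainder equals `s² - 1 - 2 log s ≥ (s - 1)²`, while `v - u = u (s + 1) (s - 1)` and `u (s
  -- + 1) = u + √(u v) ≤ 2 T`. This is the source of `1 / (4 T²)`.
  set s := √(v / u) with hs
  have hs0 : 0 < s := Real.sqrt_pos.2 (div_pos hv hu)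
  have hs2 : s ^ 2 = v / u := Real.sq_sqrt (div_pos hv hu).le
  have hvs : v = s ^ 2 * u := by rw [hs2]; field_simp
  have hlog : Real.log v - Real.log u = 2 * Real.log s := by
    rw [← Real.log_div hv.ne' hu.ne', ← hs2, Real.log_pow]
    norm_num
  have h1 := Real.log_le_sub_one_of_pos hs0
  have h2 : (v - Real.log v) - (u - Real.log u) - (1 - 1 / u) * (v - u) =
      s ^ 2 - 1 - 2 * Real.log s := by
    have : (v - Real.log v) - (u - Real.log u) - (1 - 1 / u) * (v - u) =
      (v - u) / u - (Real.log v - Real.log u) := by field_simp; ring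
    rw [this, hlog, sub_div, div_self hu.ne', hs2]
  rw [h2]
  have h3 : u * s ≤ T := by
    refine abs_le_of_sq_le_sq' ?_ hT.le |>.2
    calc (u * s) ^ 2 = u * v := by rw [hvs]; ring
      _ ≤ T * T := mul_le_mul huT hvT hv.le hT.le
      _ = T ^ 2 := by ring
  have h4 : (u * (s + 1)) ^ 2 ≤ (2 * T) ^ 2 := by
    refine pow_le_pow_left₀ (by positivity) ?_ 2
    nlinarith
  have h5 : 1 / (4 * T ^ 2) * (v - u) ^ 2 ≤ (s - 1) ^ 2 := by
    rw [one_div, inv_mul_le_iff₀ (by positivity)]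
    have : (v - u) ^ 2 = (u * (s + 1)) ^ 2 * (s - 1) ^ 2 := by rw [hvs]; ring
    rw [this]
    refine (mul_le_mul_of_nonneg_right h4 (sq_nonneg _)).trans (le_of_eq (by ring))
  nlinarith

/-- The inequality `log x ≥ 1 - 1/x` at `x = v / u` bounds the remainder by `(v - u)² / (u v)`. -/
theorem log_gap_upper {u v c : ℝ} (hc : 0 < c) (hu : c ≤ u) (hv : c ≤ v) :
    (v - Real.log v) - (u - Real.log u) - (1 - 1 / u) * (v - u) ≤ 1 / c ^ 2 * (v - u) ^ 2 := by
  have hu0 : 0 < u := hc.trans_le hu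
  have hv0 : 0 < v := hc.trans_le hv
  have h1 := Real.one_sub_inv_le_log_of_pos (div_pos hv0 hu0)
  rw [Real.log_div hv0.ne' hu0.ne'] at h1
  have h2 : (v - Real.log v) - (u - Real.log u) - (1 - 1 / u) * (v - u) ≤
      (v - u) ^ 2 / (u * v) := by
    have : (v - u) ^ 2 / (u * v) = (v - u) / u - (1 - (v / u)⁻¹) := by field_simp
    rw [this]
    have : (v - Real.log v) - (u - Real.log u) - (1 - 1 / u) * (v - u) =
      (v - u) / u - (Real.log v - Real.log u) := by field_simp; ring
    rw [this]
    linarith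
  refine h2.trans ?_
  rw [div_eq_mul_one_div, mul_comm]
  refine mul_le_mul_of_nonneg_right ?_ (sq_nonneg _)
  refine one_div_le_one_div_of_le (by positivity) ?_
  rw [sq]
  exact mul_le_mul hu hv hc.le hu0.le

/-! ### The Carleman-Fredholm determinant: spectral formula, gradient and curvature. -/

section Determinant

variable {E : Type*} [NormedAddCommGroup E] [InnerProductSpace ℝ E] [CompleteSpace E]
  {ι κ : Type*}

theorem IsEig.tendsto_zero {A : E →L[ℝ] E} {b : HilbertBasis ι ℝ E} {a : ι → ℝ}
    (h : IsEig A b a) (hA : IsHS A) : Filter.Tendsto a Filter.cofinite (nhds 0) := by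
  have h1 := ((h.isHS_iff.1 hA).tendsto_cofinite_zero).sqrt
  simp_rw [Real.sqrt_sq_eq_abs, Real.sqrt_zero] at h1
  exact (tendsto_zero_iff_abs_tendsto_zero a).2 h1

theorem IsEig.finite_fiber {A : E →L[ℝ] E} {b : HilbertBasis ι ℝ E} {a : ι → ℝ}
    (h : IsEig A b a) (hA : IsHS A) {c : ℝ} (hc : 0 < c) : {k | c ≤ |a k|}.Finite := by
  have h1 := (h.tendsto_zero hA).eventually (Metric.ball_mem_nhds (0 : ℝ) hc)
  refine (Filter.eventually_cofinite.1 h1).subset fun k hk => ?_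
  simpa using hk

/-- Eigenvalues of a Hilbert-Schmidt operator tend to zero, so only finitely many have modulus at
least `1/2`, and a finite set of positive numbers is bounded below. -/
theorem IsEig.exists_gap {A : E →L[ℝ] E} {b : HilbertBasis ι ℝ E} {a : ι → ℝ}
    (h : IsEig A b a) (hA : IsHS A) (ha : ∀ k, 0 < 1 + a k) : ∃ c, 0 < c ∧ ∀ k, c ≤ 1 + a k := by
  have hfin := h.finite_fiber hA (c := 1 / 2) (by norm_num)
  obtain ⟨M, hM⟩ := (hfin.image fun k => (1 + a k)⁻¹).bddAbove
  refine ⟨min (1 / 2) (max M 1)⁻¹, by positivity, fun k => ?_⟩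
  by_cases hk : 1 / 2 ≤ |a k|
  · refine (min_le_right _ _).trans ?_
    have h1 : (1 + a k)⁻¹ ≤ max M 1 := (hM ⟨k, hk, rfl⟩).trans (le_max_left _ _)
    exact inv_le_of_inv_le₀ (ha k) h1
  · refine (min_le_left _ _).trans ?_
    have := (abs_lt.1 (not_le.1 hk)).1
    linarith

theorem IsEig.inverse {A : E →L[ℝ] E} {b : HilbertBasis ι ℝ E} {a : ι → ℝ} (h : IsEig A b a)
    {c : ℝ} (hc : 0 < c) (ha : ∀ k, c ≤ a k) :
    IsUnit A ∧ IsEig (Ring.inverse A) b (fun k => (a k)⁻¹) := by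
  obtain ⟨T, hT, -⟩ := exists_diag b (fun k => (a k)⁻¹) (M := c⁻¹) (by positivity) fun k => by
    rw [abs_of_pos (inv_pos.2 (hc.trans_le (ha k)))]
    exact inv_anti₀ hc (ha k)
  have hne : ∀ k, a k ≠ 0 := fun k => (hc.trans_le (ha k)).ne'
  have h1 : A * T = 1 := clm_ext_basis b fun k => by
    change A (T (b k)) = b k
    rw [hT, map_smul, h k, smul_smul, inv_mul_cancel₀ (hne k), one_smul]
  have h2 : T * A = 1 := clm_ext_basis b fun k => by
    change T (A (b k)) = b k
    rw [h k, map_smul, hT, smul_smul, mul_inv_cancel₀ (hne k), one_smul]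
  let U : (E →L[ℝ] E)ˣ := ⟨A, T, h1, h2⟩
  refine ⟨⟨U, rfl⟩, ?_⟩
  have : Ring.inverse A = T := Ring.inverse_unit U
  rw [this]
  exact hT

theorem IsEig.finrank_eigenspace {A : E →L[ℝ] E} {b : HilbertBasis ι ℝ E} {a : ι → ℝ}
    (h : IsEig A b a) (c : ℝ) [Fintype {k // a k = c}] :
    Module.finrank ℝ (Module.End.eigenspace (A : E →ₗ[ℝ] E) c) = Fintype.card {k // a k = c} := by
  let v : {k // a k = c} → Module.End.eigenspace (A : E →ₗ[ℝ] E) c := fun k =>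
    ⟨b k.1, Module.End.mem_eigenspace_iff.2 (by
      have := h k.1
      rw [k.2] at this
      exact this)⟩
  have hv : Orthonormal ℝ v :=
    ⟨fun k => b.orthonormal.1 k.1, fun k l hkl => b.orthonormal.2 fun hh => hkl (Subtype.ext hh)⟩
  have hbot : (Submodule.span ℝ (Set.range v))ᗮ = ⊥ := by
    rw [eq_bot_iff]
    intro x hx
    rw [Submodule.mem_orthogonal] at hx
    have hx0 : (x : E) = 0 := by
      refine ext_inner_basis b fun k => ?_
      rw [inner_zero_right]
      rcases h.mem_of_mul (Module.End.mem_eigenspace_iff.1 x.2) k with hk | hk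
      · exact hx (v ⟨k, hk⟩) (Submodule.subset_span ⟨_, rfl⟩)
      · exact hk
    exact (Submodule.mem_bot ℝ).2 (Subtype.ext hx0)
  exact Module.finrank_eq_card_basis
    ((HilbertBasis.mkOfOrthogonalEqBot hv hbot).toOrthonormalBasis.toBasis)

theorem IsEig.summable_log {A : E →L[ℝ] E} {b : HilbertBasis ι ℝ E} {a : ι → ℝ}
    (h : IsEig A b a) (hA : IsHS A) (ha : ∀ k, 0 < 1 + a k) :
    Summable fun k => a k - Real.log (1 + a k) := by
  obtain ⟨c, hc, hac⟩ := h.exists_gap hA ha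
  have hs := (h.isHS_iff.1 hA).mul_left (1 / (min c 1) ^ 2)
  refine Summable.of_nonneg_of_le (fun k => ?_) (fun k => ?_) hs
  · linarith [Real.log_le_sub_one_of_pos (ha k)]
  · have := log_gap_upper (lt_min hc one_pos) (min_le_right c 1) ((min_le_left c 1).trans (hac k))
    simp only [Real.log_one] at this
    calc a k - Real.log (1 + a k) = _ := by ring
      _ ≤ _ := this
      _ = _ := by ring

/-- Grouping the convergent series by eigenvalue and exponentiating gives the product over distinct
eigenvalues with multiplicities that defines `cfDet`. -/
theorem IsEig.hasSum_log {A : E →L[ℝ] E} {b : HilbertBasis ι ℝ E} {a : ι → ℝ}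
    (h : IsEig A b a) (hA : IsHS A) (ha : ∀ k, 0 < 1 + a k) :
    HasSum (fun k => a k - Real.log (1 + a k)) (-Real.log (cfDet A)) := by
  classical
  have hs := h.summable_log hA ha
  have h1 : HasSum (fun q : Σ c, {k // a k = c} => a q.2.1 - Real.log (1 + a q.2.1))
      (∑' k, (a k - Real.log (1 + a k))) :=
    (Equiv.hasSum_iff (Equiv.sigmaFiberEquiv a)).2 hs.hasSum
  have hfib : ∀ c : ℝ, c ≠ 0 → Finite {k // a k = c} := fun c hc =>
    ((h.finite_fiber hA (abs_pos.2 hc)).subset fun k (hk : a k = c) => by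
      simp only [Set.mem_ofPred_eq, hk]; exact le_rfl).to_subtype
  set m : ℝ → ℕ := fun c => Module.finrank ℝ (Module.End.eigenspace (A : E →ₗ[ℝ] E) c) with hm
  have h2 : ∀ c : ℝ, HasSum (fun k : {k // a k = c} => a k.1 - Real.log (1 + a k.1))
      (m c * (c - Real.log (1 + c))) := by
    intro c
    have e : (fun k : {k // a k = c} => a k.1 - Real.log (1 + a k.1)) =
        fun _ => c - Real.log (1 + c) := by
      ext k; rw [k.2]
    rw [e]
    -- The eigenvalue `0` can have infinite multiplicity, for which `finrank` is `0`; this does no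
    -- harm because its terms vanish.
    by_cases hc : c = 0
    · simp [hc]
    · have := hfib c hc
      have := Fintype.ofFinite {k // a k = c}
      have h3 := hasSum_fintype fun _ : {k // a k = c} => c - Real.log (1 + c)
      rwa [Finset.sum_const, Finset.card_univ, ← h.finrank_eigenspace c, nsmul_eq_mul] at h3
  have h3 := (h1.sigma h2).neg.rexp
  have h4 : cfDet A = Real.exp (-∑' k, (a k - Real.log (1 + a k))) := by
    rw [cfDet, ← h3.tprod_eq]
    refine tprod_congr fun c => ?_
    simp only [Function.comp_apply]
    by_cases hc : c = 0
    · simp [hc]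
    · have := hfib c hc
      have := Fintype.ofFinite {k // a k = c}
      -- When `c` is not an eigenvalue, `1 + c` may be nonpositive and the logarithm is meaningless,
      -- but the exponent is zero.
      by_cases hm0 : m c = 0
      · change _ ^ m c = _
        simp [hm0]
      · have : 0 < Fintype.card {k // a k = c} := by
          rw [← h.finrank_eigenspace c]
          exact Nat.pos_of_ne_zero hm0
        obtain ⟨k⟩ := Fintype.card_pos_iff.1 this
        have hpos : 0 < 1 + c := by rw [← k.2]; exact ha k
        change _ ^ m c = _
        rw [← Real.exp_log (mul_pos hpos (Real.exp_pos _)), ← Real.exp_nat_mul,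
          Real.log_mul hpos.ne' (Real.exp_pos _).ne', Real.log_exp]
        congr 1
        ring
  rw [h4, Real.log_exp, neg_neg]
  exact hs.hasSum

/-- The weights `⟨f_l, b_k⟩²` sum to `1` over `l`, so a single series becomes a double one. This
puts operators diagonal in different bases on a common index set. -/
theorem hasSum_weight_left (b : HilbertBasis ι ℝ E) (f : HilbertBasis κ ℝ E) {x : ι → ℝ} {s : ℝ}
    (hx : HasSum x s) : HasSum (fun q : ι × κ => inner ℝ (f q.2) (b q.1) ^ 2 * x q.1) s := by
  have h1 : ∀ k, HasSum (fun l => inner ℝ (f l) (b k) ^ 2 * x k) (x k) := fun k => by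
    have := (hasSum_sq_inner_basis f (b k)).mul_right (x k)
    rwa [b.orthonormal.1 k, one_pow, one_mul] at this
  have habs : ∀ k, HasSum (fun l => |inner ℝ (f l) (b k) ^ 2 * x k|) |x k| := fun k => by
    have := (hasSum_sq_inner_basis f (b k)).mul_right |x k|
    rw [b.orthonormal.1 k, one_pow, one_mul] at this
    refine this.congr_fun fun l => ?_
    rw [abs_mul, abs_of_nonneg (sq_nonneg _)]
  have hsum : Summable fun q : ι × κ => inner ℝ (f q.2) (b q.1) ^ 2 * x q.1 := by
    refine Summable.of_abs ((summable_prod_of_nonneg fun q => abs_nonneg _).2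
      ⟨fun k => (habs k).summable, ?_⟩)
    exact hx.summable.abs.congr fun k => (habs k).tsum_eq.symm
  have := hsum.hasSum.prod_fiberwise h1
  rw [hx.unique this]
  exact hsum.hasSum

theorem hasSum_weight_right (b : HilbertBasis ι ℝ E) (f : HilbertBasis κ ℝ E) {x : κ → ℝ} {s : ℝ}
    (hx : HasSum x s) : HasSum (fun q : ι × κ => inner ℝ (f q.2) (b q.1) ^ 2 * x q.2) s := by
  have := hasSum_weight_left f b hx
  rw [← (Equiv.prodComm ι κ).hasSum_iff] at this
  refine this.congr_fun fun q => ?_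
  simp [real_inner_comm]

/-- The second-order remainder of `-log det₂` as a sum over pairs of eigenvectors. -/
theorem hasSum_logdet_gap {A B G : E →L[ℝ] E} {b : HilbertBasis ι ℝ E} {f : HilbertBasis κ ℝ E}
    {a : ι → ℝ} {a' : κ → ℝ} (hA : IsEig A b a) (hB : IsEig B f a') (hAS : IsHS A) (hBS : IsHS B)
    (ha : ∀ k, 0 < 1 + a k) (ha' : ∀ l, 0 < 1 + a' l)
    (hG : IsEig G b (fun k => 1 - 1 / (1 + a k))) (hGS : IsHS G) :
    HasSum (fun q : ι × κ => inner ℝ (f q.2) (b q.1) ^ 2 *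
      ((1 + a' q.2 - Real.log (1 + a' q.2)) - (1 + a q.1 - Real.log (1 + a q.1)) -
        (1 - 1 / (1 + a q.1)) * ((1 + a' q.2) - (1 + a q.1))))
      (-Real.log (cfDet B) - -Real.log (cfDet A) - hsInner G (B - A)) := by
  have h1 := hasSum_weight_left b f (hA.hasSum_log hAS ha)
  have h2 := hasSum_weight_right b f (hB.hasSum_log hBS ha')
  -- The matrix coefficients of `B - A` between the two eigenbases are `(a'_l - a_k) ⟨f_l, b_k⟩`, so
  -- the linear term carries the same weights and the remainder becomes a weighted sum of scalar
  -- remainders.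
  have h3 := hGS.hasSum_double (isHS_sub hBS hAS) b f
  refine ((h2.sub h1).sub h3).congr_fun fun q => ?_
  rw [hG q.1, inner_smul_right, sub_apply, inner_sub_right, hA q.1, inner_smul_right,
    hB.inner_basis]
  ring

theorem hasSum_sub_sq {A B : E →L[ℝ] E} {b : HilbertBasis ι ℝ E} {f : HilbertBasis κ ℝ E}
    {a : ι → ℝ} {a' : κ → ℝ} (hA : IsEig A b a) (hB : IsEig B f a') (hAS : IsHS A) (hBS : IsHS B) :
    HasSum (fun q : ι × κ => inner ℝ (f q.2) (b q.1) ^ 2 * ((1 + a' q.2) - (1 + a q.1)) ^ 2)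
      (hs (B - A) ^ 2) := by
  refine ((isHS_sub hBS hAS).hasSum_double_sq b f).congr_fun fun q => ?_
  rw [sub_apply, inner_sub_right, hA q.1, inner_smul_right, hB.inner_basis]
  ring

theorem IsEig.pos_of_forall {A : E →L[ℝ] E} {b : HilbertBasis ι ℝ E} {a : ι → ℝ}
    (h : IsEig A b a) (hpos : ∀ x, x ≠ 0 → 0 < inner ℝ x ((1 + A) x)) (k : ι) : 0 < 1 + a k := by
  have h1 := hpos (b k) (b.orthonormal.ne_zero k)
  rwa [((isEig_one b).add h) k, inner_smul_right, real_inner_self_eq_norm_sq, b.orthonormal.1 k,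
    one_pow, mul_one] at h1

theorem IsEig.le_of_forall {A : E →L[ℝ] E} {b : HilbertBasis ι ℝ E} {a : ι → ℝ}
    (h : IsEig A b a) {c : ℝ} (hpos : ∀ x, c * ‖x‖ ^ 2 ≤ inner ℝ x (A x)) (k : ι) : c ≤ a k := by
  have h1 := hpos (b k)
  rwa [h k, inner_smul_right, real_inner_self_eq_norm_sq, b.orthonormal.1 k,
    one_pow, mul_one, mul_one] at h1

/-- The gradient of `-log det₂(I + A)`. -/
def gradLog (A : E →L[ℝ] E) : E →L[ℝ] E := 1 - Ring.inverse (1 + A)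

/-- Since `1 - 1 / (1 + a) = a / (1 + a)`, the gradient is `(1 + A)⁻¹ A`, hence Hilbert-Schmidt
although its two terms need not be. -/
theorem IsEig.gradLog {A : E →L[ℝ] E} {b : HilbertBasis ι ℝ E} {a : ι → ℝ} (h : IsEig A b a)
    (hA : IsHS A) (ha : ∀ k, 0 < 1 + a k) :
    IsUnit (1 + A) ∧ IsEig (gradLog A) b (fun k => 1 - 1 / (1 + a k)) ∧ IsHS (gradLog A) := by
  obtain ⟨c, hc, hac⟩ := h.exists_gap hA ha
  obtain ⟨hu, hi⟩ := ((isEig_one b).add h).inverse hc hac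
  have hg : IsEig (FGL.gradLog A) b (fun k => 1 - 1 / (1 + a k)) := fun k => by
    simp only [one_div]
    exact ((isEig_one b).sub hi) k
  refine ⟨hu, hg, ?_⟩
  have : FGL.gradLog A = Ring.inverse (1 + A) ∘L A := by
    refine clm_ext_basis b fun k => ?_
    rw [hg k, ContinuousLinearMap.comp_apply, h k, map_smul, hi k, smul_smul]
    congr 1
    have := (ha k).ne'
    field_simp
    ring
  rw [this]
  exact hA.comp_left _

theorem isHS_gradLog {A : E →L[ℝ] E} (hA : IsHS A) (hsa : IsSelfAdjoint A)
    (hpos : ∀ x, x ≠ 0 → 0 < inner ℝ x ((1 + A) x)) :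
    IsUnit (1 + A) ∧ IsHS (gradLog A) ∧ IsSelfAdjoint (gradLog A) := by
  obtain ⟨b, a, h⟩ := hA.exists_isEig hsa
  obtain ⟨h1, h2, h3⟩ := h.gradLog hA (h.pos_of_forall hpos)
  exact ⟨h1, h3, h2.isSelfAdjoint⟩

/-- Strong convexity of `-log det₂(I + A)`. -/
theorem logdet_gap_lower {A B : E →L[ℝ] E} (hA : IsHS A) (hB : IsHS B) (hsA : IsSelfAdjoint A)
    (hsB : IsSelfAdjoint B) (hpA : ∀ x, x ≠ 0 → 0 < inner ℝ x ((1 + A) x))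
    (hpB : ∀ x, x ≠ 0 → 0 < inner ℝ x ((1 + B) x)) {T : ℝ} (hTA : 1 + ‖A‖ ≤ T)
    (hTB : 1 + ‖B‖ ≤ T) :
    1 / (4 * T ^ 2) * hs (B - A) ^ 2 ≤
      -Real.log (cfDet B) - -Real.log (cfDet A) - hsInner (gradLog A) (B - A) := by
  obtain ⟨b, a, h⟩ := hA.exists_isEig hsA
  obtain ⟨f, a', h'⟩ := hB.exists_isEig hsB
  have ha := h.pos_of_forall hpA
  have ha' := h'.pos_of_forall hpB
  obtain ⟨-, hg, hgS⟩ := h.gradLog hA ha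
  refine hasSum_le (fun q => ?_) ((hasSum_sub_sq h h' hA hB).mul_left _)
    (hasSum_logdet_gap h h' hA hB ha ha' hg hgS)
  have h1 := (le_abs_self _).trans (h.abs_le q.1)
  have h2 := (le_abs_self _).trans (h'.abs_le q.2)
  have := log_gap_lower (ha q.1) (ha' q.2) (T := T) (by linarith) (by linarith)
  rw [mul_left_comm]
  exact mul_le_mul_of_nonneg_left this (sq_nonneg _)

/-- Quadratic upper bound for `-log det₂(I + A)`. -/
theorem logdet_gap_upper {A B : E →L[ℝ] E} (hA : IsHS A) (hB : IsHS B) (hsA : IsSelfAdjoint A)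
    (hsB : IsSelfAdjoint B) {c : ℝ} (hc : 0 < c)
    (hpA : ∀ x, c * ‖x‖ ^ 2 ≤ inner ℝ x ((1 + A) x))
    (hpB : ∀ x, c * ‖x‖ ^ 2 ≤ inner ℝ x ((1 + B) x)) :
    -Real.log (cfDet B) - -Real.log (cfDet A) - hsInner (gradLog A) (B - A) ≤
      1 / c ^ 2 * hs (B - A) ^ 2 := by
  obtain ⟨b, a, h⟩ := hA.exists_isEig hsA
  obtain ⟨f, a', h'⟩ := hB.exists_isEig hsB
  have ha := ((isEig_one b).add h).le_of_forall hpA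
  have ha' := ((isEig_one f).add h').le_of_forall hpB
  obtain ⟨-, hg, hgS⟩ := h.gradLog hA fun k => hc.trans_le (ha k)
  refine hasSum_le (fun q => ?_) (hasSum_logdet_gap h h' hA hB (fun k => hc.trans_le (ha k))
    (fun k => hc.trans_le (ha' k)) hg hgS) ((hasSum_sub_sq h h' hA hB).mul_left _)
  have := log_gap_upper hc (ha q.1) (ha' q.2)
  rw [mul_left_comm]
  exact mul_le_mul_of_nonneg_left this (sq_nonneg _)

end Determinant

/-! ### Operator matrices on the product space and truncation to a set of pairs. -/

section Blocks

variable {p : ℕ} {H : Fin p → Type*} [∀ i, NormedAddCommGroup (H i)]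
  [∀ i, InnerProductSpace ℝ (H i)] [∀ i, CompleteSpace (H i)]

theorem incl_apply (j : Fin p) (x : H j) (i : Fin p) :
    incl H j x i = (Pi.single j x : ∀ i, H i) i := rfl

theorem proj_comp_incl_self (i : Fin p) : PiLp.proj 2 H i ∘L incl H i = 1 := by
  ext x
  simp [incl_apply]

theorem proj_comp_incl_ne {i j : Fin p} (h : i ≠ j) : PiLp.proj 2 H i ∘L incl H j = 0 := by
  ext x
  simp [incl_apply, h]

theorem adjoint_incl (j : Fin p) : ContinuousLinearMap.adjoint (incl H j) = PiLp.proj 2 H j := by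
  rw [eq_comm, ContinuousLinearMap.eq_adjoint_iff]
  intro x y
  rw [PiLp.inner_apply, Finset.sum_eq_single j]
  · simp [incl_apply]
  · intro i _ hi
    simp [incl_apply, hi]
  · simp

theorem adjoint_proj (j : Fin p) : ContinuousLinearMap.adjoint (PiLp.proj 2 H j : PiLp 2 H →L[ℝ] H j) =
    incl H j := by
  rw [← adjoint_incl, ContinuousLinearMap.adjoint_adjoint]

theorem sum_incl_proj : ∑ i, incl H i ∘L PiLp.proj 2 H i = 1 := by
  ext x i
  simp only [sum_apply, ContinuousLinearMap.comp_apply, PiLp.proj_apply, WithLp.ofLp_sum,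
    Finset.sum_apply, incl_apply]
  rw [Finset.sum_eq_single i]
  · simp
  · intro j _ hj
    simp [hj.symm]
  · simp

theorem entry_toOp (M : ∀ i j, H j →L[ℝ] H i) (i j : Fin p) : entry (toOp M) i j = M i j := by
  ext x
  simp only [entry, toOp, ContinuousLinearMap.comp_apply, sum_apply, PiLp.proj_apply,
    WithLp.ofLp_sum, Finset.sum_apply, incl_apply]
  rw [Finset.sum_eq_single i]
  · rw [Finset.sum_eq_single j]
    · simp
    · intro l _ hl
      simp [hl]
    · simp
  · intro k _ hk
    refine Finset.sum_eq_zero fun l _ => ?_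
    simp [hk.symm]
  · simp

theorem toOp_entry (A : PiLp 2 H →L[ℝ] PiLp 2 H) : toOp (entry A) = A := by
  have h1 : toOp (entry A) =
      (∑ i, incl H i ∘L PiLp.proj 2 H i) ∘L A ∘L (∑ j, incl H j ∘L PiLp.proj 2 H j) := by
    ext x
    simp only [toOp, entry, sum_apply, ContinuousLinearMap.comp_apply, map_sum]
    rw [Finset.sum_comm]
  rw [h1, sum_incl_proj]
  rfl

theorem ext_entry {A B : PiLp 2 H →L[ℝ] PiLp 2 H} (h : ∀ i j, entry A i j = entry B i j) :
    A = B := by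
  rw [← toOp_entry A, ← toOp_entry B]
  exact congrArg toOp (funext fun i => funext fun j => h i j)

theorem entry_add (A B : PiLp 2 H →L[ℝ] PiLp 2 H) (i j : Fin p) :
    entry (A + B) i j = entry A i j + entry B i j := by
  ext x; simp [entry]

theorem entry_sub (A B : PiLp 2 H →L[ℝ] PiLp 2 H) (i j : Fin p) :
    entry (A - B) i j = entry A i j - entry B i j := by
  ext x; simp [entry]

theorem entry_neg (A : PiLp 2 H →L[ℝ] PiLp 2 H) (i j : Fin p) :
    entry (-A) i j = -entry A i j := by
  ext x; simp [entry]

theorem entry_smul (c : ℝ) (A : PiLp 2 H →L[ℝ] PiLp 2 H) (i j : Fin p) :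
    entry (c • A) i j = c • entry A i j := by
  ext x; simp [entry]

theorem entry_one_self (i : Fin p) : entry (1 : PiLp 2 H →L[ℝ] PiLp 2 H) i i = 1 :=
  proj_comp_incl_self i

theorem entry_one_ne {i j : Fin p} (h : i ≠ j) :
    entry (1 : PiLp 2 H →L[ℝ] PiLp 2 H) i j = 0 := proj_comp_incl_ne h

theorem entry_zero (i j : Fin p) : entry (0 : PiLp 2 H →L[ℝ] PiLp 2 H) i j = 0 := by
  ext x; simp [entry]

theorem entry_adjoint (A : PiLp 2 H →L[ℝ] PiLp 2 H) (i j : Fin p) :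
    entry (ContinuousLinearMap.adjoint A) i j = ContinuousLinearMap.adjoint (entry A j i) := by
  rw [entry, entry, ContinuousLinearMap.adjoint_comp, ContinuousLinearMap.adjoint_comp,
    adjoint_incl, adjoint_proj]
  rfl

theorem entry_of_isSelfAdjoint {A : PiLp 2 H →L[ℝ] PiLp 2 H} (hA : IsSelfAdjoint A)
    (i j : Fin p) : entry A i j = ContinuousLinearMap.adjoint (entry A j i) := by
  rw [← entry_adjoint, ContinuousLinearMap.isSelfAdjoint_iff'.1 hA]

theorem isSelfAdjoint_of_entry {A : PiLp 2 H →L[ℝ] PiLp 2 H}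
    (h : ∀ i j, entry A i j = ContinuousLinearMap.adjoint (entry A j i)) : IsSelfAdjoint A := by
  rw [ContinuousLinearMap.isSelfAdjoint_iff']
  refine ext_entry fun i j => ?_
  rw [entry_adjoint, h i j]

theorem entry_comp (A B : PiLp 2 H →L[ℝ] PiLp 2 H) (i j : Fin p) :
    entry (A ∘L B) i j = ∑ k, entry A i k ∘L entry B k j := by
  have : A ∘L B = A ∘L (∑ k, incl H k ∘L PiLp.proj 2 H k) ∘L B := by
    rw [sum_incl_proj]; rfl
  rw [this]
  ext x
  simp [entry]

theorem apply_eq_sum_entry (A : PiLp 2 H →L[ℝ] PiLp 2 H) (x : PiLp 2 H) (i : Fin p) :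
    A x i = ∑ j, entry A i j (x j) := by
  have : A x = A ((∑ k, incl H k ∘L PiLp.proj 2 H k) x) := by rw [sum_incl_proj]; rfl
  rw [this]
  simp [entry]

theorem isHS_entry {A : PiLp 2 H →L[ℝ] PiLp 2 H} (hA : IsHS A) (i j : Fin p) :
    IsHS (entry A i j) := (hA.comp_right _).comp_left _

theorem isHS_toOp {M : ∀ i j, H j →L[ℝ] H i} (hM : ∀ i j, IsHS (M i j)) : IsHS (toOp M) :=
  isHS_sum fun i _ => isHS_sum fun j _ => ((hM i j).comp_right _).comp_left _

theorem isHS_of_entry {A : PiLp 2 H →L[ℝ] PiLp 2 H} (hA : ∀ i j, IsHS (entry A i j)) :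
    IsHS A := by
  rw [← toOp_entry A]
  exact isHS_toOp hA

theorem hsInner_eq_sum {A B : PiLp 2 H →L[ℝ] PiLp 2 H} (hA : IsHS A) (hB : IsHS B) :
    hsInner A B = ∑ i, ∑ j, hsInner (entry A i j) (entry B i j) := by
  conv_lhs => rw [← toOp_entry A]
  have hij : ∀ i j, IsHS (incl H i ∘L entry A i j ∘L PiLp.proj 2 H j) := fun i j =>
    ((isHS_entry hA i j).comp_right _).comp_left _
  rw [toOp, hsInner_sum_left _ (fun i => isHS_sum fun j _ => hij i j) hB]
  refine Finset.sum_congr rfl fun i _ => ?_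
  rw [hsInner_sum_left _ (fun j => hij i j) hB]
  refine Finset.sum_congr rfl fun j _ => ?_
  rw [hsInner_comp_left, adjoint_incl, hsInner_comp_right (isHS_entry hA i j) (hB.comp_left _),
    adjoint_proj]
  rfl

theorem hs_sq_eq_sum {A : PiLp 2 H →L[ℝ] PiLp 2 H} (hA : IsHS A) :
    hs A ^ 2 = ∑ i, ∑ j, hs (entry A i j) ^ 2 := by
  rw [← hsInner_self hA, hsInner_eq_sum hA hA]
  exact Finset.sum_congr rfl fun i _ => Finset.sum_congr rfl fun j _ =>
    hsInner_self (isHS_entry hA i j)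

theorem hs_entry_le {A : PiLp 2 H →L[ℝ] PiLp 2 H} (hA : IsHS A) (i j : Fin p) :
    hs (entry A i j) ≤ hs A := by
  refine le_of_sq_le_sq ?_ (hs_nonneg A)
  rw [hs_sq_eq_sum hA]
  refine (Finset.single_le_sum (f := fun j => hs (entry A i j) ^ 2) (fun _ _ => sq_nonneg _)
    (Finset.mem_univ j)).trans ?_
  exact Finset.single_le_sum (f := fun i => ∑ j, hs (entry A i j) ^ 2)
    (fun _ _ => Finset.sum_nonneg fun _ _ => sq_nonneg _) (Finset.mem_univ i)

/-- The Schur test for self-adjoint operator matrices. -/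
theorem abs_inner_le_of_rowSum {A : PiLp 2 H →L[ℝ] PiLp 2 H} (hA : IsSelfAdjoint A) {N : ℝ}
    (hN : ∀ i, ∑ j, ‖entry A i j‖ ≤ N) (x : PiLp 2 H) :
    |inner ℝ x (A x)| ≤ N * ‖x‖ ^ 2 := by
  have hsym : ∀ i j, ‖entry A i j‖ = ‖entry A j i‖ := fun i j => by
    rw [entry_of_isSelfAdjoint hA i j, LinearIsometryEquiv.norm_map]
  have hx : ‖x‖ ^ 2 = ∑ i, ‖x i‖ ^ 2 := PiLp.norm_sq_eq_of_L2 _ x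
  have h1 : ∑ i, ∑ j, ‖entry A i j‖ * ‖x i‖ ^ 2 ≤ N * ‖x‖ ^ 2 := by
    rw [hx, Finset.mul_sum]
    refine Finset.sum_le_sum fun i _ => ?_
    rw [← Finset.sum_mul]
    exact mul_le_mul_of_nonneg_right (hN i) (sq_nonneg _)
  have h2 : ∑ i, ∑ j, ‖entry A i j‖ * ‖x j‖ ^ 2 ≤ N * ‖x‖ ^ 2 := by
    rw [Finset.sum_comm]
    refine le_of_eq_of_le ?_ h1
    exact Finset.sum_congr rfl fun i _ => Finset.sum_congr rfl fun j _ => by rw [hsym]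
  rw [PiLp.inner_apply]
  calc |∑ i, inner ℝ (x i) (A x i)|
      ≤ ∑ i, ∑ j, ‖entry A i j‖ * (‖x i‖ * ‖x j‖) := by
        refine (Finset.abs_sum_le_sum_abs _ _).trans (Finset.sum_le_sum fun i _ => ?_)
        rw [apply_eq_sum_entry, inner_sum]
        refine (Finset.abs_sum_le_sum_abs _ _).trans (Finset.sum_le_sum fun j _ => ?_)
        refine (abs_real_inner_le_norm _ _).trans ?_
        have := (entry A i j).le_opNorm (x j)
        nlinarith [norm_nonneg (x i)]
    _ ≤ ∑ i, ∑ j, (‖entry A i j‖ * ‖x i‖ ^ 2 + ‖entry A i j‖ * ‖x j‖ ^ 2) / 2 := by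
        refine Finset.sum_le_sum fun i _ => Finset.sum_le_sum fun j _ => ?_
        nlinarith [mul_nonneg (norm_nonneg (entry A i j)) (sq_nonneg (‖x i‖ - ‖x j‖))]
    _ = (∑ i, ∑ j, ‖entry A i j‖ * ‖x i‖ ^ 2 + ∑ i, ∑ j, ‖entry A i j‖ * ‖x j‖ ^ 2) / 2 := by
        simp_rw [← Finset.sum_div, Finset.sum_add_distrib]
    _ ≤ N * ‖x‖ ^ 2 := by linarith

/-- The truncation of an operator matrix to the entries in `S`. -/
def trunc (S : Finset (Fin p × Fin p)) (A : PiLp 2 H →L[ℝ] PiLp 2 H) : PiLp 2 H →L[ℝ] PiLp 2 H :=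
  toOp fun i j => if (i, j) ∈ S then entry A i j else 0

theorem entry_trunc (S : Finset (Fin p × Fin p)) (A : PiLp 2 H →L[ℝ] PiLp 2 H) (i j : Fin p) :
    entry (trunc S A) i j = if (i, j) ∈ S then entry A i j else 0 := entry_toOp _ i j

theorem isHS_trunc (S : Finset (Fin p × Fin p)) {A : PiLp 2 H →L[ℝ] PiLp 2 H} (hA : IsHS A) :
    IsHS (trunc S A) := isHS_toOp fun i j => by
  split_ifs
  · exact isHS_entry hA i j
  · exact isHS_zero

theorem trunc_add (S : Finset (Fin p × Fin p)) (A B : PiLp 2 H →L[ℝ] PiLp 2 H) :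
    trunc S (A + B) = trunc S A + trunc S B := ext_entry fun i j => by
  rw [entry_add, entry_trunc, entry_trunc, entry_trunc, entry_add]
  split_ifs <;> simp

theorem trunc_smul (S : Finset (Fin p × Fin p)) (c : ℝ) (A : PiLp 2 H →L[ℝ] PiLp 2 H) :
    trunc S (c • A) = c • trunc S A := ext_entry fun i j => by
  rw [entry_smul, entry_trunc, entry_trunc, entry_smul]
  split_ifs <;> simp

theorem hs_trunc_le (S : Finset (Fin p × Fin p)) {A : PiLp 2 H →L[ℝ] PiLp 2 H} (hA : IsHS A) :
    hs (trunc S A) ≤ hs A := by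
  refine le_of_sq_le_sq ?_ (hs_nonneg A)
  rw [hs_sq_eq_sum hA, hs_sq_eq_sum (isHS_trunc S hA)]
  refine Finset.sum_le_sum fun i _ => Finset.sum_le_sum fun j _ => ?_
  rw [entry_trunc]
  split_ifs
  · exact le_rfl
  · rw [hs_zero, zero_pow two_ne_zero]
    exact sq_nonneg _

theorem hsInner_trunc_left (S : Finset (Fin p × Fin p)) {A B : PiLp 2 H →L[ℝ] PiLp 2 H}
    (hA : IsHS A) (hB : IsHS B) : hsInner (trunc S A) B = hsInner A (trunc S B) := by
  rw [hsInner_eq_sum (isHS_trunc S hA) hB, hsInner_eq_sum hA (isHS_trunc S hB)]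
  refine Finset.sum_congr rfl fun i _ => Finset.sum_congr rfl fun j _ => ?_
  rw [entry_trunc, entry_trunc]
  split_ifs
  · rfl
  · rw [hsInner_zero_left, hsInner_zero_right]

theorem trunc_trunc (S : Finset (Fin p × Fin p)) (A : PiLp 2 H →L[ℝ] PiLp 2 H) :
    trunc S (trunc S A) = trunc S A := ext_entry fun i j => by
  rw [entry_trunc, entry_trunc]
  split_ifs <;> rfl

theorem isSelfAdjoint_trunc {S : Finset (Fin p × Fin p)} (hS : ∀ i j, (i, j) ∈ S → (j, i) ∈ S)
    {A : PiLp 2 H →L[ℝ] PiLp 2 H} (hA : IsSelfAdjoint A) : IsSelfAdjoint (trunc S A) := by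
  refine isSelfAdjoint_of_entry fun i j => ?_
  rw [entry_trunc, entry_trunc]
  by_cases h : (i, j) ∈ S
  · rw [if_pos h, if_pos (hS _ _ h), ← entry_of_isSelfAdjoint hA]
  · rw [if_neg h, if_neg fun h' => h (hS _ _ h'), map_zero]

end Blocks

/-! ### Norms of maps between spaces of Hilbert-Schmidt operators. -/

section OperatorNorms

variable {E F E' F' : Type*}
  [NormedAddCommGroup E] [InnerProductSpace ℝ E] [CompleteSpace E]
  [NormedAddCommGroup F] [InnerProductSpace ℝ F] [CompleteSpace F]
  [NormedAddCommGroup E'] [InnerProductSpace ℝ E'] [CompleteSpace E']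
  [NormedAddCommGroup F'] [InnerProductSpace ℝ F'] [CompleteSpace F']

theorem hs_le_hsOpNorm {T : HSOp E F →ₗ[ℝ] HSOp E' F'} (hT : hsOpNorm T ≠ ∞) (X : HSOp E F) :
    hs (T X : E' →L[ℝ] F') ≤ (hsOpNorm T).toReal * hs (X : E →L[ℝ] F) := by
  by_cases hX : hs (X : E →L[ℝ] F) = 0
  · have : X = 0 := Subtype.ext (eq_zero_of_hs_eq_zero X.2 hX)
    rw [this, map_zero]
    simp [hs_zero]
  have hpos : 0 < hs (X : E →L[ℝ] F) := (hs_nonneg _).lt_of_ne (Ne.symm hX)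
  set c := hs (X : E →L[ℝ] F)
  have h1 : hsNorm ((c⁻¹ • X : HSOp E F) : E →L[ℝ] F) ≤ 1 := by
    rw [← (c⁻¹ • X : HSOp E F).2.ofReal_hs]
    refine ENNReal.ofReal_le_one.2 ?_
    change hs (c⁻¹ • (X : E →L[ℝ] F)) ≤ 1
    rw [hs_smul _ X.2, abs_of_pos (inv_pos.2 hpos)]
    exact (inv_mul_cancel₀ hX).le
  have h2 : hsNorm (T (c⁻¹ • X) : E' →L[ℝ] F') ≤ hsOpNorm T :=
    le_iSup₂_of_le (c⁻¹ • X) h1 le_rfl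
  have h3 := ENNReal.toReal_mono hT h2
  change hs (T (c⁻¹ • X) : E' →L[ℝ] F') ≤ _ at h3
  rw [map_smul] at h3
  change hs (c⁻¹ • (T X : E' →L[ℝ] F')) ≤ _ at h3
  rw [hs_smul _ (T X).2, abs_of_pos (inv_pos.2 hpos), inv_mul_le_iff₀ hpos] at h3
  linarith

theorem hsOpNorm_le {T : HSOp E F →ₗ[ℝ] HSOp E' F'} {c : ℝ} (hc : 0 ≤ c)
    (h : ∀ X : HSOp E F, hs (T X : E' →L[ℝ] F') ≤ c * hs (X : E →L[ℝ] F)) :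
    hsOpNorm T ≤ ENNReal.ofReal c := by
  refine iSup₂_le fun X hX => ?_
  rw [← (T X).2.ofReal_hs]
  refine ENNReal.ofReal_le_ofReal ((h X).trans ?_)
  have : hs (X : E →L[ℝ] F) ≤ 1 := by
    rw [← X.2.ofReal_hs] at hX
    exact ENNReal.ofReal_le_one.1 hX
  nlinarith

end OperatorNorms

/-! ### Surjectivity of coercive operators. -/

section LaxMilgram

variable {V : Type*} [NormedAddCommGroup V] [InnerProductSpace ℝ V] [CompleteSpace V]

theorem surjective_of_coercive (T : V →L[ℝ] V) {c : ℝ} (hc : 0 < c)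
    (h : ∀ u, c * ‖u‖ ^ 2 ≤ inner ℝ (T u) u) : Function.Surjective T := by
  let B : V →L[ℝ] V →L[ℝ] ℝ := (innerSL ℝ : V →L[ℝ] V →L[ℝ] ℝ) ∘L T
  have hB : IsCoercive B := ⟨c, hc, fun u => by
    have := h u
    rw [mul_assoc, ← sq]
    exact this⟩
  intro v
  refine ⟨hB.continuousLinearEquivOfBilin.symm v, ?_⟩
  refine ext_inner_right ℝ fun w => ?_
  have := hB.continuousLinearEquivOfBilin_apply (hB.continuousLinearEquivOfBilin.symm v) w
  rw [ContinuousLinearEquiv.apply_symm_apply] at this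
  rw [this]
  rfl

end LaxMilgram

/-! ### The map `Γ` on arrays indexed by the graph: invertibility and row-sum bounds. -/

section Gamma

variable {p : ℕ} {H : Fin p → Type*} [∀ i, NormedAddCommGroup (H i)]
  [∀ i, InnerProductSpace ℝ (H i)] [∀ i, CompleteSpace (H i)] {ι : Type*}

/-- The operator with the entries of an array, and zero entries outside of `S`. -/
def arrOp (S : Finset (Fin p × Fin p)) (B : HSArray H S) : PiLp 2 H →L[ℝ] PiLp 2 H :=
  toOp fun i j => if h : (i, j) ∈ S then (B ⟨(i, j), h⟩ : H j →L[ℝ] H i) else 0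

theorem entry_arrOp (S : Finset (Fin p × Fin p)) (B : HSArray H S) (i j : Fin p) :
    entry (arrOp S B) i j = if h : (i, j) ∈ S then (B ⟨(i, j), h⟩ : H j →L[ℝ] H i) else 0 :=
  entry_toOp _ i j

theorem entry_arrOp_mem {S : Finset (Fin p × Fin p)} (B : HSArray H S) (e : S) :
    entry (arrOp S B) e.1.1 e.1.2 = B e := by
  rw [entry_arrOp, dif_pos e.2]

theorem isHS_arrOp (S : Finset (Fin p × Fin p)) (B : HSArray H S) : IsHS (arrOp S B) :=
  isHS_toOp fun i j => by
    split_ifs with h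
    · exact (B ⟨(i, j), h⟩).2
    · exact isHS_zero

/-- The array of the entries in `S` of an operator. -/
def arr (S : Finset (Fin p × Fin p)) (A : PiLp 2 H →L[ℝ] PiLp 2 H) (hA : IsHS A) : HSArray H S :=
  fun e => ⟨entry A e.1.1 e.1.2, isHS_entry hA _ _⟩

theorem arrOp_arr (S : Finset (Fin p × Fin p)) {A : PiLp 2 H →L[ℝ] PiLp 2 H} (hA : IsHS A) :
    arrOp S (arr S A hA) = trunc S A := ext_entry fun i j => by
  rw [entry_arrOp, entry_trunc]
  split_ifs <;> rfl

/-- An array on `S` is an operator that vanishes off `S`. This identity exchanges the block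
description of `Γ` for the product `R A R`, on which all estimates are made. -/
theorem gammaRow_apply (R : ∀ i j, H j →L[ℝ] H i) (S : Finset (Fin p × Fin p)) (e : Fin p × Fin p)
    (B : HSArray H S) : (gammaRow R S e B : H e.2 →L[ℝ] H e.1) =
      entry (toOp R ∘L arrOp S B ∘L toOp R) e.1 e.2 := by
  let g : Fin p × Fin p → (H e.2 →L[ℝ] H e.1) := fun q =>
    R e.1 q.1 ∘L entry (arrOp S B) q.1 q.2 ∘L R q.2 e.2
  have h1 : (gammaRow R S e B : H e.2 →L[ℝ] H e.1) = ∑ q : S, g q := by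
    rw [gammaRow, LinearMap.sum_apply, AddSubmonoidClass.coe_finsetSum]
    refine Finset.sum_congr rfl fun q _ => ?_
    simp only [g]
    rw [entry_arrOp_mem]
    rfl
  have h2 : ∑ q : S, g q = ∑ q, g q := by
    rw [Finset.sum_coe_sort S g]
    refine Finset.sum_subset (Finset.subset_univ _) fun q _ hq => ?_
    simp only [g]
    rw [entry_arrOp, dif_neg hq]
    simp
  rw [h1, h2, Fintype.sum_prod_type, entry_comp]
  refine Finset.sum_congr rfl fun k _ => ?_
  rw [entry_toOp, entry_comp]
  ext x
  simp only [g, sum_apply, ContinuousLinearMap.comp_apply, map_sum, entry_toOp]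

theorem hs_le_rowSum {e : Fin p × Fin p} {S : Finset (Fin p × Fin p)}
    {T : HSArray H S →ₗ[ℝ] HSOp (H e.2) (H e.1)} (hT : rowSum T ≠ ∞) {B : HSArray H S} {M : ℝ}
    (hB : ∀ q : S, hs (B q : H q.1.2 →L[ℝ] H q.1.1) ≤ M) :
    hs (T B : H e.2 →L[ℝ] H e.1) ≤ (rowSum T).toReal * M := by
  have hq : ∀ q : S, hsOpNorm (T ∘ₗ LinearMap.single ℝ
      (fun e : S => HSOp (H e.1.2) (H e.1.1)) q) ≠ ∞ := fun q =>
    ENNReal.sum_ne_top.1 hT q (Finset.mem_univ q)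
  have h1 : (T B : H e.2 →L[ℝ] H e.1) =
      ∑ q : S, ((T ∘ₗ LinearMap.single ℝ (fun e : S => HSOp (H e.1.2) (H e.1.1)) q) (B q) :
        H e.2 →L[ℝ] H e.1) := by
    conv_lhs => rw [← Finset.univ_sum_single B, map_sum, AddSubmonoidClass.coe_finsetSum]
    rfl
  rw [h1, rowSum, ENNReal.toReal_sum fun q _ => hq q, Finset.sum_mul]
  refine (hs_sum_le _ fun q =>
    (T (LinearMap.single ℝ (fun e : S => HSOp (H e.1.2) (H e.1.1)) q (B q))).2).trans
    (Finset.sum_le_sum fun q _ => ?_)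
  exact (hs_le_hsOpNorm (hq q) _).trans (mul_le_mul_of_nonneg_left (hB q) ENNReal.toReal_nonneg)

/-- In the eigenbasis of `R`, the map `A ↦ R A R` multiplies each matrix coefficient by a product of
two eigenvalues, which is at least `c²`: this is the coercivity of `Γ`. -/
theorem IsEig.hsInner_sandwich {E : Type*} [NormedAddCommGroup E] [InnerProductSpace ℝ E]
    [CompleteSpace E] {R A : E →L[ℝ] E} {b : HilbertBasis ι ℝ E} {r : ι → ℝ} (h : IsEig R b r)
    {c : ℝ} (hc : 0 < c) (hr : ∀ k, c ≤ r k) (hA : IsHS A) :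
    c ^ 2 * hs A ^ 2 ≤ hsInner A (R ∘L A ∘L R) := by
  refine hasSum_le (fun q => ?_) ((hA.hasSum_double_sq b b).mul_left _)
    (hA.hasSum_double ((hA.comp_right R).comp_left R) b b)
  have : inner ℝ (b q.2) ((R ∘L A ∘L R) (b q.1)) = r q.2 * r q.1 * inner ℝ (b q.2) (A (b q.1)) := by
    rw [ContinuousLinearMap.comp_apply, ContinuousLinearMap.comp_apply, h.inner_basis, h q.1,
      map_smul, inner_smul_right]
    ring
  rw [this]
  have h2 : c ^ 2 ≤ r q.2 * r q.1 := by
    rw [sq]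
    exact mul_le_mul (hr _) (hr _) hc.le (hc.le.trans (hr _))
  nlinarith [sq_nonneg (inner ℝ (b q.2) (A (b q.1)))]

variable {R : ∀ i j, H j →L[ℝ] H i} {b : HilbertBasis ι ℝ (PiLp 2 H)} {r : ι → ℝ} {c : ℝ}

/-- Pairing with an operator supported on `S` ignores the entries off `S`, so the compression
`Γ_{SS}` inherits the coercivity of `Γ`; Cauchy-Schwarz turns it into a lower bound for the norm. -/
theorem hs_arrOp_le (h : IsEig (toOp R) b r) (hc : 0 < c) (hr : ∀ k, c ≤ r k)
    (S : Finset (Fin p × Fin p)) (B : HSArray H S) :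
    c ^ 2 * hs (arrOp S B) ≤ hs (arrOp S (gammaSS R S B)) := by
  have h1 := h.hsInner_sandwich hc hr (isHS_arrOp S B)
  have hRB : IsHS (toOp R ∘L arrOp S B ∘L toOp R) :=
    ((isHS_arrOp S B).comp_right _).comp_left _
  have h2 : hsInner (arrOp S B) (toOp R ∘L arrOp S B ∘L toOp R) =
      hsInner (arrOp S B) (arrOp S (gammaSS R S B)) := by
    rw [hsInner_eq_sum (isHS_arrOp S B) hRB, hsInner_eq_sum (isHS_arrOp S B) (isHS_arrOp S _)]
    refine Finset.sum_congr rfl fun i _ => Finset.sum_congr rfl fun j _ => ?_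
    by_cases hij : (i, j) ∈ S
    · congr 1
      have := entry_arrOp_mem (gammaSS R S B) ⟨(i, j), hij⟩
      rw [this]
      exact (gammaRow_apply R S (i, j) B).symm
    · rw [entry_arrOp, dif_neg hij, hsInner_zero_left, hsInner_zero_left]
  rw [h2] at h1
  have h3 := (le_abs_self _).trans (abs_hsInner_le (isHS_arrOp S B) (isHS_arrOp S (gammaSS R S B)))
  rcases (hs_nonneg (arrOp S B)).eq_or_lt with h0 | h0
  · rw [← h0, mul_zero]
    exact hs_nonneg _
  · refine le_of_mul_le_mul_left ?_ h0
    linarith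

theorem arrOp_injective (S : Finset (Fin p × Fin p)) {B : HSArray H S} (h : arrOp S B = 0) :
    B = 0 := by
  funext e
  refine Subtype.ext ?_
  rw [← entry_arrOp_mem B e, h, entry_zero]
  rfl

theorem isHS_gammaExt (M : PiLp 2 H →L[ℝ] PiLp 2 H) (S : Finset (Fin p × Fin p))
    {A : PiLp 2 H →L[ℝ] PiLp 2 H} (hA : IsHS A) :
    IsHS (trunc S (M ∘L trunc S A ∘L M) + (A - trunc S A)) :=
  isHS_add (isHS_trunc S (((isHS_trunc S hA).comp_right _).comp_left _))
    (isHS_sub hA (isHS_trunc S hA))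

/-- The regularized extension of `Γ_{SS}` to all Hilbert-Schmidt operators. -/
def gammaExt (R : ∀ i j, H j →L[ℝ] H i) (S : Finset (Fin p × Fin p)) :
    HSL (PiLp 2 H) (PiLp 2 H) →L[ℝ] HSL (PiLp 2 H) (PiLp 2 H) :=
  LinearMap.mkContinuous
    { toFun := fun u => ofHS (trunc S (toOp R ∘L trunc S (opOf u) ∘L toOp R) +
        (opOf u - trunc S (opOf u))) (isHS_gammaExt _ S (isHS_opOf u))
      map_add' := fun u v => by
        rw [← ofHS_add]
        congr 1
        simp only [map_add, trunc_add, ContinuousLinearMap.add_comp, ContinuousLinearMap.comp_add]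
        abel
      map_smul' := fun c u => by
        rw [RingHom.id_apply, ← ofHS_smul]
        congr 1
        simp only [map_smul, trunc_smul, ContinuousLinearMap.smul_comp,
          ContinuousLinearMap.comp_smul, smul_add, smul_sub] }
    (‖toOp R‖ * ‖toOp R‖ + 2) fun u => by
      have h0 := hs_trunc_le S (isHS_opOf u)
      have h1 := isHS_trunc S (isHS_opOf u)
      have h2 := (h1.comp_right (toOp R)).comp_left (toOp R)
      change ‖ofHS _ (isHS_gammaExt (toOp R) S (isHS_opOf u))‖ ≤ _
      rw [norm_ofHS, norm_eq_hs]
      refine (hs_add_le (isHS_trunc S h2) (isHS_sub (isHS_opOf u) h1)).trans ?_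
      have h3 : hs (toOp R ∘L trunc S (opOf u) ∘L toOp R) ≤ ‖toOp R‖ * (hs (opOf u) * ‖toOp R‖) :=
        (hs_comp_left_le _ (h1.comp_right _)).trans (mul_le_mul_of_nonneg_left
          ((hs_comp_right_le h1 _).trans (mul_le_mul_of_nonneg_right h0 (norm_nonneg _)))
          (norm_nonneg _))
      have h4 := hs_trunc_le S h2
      have h5 := hs_sub_le (isHS_opOf u) h1
      linarith

/-- Injectivity is the lower bound. For surjectivity, `Γ_{SS}` is extended by the identity on
operators that vanish on `S`; the extension is coercive on the full Hilbert space with constant `min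
(c²) 1`, and Lax-Milgram applies. -/
theorem gammaSS_bijective (h : IsEig (toOp R) b r) (hc : 0 < c) (hr : ∀ k, c ≤ r k)
    (S : Finset (Fin p × Fin p)) : Function.Bijective (gammaSS R S) := by
  constructor
  · rw [injective_iff_map_eq_zero]
    intro B hB
    have h1 := hs_arrOp_le h hc hr S B
    rw [hB] at h1
    have h0 : arrOp S (0 : HSArray H S) = 0 := ext_entry fun i j => by
      rw [entry_arrOp, entry_zero]
      split_ifs <;> rfl
    rw [h0, hs_zero] at h1
    refine arrOp_injective S (eq_zero_of_hs_eq_zero (isHS_arrOp S B) ?_)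
    have := hs_nonneg (arrOp S B)
    have hc2 : 0 < c ^ 2 := by positivity
    nlinarith
  · intro B
    have hco : ∀ u, min (c ^ 2) 1 * ‖u‖ ^ 2 ≤ inner ℝ (gammaExt R S u) u := by
      intro u
      set A := opOf u with hA
      have hAS : IsHS A := isHS_opOf u
      have hT := isHS_trunc S hAS
      have hRT := (hT.comp_right (toOp R)).comp_left (toOp R)
      have e1 : inner ℝ (gammaExt R S u) u =
          hsInner (trunc S (toOp R ∘L trunc S A ∘L toOp R) + (A - trunc S A)) A := by
        rw [inner_eq_hsInner]
        congr 1
        exact opOf_ofHS (isHS_gammaExt (toOp R) S (isHS_opOf u))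
      have e2 : hsInner (A - trunc S A) A = hs (A - trunc S A) ^ 2 := by
        rw [← hsInner_self (isHS_sub hAS hT), hsInner_sub_right (isHS_sub hAS hT) hAS hT,
          ← hsInner_trunc_left S (isHS_sub hAS hT) hAS]
        have : trunc S (A - trunc S A) = 0 := ext_entry fun i j => by
          rw [entry_trunc, entry_sub, entry_trunc, entry_zero]
          split_ifs <;> simp
        rw [this, hsInner_zero_left, sub_zero]
      have e3 : hs A ^ 2 = hs (trunc S A) ^ 2 + hs (A - trunc S A) ^ 2 := by
        rw [hs_sq_eq_sum hAS, hs_sq_eq_sum hT, hs_sq_eq_sum (isHS_sub hAS hT),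
          ← Finset.sum_add_distrib]
        refine Finset.sum_congr rfl fun i _ => ?_
        rw [← Finset.sum_add_distrib]
        refine Finset.sum_congr rfl fun j _ => ?_
        rw [entry_sub, entry_trunc]
        split_ifs <;> simp [hs_zero]
      rw [e1, norm_eq_hs, ← hA, hsInner_add_left (isHS_trunc S hRT) (isHS_sub hAS hT) hAS,
        hsInner_trunc_left S hRT hAS, hsInner_comm, e2, e3, mul_add]
      have h1 := h.hsInner_sandwich hc hr hT
      have h2 := mul_le_mul_of_nonneg_right (min_le_left (c ^ 2) 1) (sq_nonneg (hs (trunc S A)))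
      have h3 := mul_le_mul_of_nonneg_right (min_le_right (c ^ 2) 1)
        (sq_nonneg (hs (A - trunc S A)))
      linarith
    obtain ⟨u, hu⟩ := surjective_of_coercive (gammaExt R S)
      (lt_min (by positivity : 0 < c ^ 2) one_pos) hco (ofHS (arrOp S B) (isHS_arrOp S B))
    have hu2 := congrArg opOf hu
    rw [opOf_ofHS] at hu2
    have hu3 : trunc S (toOp R ∘L trunc S (opOf u) ∘L toOp R) + (opOf u - trunc S (opOf u)) =
      arrOp S B := (opOf_ofHS (isHS_gammaExt (toOp R) S (isHS_opOf u))).symm.trans hu2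
    refine ⟨arr S (opOf u) (isHS_opOf u), ?_⟩
    funext e
    refine Subtype.ext ?_
    change (gammaRow R S e.1 (arr S (opOf u) (isHS_opOf u)) : H e.1.2 →L[ℝ] H e.1.1) = _
    rw [gammaRow_apply, arrOp_arr, ← entry_arrOp_mem B e, ← hu3, entry_add, entry_sub, entry_trunc,
      entry_trunc, if_pos e.2, if_pos e.2, sub_self, add_zero]

theorem gammaSS_apply_inverse (h : IsEig (toOp R) b r) (hc : 0 < c) (hr : ∀ k, c ≤ r k)
    (S : Finset (Fin p × Fin p)) (B : HSArray H S) :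
    Ring.inverse (gammaSS R S) (gammaSS R S B) = B := by
  have hu : IsUnit (gammaSS R S) := (Module.End.isUnit_iff _).2 (gammaSS_bijective h hc hr S)
  have := Ring.inverse_mul_cancel _ hu
  exact congrArg (fun T : Module.End ℝ (HSArray H S) => T B) this

theorem hs_arrOp_inverse_le (h : IsEig (toOp R) b r) (hc : 0 < c) (hr : ∀ k, c ≤ r k)
    (S : Finset (Fin p × Fin p)) (B : HSArray H S) :
    c ^ 2 * hs (arrOp S (Ring.inverse (gammaSS R S) B)) ≤ hs (arrOp S B) := by
  obtain ⟨D, rfl⟩ := (gammaSS_bijective h hc hr S).2 B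
  rw [gammaSS_apply_inverse h hc hr]
  exact hs_arrOp_le h hc hr S D

theorem hs_arrOp_single (S : Finset (Fin p × Fin p)) (e : S) (X : HSOp (H e.1.2) (H e.1.1)) :
    hs (arrOp S (LinearMap.single ℝ (fun e : S => HSOp (H e.1.2) (H e.1.1)) e X)) =
      hs (X : H e.1.2 →L[ℝ] H e.1.1) := by
  refine (pow_left_inj₀ (hs_nonneg _) (hs_nonneg _) two_ne_zero).1 ?_
  rw [hs_sq_eq_sum (isHS_arrOp S _), ← Fintype.sum_prod_type'
    (f := fun i j => hs (entry (arrOp S (LinearMap.single ℝ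
      (fun e : S => HSOp (H e.1.2) (H e.1.1)) e X)) i j) ^ 2), Finset.sum_eq_single e.1]
  · rw [entry_arrOp_mem, LinearMap.single_apply, Pi.single_eq_same]
  · intro q _ hq
    rw [entry_arrOp]
    split_ifs with hqS
    · rw [LinearMap.single_apply, Pi.single_eq_of_ne]
      · change hs (0 : _ →L[ℝ] _) ^ 2 = 0
        rw [hs_zero]; ring
      · exact fun hh => hq (congrArg Subtype.val hh)
    · rw [hs_zero]; ring
  · simp

theorem hs_lambda_le (h : IsEig (toOp R) b r) (hc : 0 < c) (hr : ∀ k, c ≤ r k)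
    (S : Finset (Fin p × Fin p)) (Y : HSArray H S) (e : S) :
    hs (((Ring.inverse (gammaSS R S) - 1) Y) e : H e.1.2 →L[ℝ] H e.1.1) ≤
      ((c ^ 2)⁻¹ + 1) * hs (arrOp S Y) := by
  have h1 := hs_arrOp_inverse_le h hc hr S Y
  have e1 : ((((Ring.inverse (gammaSS R S) - 1) Y) e : HSOp _ _) : H e.1.2 →L[ℝ] H e.1.1) =
      (Ring.inverse (gammaSS R S) Y e : H e.1.2 →L[ℝ] H e.1.1) - (Y e : _ →L[ℝ] _) := rfl
  rw [e1]
  generalize Ring.inverse (gammaSS R S) Y = Z at h1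
  have h2 := hs_entry_le (isHS_arrOp S Z) e.1.1 e.1.2
  have h3 := hs_entry_le (isHS_arrOp S Y) e.1.1 e.1.2
  rw [entry_arrOp_mem] at h2 h3
  have h4 := hs_sub_le (Z e).2 (Y e).2
  have h5 : hs (arrOp S Z) ≤ (c ^ 2)⁻¹ * hs (arrOp S Y) := by
    rw [← div_eq_inv_mul, le_div_iff₀ (by positivity)]
    linarith
  linarith

/-- Finiteness matters because `gammaConst` passes through `toReal`, which sends `∞` to `0`; without
it the constant would bound nothing. -/
theorem rowSum_lambda_ne_top (h : IsEig (toOp R) b r) (hc : 0 < c) (hr : ∀ k, c ≤ r k)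
    (S : Finset (Fin p × Fin p)) (e : S) :
    rowSum (LinearMap.proj e ∘ₗ (Ring.inverse (gammaSS R S) - 1) :
      HSArray H S →ₗ[ℝ] HSOp (H e.1.2) (H e.1.1)) ≠ ∞ := by
  refine ENNReal.sum_ne_top.2 fun q _ => ne_of_lt ?_
  have hc' : 0 ≤ (c ^ 2)⁻¹ + 1 := by positivity
  refine (hsOpNorm_le hc' fun X => ?_).trans_lt ENNReal.ofReal_lt_top
  rw [← hs_arrOp_single S q X]
  exact hs_lambda_le h hc hr S _ e

theorem one_le_gammaConst (R : ∀ i j, H j →L[ℝ] H i) (S : Finset (Fin p × Fin p)) :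
    1 ≤ gammaConst R S :=
  le_add_of_nonneg_right ENNReal.toReal_nonneg

theorem toReal_le_toReal_iSup {σ : Type*} [Finite σ] {f : σ → ℝ≥0∞} (hf : ∀ i, f i ≠ ∞) (i : σ) :
    (f i).toReal ≤ (⨆ i, f i).toReal :=
  ENNReal.toReal_mono (iSup_ne_top hf) (le_iSup f i)

/-- The maximum norm bound for `Γ_{SS}⁻¹`. -/
theorem hs_le_gammaConst (h : IsEig (toOp R) b r) (hc : 0 < c) (hr : ∀ k, c ≤ r k)
    {S : Finset (Fin p × Fin p)} {D : HSArray H S} {M : ℝ}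
    (hM : ∀ e : S, hs (gammaSS R S D e : H e.1.2 →L[ℝ] H e.1.1) ≤ M) (e : S) :
    hs (D e : H e.1.2 →L[ℝ] H e.1.1) ≤ gammaConst R S * M := by
  set B := gammaSS R S D with hB
  -- The identity part of `Γ_{SS}⁻¹ = I + Λ` is kept apart: it accounts for the summand `1` in `γ`.
  have hD : D = B + (Ring.inverse (gammaSS R S) - 1) B := by
    rw [LinearMap.sub_apply, gammaSS_apply_inverse h hc hr]
    simp
  have h0 : 0 ≤ M := (hs_nonneg _).trans (hM e)
  have h1 := hs_le_rowSum (rowSum_lambda_ne_top h hc hr S e) hM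
  have h2 : (rowSum (LinearMap.proj e ∘ₗ (Ring.inverse (gammaSS R S) - 1) :
      HSArray H S →ₗ[ℝ] HSOp (H e.1.2) (H e.1.1))).toReal ≤ gammaConst R S - 1 := by
    rw [gammaConst, add_sub_cancel_left]
    exact toReal_le_toReal_iSup (fun e => rowSum_lambda_ne_top h hc hr S e) e
  have h3 : hs (D e : H e.1.2 →L[ℝ] H e.1.1) ≤ hs (B e : H e.1.2 →L[ℝ] H e.1.1) +
      hs (((LinearMap.proj e ∘ₗ (Ring.inverse (gammaSS R S) - 1) :
        HSArray H S →ₗ[ℝ] HSOp (H e.1.2) (H e.1.1)) B : HSOp _ _) : H e.1.2 →L[ℝ] H e.1.1) := by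
    conv_lhs => rw [hD]
    exact hs_add_le (B e).2 ((Ring.inverse (gammaSS R S) - 1) B e).2
  have h4 := hM e
  have h5 := mul_le_mul_of_nonneg_right h2 h0
  linarith

/-- The maximum norm bound for `Γ_{eS}` under incoherence. -/
theorem hs_le_of_incoherent (h : IsEig (toOp R) b r) (hc : 0 < c) (hr : ∀ k, c ≤ r k)
    {S : Finset (Fin p × Fin p)} {α : ℝ} (hα : 0 < α) (hinc : Incoherent R S α) {D : HSArray H S}
    {M : ℝ} (hM0 : 0 ≤ M) (hM : ∀ e : S, hs (gammaSS R S D e : H e.1.2 →L[ℝ] H e.1.1) ≤ M)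
    {e : Fin p × Fin p} (he : e ∉ S) :
    α ≤ 1 ∧ hs (gammaRow R S e D : H e.2 →L[ℝ] H e.1) ≤ (1 - α) * M := by
  have h0 := hinc e he
  have hfin : rowSum (gammaRow R S e ∘ₗ Ring.inverse (gammaSS R S)) ≠ ∞ :=
    ne_top_of_le_ne_top ENNReal.one_ne_top (le_self_add.trans h0)
  have h1 := hs_le_rowSum hfin hM
  rw [LinearMap.comp_apply, gammaSS_apply_inverse h hc hr] at h1
  have h2 := ENNReal.toReal_mono ENNReal.one_ne_top h0
  rw [ENNReal.toReal_add hfin ENNReal.ofReal_ne_top, ENNReal.toReal_ofReal hα.le,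
    ENNReal.toReal_one] at h2
  have h3 : 0 ≤ (rowSum (gammaRow R S e ∘ₗ Ring.inverse (gammaSS R S))).toReal :=
    ENNReal.toReal_nonneg
  refine ⟨by linarith, h1.trans (mul_le_mul_of_nonneg_right (by linarith) hM0)⟩

end Gamma

/-! ### Minimizers of strongly convex functions and their continuation in a parameter. -/

section StrongConvexity

variable {V : Type*} [NormedAddCommGroup V] [InnerProductSpace ℝ V]

/-- The tangent inequalities at the midpoint, tested at both ends, have opposite linear terms, which
cancel on addition. -/
theorem midpoint_gap {K : Set V} (hK : Convex ℝ K) {F : V → ℝ} {g : V → V} {m : ℝ}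
    (hF : ∀ x ∈ K, ∀ y ∈ K, F y + inner ℝ (g y) (x - y) + m * ‖x - y‖ ^ 2 ≤ F x) {x y : V}
    (hx : x ∈ K) (hy : y ∈ K) :
    ∃ z ∈ K, 2 * F z + m / 2 * ‖x - y‖ ^ 2 ≤ F x + F y := by
  set z := (1 / 2 : ℝ) • x + (1 / 2 : ℝ) • y with hz
  have hzK : z ∈ K := hK hx hy (by norm_num) (by norm_num) (by norm_num)
  have hxz : x - z = (1 / 2 : ℝ) • (x - y) := by rw [hz]; module
  have hyz : y - z = -((1 / 2 : ℝ) • (x - y)) := by rw [hz]; module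
  have h1 := hF x hx z hzK
  have h2 := hF y hy z hzK
  rw [hxz, norm_smul] at h1
  rw [hyz, inner_neg_right, norm_neg, norm_smul] at h2
  refine ⟨z, hzK, ?_⟩
  have e : ‖(1 / 2 : ℝ)‖ = 1 / 2 := by norm_num
  rw [e] at h1 h2
  nlinarith

/-- The midpoint inequality makes a minimizing sequence Cauchy. No continuity of `F` is needed at
the limit `x₀`: in the tangent inequality at `x₀` the linear term tends to zero, so `F x₀` is at
most the infimum. The midpoint inequality with `x₀` then gives the quadratic growth. -/
theorem exists_min_of_stronglyConvex [CompleteSpace V] {K : Set V} (hK : Convex ℝ K)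
    (hKc : IsClosed K) (hne : K.Nonempty) {F : V → ℝ} {g : V → V} {m : ℝ} (hm : 0 < m)
    (hF : ∀ x ∈ K, ∀ y ∈ K, F y + inner ℝ (g y) (x - y) + m * ‖x - y‖ ^ 2 ≤ F x) :
    ∃ x₀ ∈ K, ∀ x ∈ K, F x₀ + m / 2 * ‖x - x₀‖ ^ 2 ≤ F x := by
  obtain ⟨y₀, hy₀⟩ := hne
  have hbdd : BddBelow (F '' K) := by
    refine ⟨F y₀ - ‖g y₀‖ ^ 2 / (4 * m), ?_⟩
    rintro _ ⟨x, hx, rfl⟩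
    have h1 := hF x hx y₀ hy₀
    have h2 := neg_le_of_abs_le (abs_real_inner_le_norm (g y₀) (x - y₀))
    have h3 : ‖g y₀‖ * ‖x - y₀‖ ≤ ‖g y₀‖ ^ 2 / (4 * m) + m * ‖x - y₀‖ ^ 2 := by
      have h4 : 0 ≤ (‖g y₀‖ - 2 * m * ‖x - y₀‖) ^ 2 / (4 * m) := by positivity
      have h5 : (‖g y₀‖ - 2 * m * ‖x - y₀‖) ^ 2 / (4 * m) =
        ‖g y₀‖ ^ 2 / (4 * m) + m * ‖x - y₀‖ ^ 2 - ‖g y₀‖ * ‖x - y₀‖ := by field_simp; ring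
      linarith
    linarith
  set I := sInf (F '' K) with hI
  have hIle : ∀ x ∈ K, I ≤ F x := fun x hx => csInf_le hbdd ⟨x, hx, rfl⟩
  have hseq : ∀ n : ℕ, ∃ x ∈ K, F x < I + 1 / ((n : ℝ) + 1) := by
    intro n
    obtain ⟨_, ⟨x, hx, rfl⟩, hlt⟩ := exists_lt_of_csInf_lt (⟨_, y₀, hy₀, rfl⟩ : (F '' K).Nonempty)
      (lt_add_of_pos_right I (by positivity : (0 : ℝ) < 1 / ((n : ℝ) + 1)))
    exact ⟨x, hx, hlt⟩
  choose x hxK hxI using hseq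
  have hclose : ∀ n k N : ℕ, N ≤ n → N ≤ k →
      dist (x n) (x k) ≤ √(4 / m * (1 / ((N : ℝ) + 1))) := by
    intro n k N hn hk
    rw [dist_eq_norm]
    refine Real.le_sqrt_of_sq_le ?_
    obtain ⟨z, hzK, hz⟩ := midpoint_gap hK hF (hxK n) (hxK k)
    have h1 := hIle z hzK
    have h2 : 1 / ((n : ℝ) + 1) ≤ 1 / ((N : ℝ) + 1) := by gcongr
    have h3 : 1 / ((k : ℝ) + 1) ≤ 1 / ((N : ℝ) + 1) := by gcongr
    have h4 := hxI n
    have h5 := hxI k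
    have h6 : m / 2 * ‖x n - x k‖ ^ 2 ≤ 2 * (1 / ((N : ℝ) + 1)) := by linarith
    calc ‖x n - x k‖ ^ 2 = 2 / m * (m / 2 * ‖x n - x k‖ ^ 2) := by field_simp
      _ ≤ 2 / m * (2 * (1 / ((N : ℝ) + 1))) := by gcongr
      _ = _ := by ring
  have hlim0 : Filter.Tendsto (fun N : ℕ => √(4 / m * (1 / ((N : ℝ) + 1)))) Filter.atTop
      (nhds 0) := by
    have := ((tendsto_one_div_add_atTop_nhds_zero_nat (𝕜 := ℝ)).const_mul (4 / m)).sqrt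
    simpa using this
  have hcau : CauchySeq x := cauchySeq_of_le_tendsto_0 _ hclose hlim0
  obtain ⟨x₀, hx₀⟩ := cauchySeq_tendsto_of_complete hcau
  have hx₀K : x₀ ∈ K := hKc.mem_of_tendsto hx₀ (Filter.Eventually.of_forall hxK)
  have hmin : F x₀ ≤ I := by
    have h1 : ∀ n, F x₀ + inner ℝ (g x₀) (x n - x₀) ≤ I + 1 / ((n : ℝ) + 1) := by
      intro n
      have h1 := hF (x n) (hxK n) x₀ hx₀K
      have h2 := hxI n
      have h3 : 0 ≤ m * ‖x n - x₀‖ ^ 2 := by positivity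
      linarith
    have h2 : Filter.Tendsto (fun n => F x₀ + inner ℝ (g x₀) (x n - x₀)) Filter.atTop
        (nhds (F x₀ + inner ℝ (g x₀) (x₀ - x₀))) :=
      tendsto_const_nhds.add (tendsto_const_nhds.inner (hx₀.sub tendsto_const_nhds))
    have h3 : Filter.Tendsto (fun n : ℕ => I + 1 / ((n : ℝ) + 1)) Filter.atTop (nhds (I + 0)) :=
      tendsto_const_nhds.add tendsto_one_div_add_atTop_nhds_zero_nat
    have := le_of_tendsto_of_tendsto' h2 h3 h1
    simpa using this
  refine ⟨x₀, hx₀K, fun y hy => ?_⟩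
  obtain ⟨z, hzK, hz⟩ := midpoint_gap hK hF hy hx₀K
  have := hIle z hzK
  linarith

/-- If the minimizers of `F s = F₀ + s L` over `K` that lie in the interior of a ball lie
in a smaller ball, then so does the minimizer for `s = 1`, by continuation from `s = 0`. -/
theorem exists_min_of_continuation [CompleteSpace V] {K : Set V} (hK : Convex ℝ K)
    (hKc : IsClosed K) (h0 : (0 : V) ∈ K) {F₀ L N : V → ℝ} {m B r r' : ℝ} (hm : 0 < m)
    (hL : ∀ x ∈ K, |L x| ≤ B)
    (hF : ∀ s ∈ Set.Icc (0 : ℝ) 1, ∃ g : V → V, ∀ x ∈ K, ∀ y ∈ K,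
      F₀ y + s * L y + inner ℝ (g y) (x - y) + m * ‖x - y‖ ^ 2 ≤ F₀ x + s * L x)
    (hF0 : ∀ x ∈ K, F₀ 0 ≤ F₀ x) (hN : Continuous N) (hN0 : N 0 ≤ r') (hr : r' < r)
    (hstep : ∀ s ∈ Set.Icc (0 : ℝ) 1, ∀ x₀ ∈ K, (∀ x ∈ K, F₀ x₀ + s * L x₀ ≤ F₀ x + s * L x) →
      N x₀ < r → N x₀ ≤ r') :
    ∃ x₀ ∈ K, (∀ x ∈ K, F₀ x₀ + L x₀ ≤ F₀ x + L x) ∧ N x₀ ≤ r' := by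
  have hex : ∀ s : Set.Icc (0 : ℝ) 1, ∃ x₀ ∈ K, ∀ x ∈ K,
      F₀ x₀ + s * L x₀ + m / 2 * ‖x - x₀‖ ^ 2 ≤ F₀ x + s * L x := by
    intro s
    obtain ⟨g, hg⟩ := hF s s.2
    exact exists_min_of_stronglyConvex (F := fun x => F₀ x + s * L x) hK hKc ⟨0, h0⟩ hm hg
  choose ξ hξK hξ using hex
  have hmin : ∀ s : Set.Icc (0 : ℝ) 1, ∀ x ∈ K, F₀ (ξ s) + s * L (ξ s) ≤ F₀ x + s * L x := by
    intro s x hx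
    have h1 := hξ s x hx
    have h2 : 0 ≤ m / 2 * ‖x - ξ s‖ ^ 2 := by positivity
    linarith
  have hB : 0 ≤ B := (abs_nonneg _).trans (hL 0 h0)
  have hcont : Continuous ξ := by
    rw [continuous_iff_continuousAt]
    intro s
    rw [ContinuousAt, tendsto_iff_norm_sub_tendsto_zero]
    -- Adding the growth inequalities of two minimizers, each tested at the other, gives `m ‖ξ t - ξ
    -- s‖² ≤ (t - s) (L (ξ s) - L (ξ t))`, so the path of minimizers is Hölder continuous of order
    -- `1/2`.
    have hb : ∀ t, ‖ξ t - ξ s‖ ≤ √(2 * B / m * |(t : ℝ) - s|) := by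
      intro t
      refine Real.le_sqrt_of_sq_le ?_
      have h1 := hξ s (ξ t) (hξK t)
      have h2 := hξ t (ξ s) (hξK s)
      rw [norm_sub_rev] at h2
      have h3 : m * ‖ξ t - ξ s‖ ^ 2 ≤ ((t : ℝ) - s) * (L (ξ s) - L (ξ t)) := by linarith
      have h4 : |L (ξ s) - L (ξ t)| ≤ 2 * B := by
        have := abs_sub (L (ξ s)) (L (ξ t))
        linarith [hL _ (hξK s), hL _ (hξK t)]
      have h5 : m * ‖ξ t - ξ s‖ ^ 2 ≤ |(t : ℝ) - s| * (2 * B) := by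
        refine h3.trans ((le_abs_self _).trans ?_)
        rw [abs_mul]
        gcongr
      calc ‖ξ t - ξ s‖ ^ 2 = m⁻¹ * (m * ‖ξ t - ξ s‖ ^ 2) := by field_simp
        _ ≤ m⁻¹ * (|(t : ℝ) - s| * (2 * B)) := by gcongr
        _ = _ := by ring
    refine squeeze_zero (fun _ => norm_nonneg _) hb ?_
    have hc : Continuous fun t : Set.Icc (0 : ℝ) 1 => √(2 * B / m * |(t : ℝ) - s|) := by
      fun_prop
    have := hc.tendsto s
    simpa using this
  have hξ0 : ξ ⟨0, by simp⟩ = 0 := by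
    have h1 := hξ ⟨0, by simp⟩ 0 h0
    have h2 := hF0 _ (hξK ⟨0, by simp⟩)
    simp only [zero_mul, add_zero, zero_sub, norm_neg] at h1
    have h3 : ‖ξ ⟨0, by simp⟩‖ ^ 2 ≤ 0 := by
      by_contra hcon
      push Not at hcon
      have : 0 < m / 2 * ‖ξ ⟨0, by simp⟩‖ ^ 2 := by positivity
      linarith
    have h4 : ‖ξ ⟨0, by simp⟩‖ = 0 := by
      have := sq_nonneg ‖ξ ⟨0, by simp⟩‖
      exact pow_eq_zero_iff two_ne_zero |>.1 (le_antisymm h3 this)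
    exact norm_eq_zero.1 h4
  set q : Set.Icc (0 : ℝ) 1 := ⟨1, by simp⟩ with hq
  refine ⟨ξ q, hξK q, fun x hx => by simpa [hq] using hmin q x hx, ?_⟩
  by_contra hcon
  push Not at hcon
  -- If the endpoint were too large, the intermediate value theorem would produce a minimizer of
  -- size `v` strictly between `r'` and `r`, which `hstep` excludes.
  set v := (r' + min r (N (ξ q))) / 2 with hv
  have hv1 : r' < v := by
    have : r' < min r (N (ξ q)) := lt_min hr hcon
    linarith
  have hv2 : v < min r (N (ξ q)) := by
    have : r' < min r (N (ξ q)) := lt_min hr hcon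
    linarith
  have hmem : v ∈ Set.range fun s => N (ξ s) := by
    refine mem_range_of_exists_le_of_exists_ge (hN.comp hcont) ⟨⟨0, by simp⟩, ?_⟩ ⟨q, ?_⟩
    · simp only [hξ0]
      exact hN0.trans hv1.le
    · exact (hv2.trans_le (min_le_right _ _)).le
  obtain ⟨s, hs⟩ := hmem
  simp only at hs
  have := hstep s s.2 (ξ s) (hξK s) (hmin s) (hs ▸ hv2.trans_le (min_le_left _ _))
  linarith

end StrongConvexity

/-! ### The deterministic model: expansion of the inverse and a priori bounds. -/

section Model

variable {p : ℕ} {H : Fin p → Type*} [∀ i, NormedAddCommGroup (H i)]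
  [∀ i, InnerProductSpace ℝ (H i)] [∀ i, CompleteSpace (H i)] {ι : Type*}

theorem IsEig.le_inner {E : Type*} [NormedAddCommGroup E] [InnerProductSpace ℝ E]
    [CompleteSpace E] {A : E →L[ℝ] E} {b : HilbertBasis ι ℝ E} {a : ι → ℝ} (h : IsEig A b a)
    {c : ℝ} (hc : ∀ k, c ≤ a k) (x : E) : c * ‖x‖ ^ 2 ≤ inner ℝ x (A x) :=
  hasSum_le (fun k => mul_le_mul_of_nonneg_right (hc k) (sq_nonneg _))
    ((hasSum_sq_inner_basis b x).mul_left c) (h.hasSum_inner x)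

theorem isSelfAdjoint_ringInverse {E : Type*} [NormedAddCommGroup E] [InnerProductSpace ℝ E]
    [CompleteSpace E] {A : E →L[ℝ] E} (hA : IsSelfAdjoint A) : IsSelfAdjoint (Ring.inverse A) := by
  rw [IsSelfAdjoint, ← Ring.inverse_star, hA.star_eq]

/-- The column sums of the operator norms of the entries of a product. -/
theorem colSum_comp_le {A B : PiLp 2 H →L[ℝ] PiLp 2 H} {N : ℝ}
    (hA : ∀ j, ∑ i, ‖entry A i j‖ ≤ N) (j : Fin p) :
    ∑ i, ‖entry (A ∘L B) i j‖ ≤ N * ∑ k, ‖entry B k j‖ := by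
  calc ∑ i, ‖entry (A ∘L B) i j‖ ≤ ∑ i, ∑ k, ‖entry A i k‖ * ‖entry B k j‖ := by
        refine Finset.sum_le_sum fun i _ => ?_
        rw [entry_comp]
        exact (norm_sum_le _ _).trans
          (Finset.sum_le_sum fun k _ => ContinuousLinearMap.opNorm_comp_le _ _)
    _ = ∑ k, (∑ i, ‖entry A i k‖) * ‖entry B k j‖ := by
        rw [Finset.sum_comm]
        simp_rw [Finset.sum_mul]
    _ ≤ N * ∑ k, ‖entry B k j‖ := by
        rw [Finset.mul_sum]
        exact Finset.sum_le_sum fun k _ => mul_le_mul_of_nonneg_right (hA k) (norm_nonneg _)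

/-- Only the row sums of operator norms of the left factor enter, so bounds on single entries
survive multiplication by `R`, which need not be Hilbert-Schmidt. -/
theorem hs_entry_comp_le_row {A B : PiLp 2 H →L[ℝ] PiLp 2 H} (hB : IsHS B) {N M : ℝ} (hM : 0 ≤ M)
    (hA : ∀ i, ∑ j, ‖entry A i j‖ ≤ N) (hBM : ∀ i j, hs (entry B i j) ≤ M) (i j : Fin p) :
    hs (entry (A ∘L B) i j) ≤ N * M := by
  rw [entry_comp]
  refine (hs_sum_le _ fun k => (isHS_entry hB k j).comp_left _).trans ?_
  calc ∑ k, hs (entry A i k ∘L entry B k j) ≤ ∑ k, ‖entry A i k‖ * M :=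
        Finset.sum_le_sum fun k _ => (hs_comp_left_le _ (isHS_entry hB k j)).trans
          (mul_le_mul_of_nonneg_left (hBM k j) (norm_nonneg _))
    _ ≤ N * M := by
        rw [← Finset.sum_mul]
        exact mul_le_mul_of_nonneg_right (hA i) hM

theorem hs_entry_comp_le_col {A B : PiLp 2 H →L[ℝ] PiLp 2 H} (hA : IsHS A) {N M : ℝ} (hM : 0 ≤ M)
    (hB : ∀ j, ∑ i, ‖entry B i j‖ ≤ N) (hAM : ∀ i j, hs (entry A i j) ≤ M) (i j : Fin p) :
    hs (entry (A ∘L B) i j) ≤ M * N := by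
  rw [entry_comp]
  refine (hs_sum_le _ fun k => (isHS_entry hA i k).comp_right _).trans ?_
  calc ∑ k, hs (entry A i k ∘L entry B k j) ≤ ∑ k, M * ‖entry B k j‖ :=
        Finset.sum_le_sum fun k _ => (hs_comp_right_le (isHS_entry hA i k) _).trans
          (mul_le_mul_of_nonneg_right (hAM i k) (norm_nonneg _))
    _ ≤ M * N := by
        rw [← Finset.mul_sum]
        exact mul_le_mul_of_nonneg_left (hB j) hM

theorem exists_isEig_of_lower {R : ∀ i j, H j →L[ℝ] H i} (hHS : IsHS (toOp R - 1))
    (hsa : IsSelfAdjoint (toOp R)) (hlow : ∃ c > 0, ∀ x, c * ‖x‖ ^ 2 ≤ inner ℝ x (toOp R x)) :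
    ∃ (b : HilbertBasis (Σ c : ℝ, onbIndex (Module.End.eigenspace
        ((toOp R - 1 : PiLp 2 H →L[ℝ] PiLp 2 H) : PiLp 2 H →ₗ[ℝ] PiLp 2 H) c)) ℝ (PiLp 2 H))
      (a : _ → ℝ) (c : ℝ), IsEig (toOp R) b a ∧ 0 < c ∧ ∀ k, c ≤ a k := by
  obtain ⟨b, a, hb⟩ := hHS.exists_isEig (hsa.sub (IsSelfAdjoint.one _))
  obtain ⟨c, hc, hcx⟩ := hlow
  have h1 : IsEig (toOp R) b (fun k => 1 + a k) := by
    have := (isEig_one b).add hb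
    rwa [add_sub_cancel] at this
  exact ⟨b, _, c, h1, hc, h1.le_of_forall hcx⟩

theorem isHS_precision_of_isUnit {R : ∀ i j, H j →L[ℝ] H i} (hHS : IsHS (toOp R - 1))
    (hu : IsUnit (toOp R)) : IsHS (precision R) := by
  have e : precision R = -(Ring.inverse (toOp R) ∘L (toOp R - 1)) := by
    have h1 : Ring.inverse (toOp R) * toOp R = 1 := Ring.inverse_mul_cancel _ hu
    change precision R = -(Ring.inverse (toOp R) * (toOp R - 1))
    rw [mul_sub, h1, precision]
    simp
  rw [e]
  exact isHS_neg (hHS.comp_left _)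

/-- A correlation operator matrix `R` with its precision graph `S`, a perturbation `W` of `R` whose
entries are at most `w`, and a radius `r` for the error of the restricted estimator. -/
structure Model (R : ∀ i j, H j →L[ℝ] H i) (S : Finset (Fin p × Fin p))
    (W : PiLp 2 H →L[ℝ] PiLp 2 H) (ρ w lam r : ℝ) (d : ℕ) : Prop where
  isHS_sub_one : IsHS (toOp R - 1)
  isSelfAdjoint : IsSelfAdjoint (toOp R)
  lower : ∃ c > 0, ∀ x, c * ‖x‖ ^ 2 ≤ inner ℝ x (toOp R x)
  row_le : ∀ i, ∑ j, ‖entry (toOp R) i j‖ ≤ ρ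
  one_le_rho : 1 ≤ ρ
  graph_eq : S = graph (precision R)
  degree_le : ∀ i, (Finset.univ.filter fun j : Fin p => (i, j) ∈ S).card ≤ d
  isHS_pert : IsHS W
  isSelfAdjoint_pert : IsSelfAdjoint W
  pert_le : ∀ i j, hs (entry W i j) ≤ w
  w_pos : 0 < w
  lam_pos : 0 < lam
  r_eq : r = 2 * gammaConst R S * (w + lam)
  -- `small` keeps `1 + H* + D` positive and the column sums of its inverse below `6ρ/5`; `small'`
  -- bounds the quadratic remainder of the inverse; `signal` keeps edges from being cancelled by
  -- `D`.
  small : d * ρ * r ≤ 1 / 6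
  small' : 6 / 5 * ρ ^ 3 * d * r ^ 2 ≤ 2 / 5 * w
  signal : ∀ i j, entry (precision R) i j ≠ 0 → r < hs (entry (precision R) i j)

/-- The self-adjoint Hilbert-Schmidt operators supported on `S` with entries at most `r`. -/
def IsAdmissible (S : Finset (Fin p × Fin p)) (r : ℝ) (D : PiLp 2 H →L[ℝ] PiLp 2 H) : Prop :=
  IsHS D ∧ IsSelfAdjoint D ∧ (∀ i j, (i, j) ∉ S → entry D i j = 0) ∧ ∀ i j, hs (entry D i j) ≤ r

namespace Model

variable {R : ∀ i j, H j →L[ℝ] H i} {S : Finset (Fin p × Fin p)} {W : PiLp 2 H →L[ℝ] PiLp 2 H}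
  {ρ w lam r : ℝ} {d : ℕ} {D : PiLp 2 H →L[ℝ] PiLp 2 H}

theorem exists_isEig (h : Model R S W ρ w lam r d) :
    ∃ (b : HilbertBasis (Σ c : ℝ, onbIndex (Module.End.eigenspace
        ((toOp R - 1 : PiLp 2 H →L[ℝ] PiLp 2 H) : PiLp 2 H →ₗ[ℝ] PiLp 2 H) c)) ℝ (PiLp 2 H))
      (a : _ → ℝ) (c : ℝ), IsEig (toOp R) b a ∧ 0 < c ∧ ∀ k, c ≤ a k :=
  exists_isEig_of_lower h.isHS_sub_one h.isSelfAdjoint h.lower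

theorem r_pos (h : Model R S W ρ w lam r d) : 0 < r := by
  have := one_le_gammaConst R S
  have := h.w_pos
  have := h.lam_pos
  rw [h.r_eq]
  positivity

theorem isUnit (h : Model R S W ρ w lam r d) : IsUnit (toOp R) := by
  obtain ⟨b, a, c, hb, hc, ha⟩ := h.exists_isEig
  exact (hb.inverse hc ha).1

theorem one_add_precision : 1 + precision R = Ring.inverse (toOp R) := by
  rw [precision, add_sub_cancel]

theorem isHS_precision (h : Model R S W ρ w lam r d) : IsHS (precision R) :=
  isHS_precision_of_isUnit h.isHS_sub_one h.isUnit

theorem isSelfAdjoint_precision (h : Model R S W ρ w lam r d) : IsSelfAdjoint (precision R) :=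
  (isSelfAdjoint_ringInverse h.isSelfAdjoint).sub (IsSelfAdjoint.one _)

theorem mem_graph_iff (h : Model R S W ρ w lam r d) (i j : Fin p) :
    (i, j) ∈ S ↔ i = j ∨ entry (precision R) i j ≠ 0 := by
  rw [h.graph_eq]
  unfold graph
  simp

theorem symm_mem (h : Model R S W ρ w lam r d) {i j : Fin p} (hij : (i, j) ∈ S) : (j, i) ∈ S := by
  rw [h.mem_graph_iff] at hij ⊢
  rcases hij with hij | hij
  · exact Or.inl hij.symm
  · refine Or.inr fun h0 => hij ?_
    rw [entry_of_isSelfAdjoint h.isSelfAdjoint_precision, h0, map_zero]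

theorem row_admissible (h : Model R S W ρ w lam r d) (hD : IsAdmissible S r D) (i : Fin p) :
    ∑ j, ‖entry D i j‖ ≤ d * r := by
  calc ∑ j, ‖entry D i j‖ ≤ ∑ j, if (i, j) ∈ S then r else 0 := by
        refine Finset.sum_le_sum fun j _ => ?_
        split_ifs with hij
        · exact (norm_le_hs (isHS_entry hD.1 i j)).trans (hD.2.2.2 i j)
        · rw [hD.2.2.1 i j hij, norm_zero]
    _ = (Finset.univ.filter fun j : Fin p => (i, j) ∈ S).card * r := by
        rw [← Finset.sum_filter, Finset.sum_const, nsmul_eq_mul]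
    _ ≤ d * r := mul_le_mul_of_nonneg_right (by exact_mod_cast h.degree_le i) h.r_pos.le

theorem col_of_row {A : PiLp 2 H →L[ℝ] PiLp 2 H} (hA : IsSelfAdjoint A) {N : ℝ}
    (hN : ∀ i, ∑ j, ‖entry A i j‖ ≤ N) (j : Fin p) : ∑ i, ‖entry A i j‖ ≤ N := by
  refine le_of_eq_of_le (Finset.sum_congr rfl fun i _ => ?_) (hN j)
  rw [entry_of_isSelfAdjoint hA i j, LinearIsometryEquiv.norm_map]

/-- The Schur test bounds the spectrum of `R` by `ρ`, so `1 + H* = R⁻¹ ≥ 1/ρ`; the same test gives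
`D ≥ -d r ≥ -1/(6ρ)`. -/
theorem lower_add (h : Model R S W ρ w lam r d) (hD : IsAdmissible S r D) (x : PiLp 2 H) :
    5 / 6 / ρ * ‖x‖ ^ 2 ≤ inner ℝ x ((1 + (precision R + D)) x) := by
  obtain ⟨b, a, c, hb, hc, ha⟩ := h.exists_isEig
  have hρ : 0 < ρ := one_pos.trans_le h.one_le_rho
  have haρ : ∀ k, a k ≤ ρ := fun k => by
    have h1 := abs_inner_le_of_rowSum h.isSelfAdjoint h.row_le (b k)
    rw [hb k, inner_smul_right, real_inner_self_eq_norm_sq, b.orthonormal.1 k] at h1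
    have := le_abs_self (a k * 1 ^ 2)
    linarith
  have h1 := (hb.inverse hc ha).2.le_inner (c := ρ⁻¹)
    (fun k => inv_anti₀ (hc.trans_le (ha k)) (haρ k)) x
  have h2 := (abs_le.1 (abs_inner_le_of_rowSum hD.2.1 (h.row_admissible hD) x)).1
  rw [← add_assoc, one_add_precision, add_apply, inner_add_right]
  have h3 : d * r ≤ 1 / 6 * ρ⁻¹ := by
    rw [← div_eq_mul_inv, le_div_iff₀ hρ]
    linarith [h.small]
  have h4 := mul_le_mul_of_nonneg_right h3 (sq_nonneg ‖x‖)
  rw [div_eq_mul_inv]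
  linarith

theorem isHS_add_admissible (h : Model R S W ρ w lam r d) (hD : IsAdmissible S r D) :
    IsHS (precision R + D) := isHS_add h.isHS_precision hD.1

theorem isSelfAdjoint_add_admissible (h : Model R S W ρ w lam r d) (hD : IsAdmissible S r D) :
    IsSelfAdjoint (precision R + D) := by
  have h1 := h.isSelfAdjoint_precision
  have h2 := hD.2.1
  exact IsSelfAdjoint.add (R := PiLp 2 H →L[ℝ] PiLp 2 H) h1 h2

theorem pos_add (h : Model R S W ρ w lam r d) (hD : IsAdmissible S r D) (x : PiLp 2 H)
    (hx : x ≠ 0) : 0 < inner ℝ x ((1 + (precision R + D)) x) := by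
  have hρ : 0 < ρ := one_pos.trans_le h.one_le_rho
  have : 0 < ‖x‖ := norm_pos_iff.2 hx
  exact (by positivity : 0 < 5 / 6 / ρ * ‖x‖ ^ 2).trans_le (h.lower_add hD x)

/-- The remainder of the first-order expansion of the inverse. -/
theorem remainder_le (h : Model R S W ρ w lam r d) (hD : IsAdmissible S r D) (i j : Fin p) :
    hs (entry (Ring.inverse (1 + (precision R + D)) - toOp R + toOp R ∘L D ∘L toOp R) i j) ≤
      2 / 5 * w := by
  have hρ : 0 < ρ := one_pos.trans_le h.one_le_rho
  have hr := h.r_pos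
  set M := 1 + (precision R + D) with hM
  have hMu : IsUnit M := (isHS_gradLog (h.isHS_add_admissible hD)
    (h.isSelfAdjoint_add_admissible hD) (h.pos_add hD)).1
  set N := Ring.inverse M with hN
  -- From `R M = 1 + R D` one gets the resolvent identity `N = R - R D N`; used twice, it gives the
  -- remainder `R D R D N`.
  have e1 : N = toOp R - toOp R ∘L D ∘L N := by
    have h1 : M * N = 1 := Ring.mul_inverse_cancel _ hMu
    have h2 : toOp R * M = 1 + toOp R * D := by
      rw [hM, ← add_assoc, one_add_precision, mul_add, Ring.mul_inverse_cancel _ h.isUnit]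
    have h3 : toOp R = N + toOp R * D * N := by
      calc toOp R = toOp R * (M * N) := by rw [h1, mul_one]
        _ = (1 + toOp R * D) * N := by rw [← mul_assoc, h2]
        _ = _ := by rw [add_mul, one_mul]
    rw [eq_sub_iff_add_eq]
    exact h3.symm
  have e2 : N - toOp R + toOp R ∘L D ∘L toOp R = (toOp R ∘L D) ∘L (toOp R ∘L (D ∘L N)) := by
    have h1 : toOp R - N = toOp R ∘L D ∘L N := by
      conv_lhs => rw [e1]
      abel
    rw [← h1, ContinuousLinearMap.comp_sub]
    have h2 : (toOp R ∘L D) ∘L N = toOp R - N := h1.symm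
    rw [h2]
    change _ + (toOp R ∘L D) ∘L toOp R = _
    abel
  have hcR := col_of_row h.isSelfAdjoint h.row_le
  have hcD := col_of_row hD.2.1 (h.row_admissible hD)
  -- The column sum `q` of `N` satisfies `q ≤ ρ + ρ d r q ≤ ρ + q/6`; being finite, it can be
  -- absorbed.
  have hq : ∀ j, ∑ i, ‖entry N i j‖ ≤ 6 / 5 * ρ := by
    intro j
    set q := ∑ i, ‖entry N i j‖ with hq
    have h1 : q ≤ ρ + ρ * (d * r * q) := by
      calc q ≤ ∑ i, (‖entry (toOp R) i j‖ + ‖entry (toOp R ∘L (D ∘L N)) i j‖) := by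
            refine Finset.sum_le_sum fun i _ => ?_
            conv_lhs => rw [e1, entry_sub]
            exact norm_sub_le _ _
        _ ≤ ρ + ρ * (d * r * q) := by
            rw [Finset.sum_add_distrib]
            refine add_le_add (hcR j) ((colSum_comp_le hcR j).trans ?_)
            exact mul_le_mul_of_nonneg_left (colSum_comp_le hcD j) hρ.le
    have h2 : 0 ≤ q := Finset.sum_nonneg fun i _ => norm_nonneg _
    have h3 := mul_le_mul_of_nonneg_right h.small h2
    linarith
  have hcol : ∀ j, ∑ i, ‖entry (toOp R ∘L (D ∘L N)) i j‖ ≤ ρ * (d * r * (6 / 5 * ρ)) := fun j =>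
    (colSum_comp_le hcR j).trans (mul_le_mul_of_nonneg_left ((colSum_comp_le hcD j).trans
      (mul_le_mul_of_nonneg_left (hq j) (by positivity))) hρ.le)
  rw [e2]
  -- The factor `R D` is measured by its largest entry, at most `ρ r`, and `R D N` by its column
  -- sums, at most `ρ · d r · 6ρ/5`. This keeps the degree `d` to the first power.
  refine (hs_entry_comp_le_col (hD.1.comp_left _) (by positivity) hcol
    (hs_entry_comp_le_row hD.1 hr.le h.row_le hD.2.2.2) i j).trans ?_
  refine le_of_eq_of_le ?_ h.small'
  ring

theorem isHS_remainder (h : Model R S W ρ w lam r d) (hD : IsAdmissible S r D) :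
    IsHS (Ring.inverse (1 + (precision R + D)) - toOp R + toOp R ∘L D ∘L toOp R) := by
  have h1 := (isHS_gradLog (h.isHS_add_admissible hD)
    (h.isSelfAdjoint_add_admissible hD) (h.pos_add hD)).2.1
  have e : Ring.inverse (1 + (precision R + D)) - toOp R + toOp R ∘L D ∘L toOp R =
      -gradLog (precision R + D) - (toOp R - 1) + toOp R ∘L D ∘L toOp R := by
    rw [gradLog]; abel
  rw [e]
  exact isHS_add (isHS_sub (isHS_neg h1) h.isHS_sub_one) ((hD.1.comp_right _).comp_left _)

theorem gammaRow_arr (hD : IsAdmissible S r D) (e : Fin p × Fin p) :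
    (gammaRow R S e (arr S D hD.1) : H e.2 →L[ℝ] H e.1) =
      entry (toOp R ∘L D ∘L toOp R) e.1 e.2 := by
  rw [gammaRow_apply, arrOp_arr]
  have : trunc S D = D := ext_entry fun i j => by
    rw [entry_trunc]
    split_ifs with hij
    · rfl
    · exact (hD.2.2.1 i j hij).symm
  rw [this]

/-- The a priori estimate: a solution of the stationarity equation on `S` whose entries are at
most `r` has entries at most `7 r / 10`. -/
theorem apriori (h : Model R S W ρ w lam r d) (hD : IsAdmissible S r D) {s : ℝ}
    (hs0 : 0 ≤ s) (hs1 : s ≤ 1) {Z : PiLp 2 H →L[ℝ] PiLp 2 H} (hZ : IsHS Z)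
    (hZ1 : ∀ i j, hs (entry Z i j) ≤ 1)
    (hstat : ∀ i j, (i, j) ∈ S → entry (toOp R + s • W - Ring.inverse (1 + (precision R + D)) +
      (s * lam) • Z) i j = 0) :
    (∀ e : S, hs (gammaSS R S (arr S D hD.1) e : H e.1.2 →L[ℝ] H e.1.1) ≤ 7 / 5 * w + lam) ∧
    ∀ i j, hs (entry D i j) ≤ 7 / 10 * r := by
  have hM : ∀ e : S, hs (gammaSS R S (arr S D hD.1) e : H e.1.2 →L[ℝ] H e.1.1) ≤
      7 / 5 * w + lam := by
    intro e
    have e1 : (gammaSS R S (arr S D hD.1) e : H e.1.2 →L[ℝ] H e.1.1) =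
        entry (toOp R ∘L D ∘L toOp R) e.1.1 e.1.2 := gammaRow_arr hD e.1
    set Q := Ring.inverse (1 + (precision R + D)) - toOp R + toOp R ∘L D ∘L toOp R with hQ
    -- On `S` the last bracket vanishes by stationarity; the three other terms have sizes `2w/5`,
    -- `w` and `lam`.
    have e2 : toOp R ∘L D ∘L toOp R = Q - s • W - (s * lam) • Z +
        (toOp R + s • W - Ring.inverse (1 + (precision R + D)) + (s * lam) • Z) := by
      rw [hQ]; abel
    rw [e1, e2, entry_add, hstat _ _ e.2, add_zero, entry_sub, entry_sub, entry_smul, entry_smul]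
    have hQS := isHS_entry (h.isHS_remainder hD) e.1.1 e.1.2
    have hWS := isHS_entry h.isHS_pert e.1.1 e.1.2
    have hZS := isHS_entry hZ e.1.1 e.1.2
    have h1 := hs_sub_le (isHS_sub hQS (isHS_smul s hWS)) (isHS_smul (s * lam) hZS)
    have h2 := hs_sub_le hQS (isHS_smul s hWS)
    rw [hs_smul _ hZS, abs_of_nonneg (mul_nonneg hs0 h.lam_pos.le)] at h1
    rw [hs_smul _ hWS, abs_of_nonneg hs0] at h2
    have h3 := h.remainder_le hD e.1.1 e.1.2
    have h4 := h.pert_le e.1.1 e.1.2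
    have h5 := hZ1 e.1.1 e.1.2
    have h6 := hs_nonneg (entry W e.1.1 e.1.2)
    have h7 := hs_nonneg (entry Z e.1.1 e.1.2)
    have h8 : s * lam * hs (entry Z e.1.1 e.1.2) ≤ lam := by
      have := h.lam_pos
      calc s * lam * hs (entry Z e.1.1 e.1.2) ≤ 1 * lam * 1 := by gcongr
        _ = lam := by ring
    have h9 : s * hs (entry W e.1.1 e.1.2) ≤ w := by
      calc s * hs (entry W e.1.1 e.1.2) ≤ 1 * w := by gcongr
        _ = w := one_mul w
    linarith
  refine ⟨hM, fun i j => ?_⟩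
  obtain ⟨b, a, c, hb, hc, ha⟩ := h.exists_isEig
  by_cases hij : (i, j) ∈ S
  -- Here `γ (7w/5 + lam) ≤ (7/5) γ (w + lam) = 7r/10`. The room between `7r/10` and `r` is what the
  -- continuation needs.
  · refine (hs_le_gammaConst hb hc ha hM ⟨(i, j), hij⟩).trans ?_
    have h1 := one_le_gammaConst R S
    have := h.w_pos
    have := h.lam_pos
    rw [h.r_eq]
    have : 0 ≤ gammaConst R S * lam := by positivity
    linarith
  · rw [hD.2.2.1 i j hij, hs_zero]
    linarith [h.r_pos]

/-- Strict dual feasibility off the graph. -/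
theorem dual_le (h : Model R S W ρ w lam r d) (hD : IsAdmissible S r D) {α : ℝ} (hα : 0 < α)
    (hinc : Incoherent R S α) (hlam : lam = 8 / α * w)
    (hM : ∀ e : S, hs (gammaSS R S (arr S D hD.1) e : H e.1.2 →L[ℝ] H e.1.1) ≤ 7 / 5 * w + lam)
    {i j : Fin p} (hij : (i, j) ∉ S) :
    hs (entry (Ring.inverse (1 + (precision R + D)) - (toOp R + W)) i j) ≤ lam := by
  obtain ⟨b, a, c, hb, hc, ha⟩ := h.exists_isEig
  have hw := h.w_pos
  have hl := h.lam_pos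
  obtain ⟨hα1, h1⟩ := hs_le_of_incoherent hb hc ha hα hinc (by positivity) hM hij
  rw [gammaRow_arr hD] at h1
  have e2 : Ring.inverse (1 + (precision R + D)) - (toOp R + W) =
      (Ring.inverse (1 + (precision R + D)) - toOp R + toOp R ∘L D ∘L toOp R) -
        toOp R ∘L D ∘L toOp R - W := by abel
  rw [e2, entry_sub, entry_sub]
  have hQS := isHS_entry (h.isHS_remainder hD) i j
  have hWS := isHS_entry h.isHS_pert i j
  have hRS : IsHS (entry (toOp R ∘L D ∘L toOp R) i j) :=
    isHS_entry ((hD.1.comp_right _).comp_left _) i j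
  have h2 := hs_sub_le (isHS_sub hQS hRS) hWS
  have h3 := hs_sub_le hQS hRS
  have h4 := h.remainder_le hD i j
  have h5 := h.pert_le i j
  have hw2 : w = α * lam / 8 := by rw [hlam]; field_simp
  have h6 : 0 ≤ α * w := by positivity
  -- Because `α lam = 8 w`, incoherence gains `8 w`, more than the errors `7w/5 + 2w/5 + w`.
  have h7 : (1 - α) * (7 / 5 * w + lam) = 7 / 5 * w + lam - 7 / 5 * (α * w) - 8 * w := by
    have : α * lam = 8 * w := by rw [hw2]; ring
    linear_combination (-1 : ℝ) * this
  linarith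

end Model

end Model

/-! ### Closure properties of self-adjoint operators. -/

section SelfAdjoint

variable {E : Type*} [NormedAddCommGroup E] [InnerProductSpace ℝ E] [CompleteSpace E]
  {A B : E →L[ℝ] E}

theorem isSelfAdjoint_add (hA : IsSelfAdjoint A) (hB : IsSelfAdjoint B) : IsSelfAdjoint (A + B) :=
  IsSelfAdjoint.add (R := E →L[ℝ] E) hA hB

theorem isSelfAdjoint_sub (hA : IsSelfAdjoint A) (hB : IsSelfAdjoint B) : IsSelfAdjoint (A - B) :=
  IsSelfAdjoint.sub (R := E →L[ℝ] E) hA hB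

theorem isSelfAdjoint_neg (hA : IsSelfAdjoint A) : IsSelfAdjoint (-A) :=
  IsSelfAdjoint.neg (R := E →L[ℝ] E) hA

theorem isSelfAdjoint_smul (c : ℝ) (hA : IsSelfAdjoint A) : IsSelfAdjoint (c • A) := by
  rw [ContinuousLinearMap.isSelfAdjoint_iff'] at *
  rw [LinearIsometryEquiv.map_smulₛₗ, hA]
  rfl

end SelfAdjoint

/-! ### The group penalty, its subgradient, and the penalized objective. -/

section Penalty

variable {E F : Type*} [NormedAddCommGroup E] [InnerProductSpace ℝ E] [CompleteSpace E]
  [NormedAddCommGroup F] [InnerProductSpace ℝ F] [CompleteSpace F]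

/-- Cauchy-Schwarz; at `A = 0` the convention `0⁻¹ = 0` selects the zero subgradient. -/
theorem hs_subgradient {A B : E →L[ℝ] F} (hA : IsHS A) (hB : IsHS B) :
    hs A + hsInner ((hs A)⁻¹ • A) (B - A) ≤ hs B := by
  rw [hsInner_smul_left, hsInner_sub_right hA hB hA, hsInner_self hA]
  rcases (hs_nonneg A).eq_or_lt with h0 | h0
  · rw [← h0]
    simpa using hs_nonneg B
  · have h1 := (le_abs_self _).trans (abs_hsInner_le hA hB)
    have h2 : hs A + (hs A)⁻¹ * (hsInner A B - hs A ^ 2) = (hs A)⁻¹ * hsInner A B := by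
      field_simp; ring
    rw [h2, inv_mul_le_iff₀ h0]
    exact h1

/-- This is `√(x² + y) ≤ x + y / (2x)` applied to the expanded square: the norm is differentiable
away from zero, with a quadratic error. -/
theorem hs_add_smul_le {A B : E →L[ℝ] F} (hA : IsHS A) (hB : IsHS B) (h0 : 0 < hs A) (t : ℝ) :
    hs (A + t • B) ≤ hs A + t * hsInner ((hs A)⁻¹ • A) B + t ^ 2 * (hs B ^ 2 / (2 * hs A)) := by
  have hB' := isHS_smul t hB
  have h1 : hs (A + t • B) ^ 2 = hs A ^ 2 + (2 * t * hsInner A B + t ^ 2 * hs B ^ 2) := by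
    rw [← hsInner_self (isHS_add hA hB'), hsInner_add_left hA hB' (isHS_add hA hB'),
      hsInner_add_right hA hA hB', hsInner_add_right hB' hA hB', hsInner_self hA, hsInner_self hB',
      hs_smul t hB, hsInner_smul_right, hsInner_smul_left, hsInner_comm B A, mul_pow, sq_abs]
    ring
  set y := 2 * t * hsInner A B + t ^ 2 * hs B ^ 2 with hy
  have h2 : hs A + t * hsInner ((hs A)⁻¹ • A) B + t ^ 2 * (hs B ^ 2 / (2 * hs A)) =
      hs A + y / (2 * hs A) := by
    rw [hsInner_smul_left, hy]
    field_simp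
    ring
  rw [h2]
  have h3 : 0 ≤ hs A ^ 2 + y := h1 ▸ sq_nonneg _
  have h4 : 0 ≤ hs A + y / (2 * hs A) := by
    have : hs A + y / (2 * hs A) = (hs A ^ 2 + (hs A ^ 2 + y)) / (2 * hs A) := by
      field_simp; ring
    rw [this]
    positivity
  refine le_of_sq_le_sq ?_ h4
  rw [h1]
  have h5 : (hs A + y / (2 * hs A)) ^ 2 = hs A ^ 2 + y + (y / (2 * hs A)) ^ 2 := by
    field_simp
    ring
  rw [h5]
  linarith [sq_nonneg (y / (2 * hs A))]

variable {p : ℕ} {H : Fin p → Type*} [∀ i, NormedAddCommGroup (H i)]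
  [∀ i, InnerProductSpace ℝ (H i)] [∀ i, CompleteSpace (H i)]

/-- The penalty `∑_{i ≠ j} ‖Aᵢⱼ‖₂`. -/
def pen (A : PiLp 2 H →L[ℝ] PiLp 2 H) : ℝ :=
  ∑ i, ∑ j, if i = j then 0 else hs (entry A i j)

/-- The normalized off-diagonal part of an operator matrix, a subgradient of the penalty. -/
def signMat (A : PiLp 2 H →L[ℝ] PiLp 2 H) : PiLp 2 H →L[ℝ] PiLp 2 H :=
  toOp fun i j => if i = j then 0 else (hs (entry A i j))⁻¹ • entry A i j

theorem entry_signMat (A : PiLp 2 H →L[ℝ] PiLp 2 H) (i j : Fin p) :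
    entry (signMat A) i j = if i = j then 0 else (hs (entry A i j))⁻¹ • entry A i j :=
  entry_toOp _ i j

theorem isHS_signMat {A : PiLp 2 H →L[ℝ] PiLp 2 H} (hA : IsHS A) : IsHS (signMat A) :=
  isHS_toOp fun i j => by
    split_ifs
    · exact isHS_zero
    · exact isHS_smul _ (isHS_entry hA i j)

theorem hs_entry_signMat_le {A : PiLp 2 H →L[ℝ] PiLp 2 H} (hA : IsHS A) (i j : Fin p) :
    hs (entry (signMat A) i j) ≤ 1 := by
  rw [entry_signMat]
  split_ifs
  · rw [hs_zero]; exact zero_le_one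
  · rw [hs_smul _ (isHS_entry hA i j), abs_of_nonneg (inv_nonneg.2 (hs_nonneg _))]
    exact inv_mul_le_one

theorem isSelfAdjoint_signMat {A : PiLp 2 H →L[ℝ] PiLp 2 H} (hA : IsSelfAdjoint A) :
    IsSelfAdjoint (signMat A) := isSelfAdjoint_of_entry fun i j => by
  rw [entry_signMat, entry_signMat]
  by_cases hij : i = j
  · rw [if_pos hij, if_pos hij.symm, map_zero]
  · rw [if_neg hij, if_neg (Ne.symm hij), LinearIsometryEquiv.map_smulₛₗ,
      ← entry_of_isSelfAdjoint hA, entry_of_isSelfAdjoint hA i j, hs_adjoint]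
    rfl

theorem pen_subgradient {A B : PiLp 2 H →L[ℝ] PiLp 2 H} (hA : IsHS A) (hB : IsHS B) :
    pen A + hsInner (signMat A) (B - A) ≤ pen B := by
  rw [hsInner_eq_sum (isHS_signMat hA) (isHS_sub hB hA), pen, ← Finset.sum_add_distrib, pen]
  refine Finset.sum_le_sum fun i _ => ?_
  rw [← Finset.sum_add_distrib]
  refine Finset.sum_le_sum fun j _ => ?_
  rw [entry_signMat, entry_sub]
  split_ifs
  · rw [hsInner_zero_left, add_zero]
  · exact hs_subgradient (isHS_entry hA i j) (isHS_entry hB i j)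

/-- Along a direction that moves only nonzero entries the penalty is smooth. Entries with `hs (entry
A i j) = 0` contribute nothing to the quadratic term, by division by zero. -/
theorem pen_add_smul_le {A B : PiLp 2 H →L[ℝ] PiLp 2 H} (hA : IsHS A) (hB : IsHS B)
    (h : ∀ i j, i ≠ j → 0 < hs (entry A i j) ∨ entry B i j = 0) (t : ℝ) :
    pen (A + t • B) ≤ pen A + t * hsInner (signMat A) B +
      t ^ 2 * ∑ i, ∑ j, hs (entry B i j) ^ 2 / (2 * hs (entry A i j)) := by
  rw [hsInner_eq_sum (isHS_signMat hA) hB, pen, pen, Finset.mul_sum, Finset.mul_sum,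
    ← Finset.sum_add_distrib, ← Finset.sum_add_distrib]
  refine Finset.sum_le_sum fun i _ => ?_
  rw [Finset.mul_sum, Finset.mul_sum, ← Finset.sum_add_distrib, ← Finset.sum_add_distrib]
  refine Finset.sum_le_sum fun j _ => ?_
  rw [entry_signMat, entry_add, entry_smul]
  have hn := hs_nonneg (entry A i j)
  split_ifs with hij
  · rw [hsInner_zero_left, mul_zero, add_zero, zero_add]
    positivity
  · rcases h i j hij with h1 | h1
    · exact hs_add_smul_le (isHS_entry hA i j) (isHS_entry hB i j) h1 t
    · rw [h1, hsInner_zero_right, hs_zero]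
      simp

/-- The penalized objective functional in terms of Hilbert-Schmidt inner products. -/
def obj (B₀ : PiLp 2 H →L[ℝ] PiLp 2 H) (l : ℝ) (A : PiLp 2 H →L[ℝ] PiLp 2 H) : ℝ :=
  hsInner B₀ A + -Real.log (cfDet A) + l * pen A

/-- The subgradient of the penalized objective functional. -/
def objGrad (B₀ : PiLp 2 H →L[ℝ] PiLp 2 H) (l : ℝ) (A : PiLp 2 H →L[ℝ] PiLp 2 H) :
    PiLp 2 H →L[ℝ] PiLp 2 H :=
  B₀ + gradLog A + l • signMat A

variable {A B B₀ : PiLp 2 H →L[ℝ] PiLp 2 H} {l : ℝ}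

theorem isHS_objGrad (hB₀ : IsHS B₀) (hA : IsHS A) (hsA : IsSelfAdjoint A)
    (hpA : ∀ x, x ≠ 0 → 0 < inner ℝ x ((1 + A) x)) : IsHS (objGrad B₀ l A) :=
  isHS_add (isHS_add hB₀ (isHS_gradLog hA hsA hpA).2.1) (isHS_smul _ (isHS_signMat hA))

theorem isSelfAdjoint_objGrad (hB₀ : IsSelfAdjoint B₀) (hA : IsHS A) (hsA : IsSelfAdjoint A)
    (hpA : ∀ x, x ≠ 0 → 0 < inner ℝ x ((1 + A) x)) : IsSelfAdjoint (objGrad B₀ l A) :=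
  isSelfAdjoint_add (isSelfAdjoint_add hB₀ (isHS_gradLog hA hsA hpA).2.2)
    (isSelfAdjoint_smul _ (isSelfAdjoint_signMat hsA))

theorem hsInner_objGrad (hB₀ : IsHS B₀) (hA : IsHS A) (hsA : IsSelfAdjoint A)
    (hpA : ∀ x, x ≠ 0 → 0 < inner ℝ x ((1 + A) x)) {C : PiLp 2 H →L[ℝ] PiLp 2 H} (hC : IsHS C) :
    hsInner (objGrad B₀ l A) C =
      hsInner B₀ C + hsInner (gradLog A) C + l * hsInner (signMat A) C := by
  have hg := (isHS_gradLog hA hsA hpA).2.1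
  rw [objGrad, hsInner_add_left (isHS_add hB₀ hg) (isHS_smul _ (isHS_signMat hA)) hC,
    hsInner_add_left hB₀ hg hC, hsInner_smul_left]

theorem obj_lower (hB₀ : IsHS B₀) (hl : 0 ≤ l) (hA : IsHS A) (hB : IsHS B)
    (hsA : IsSelfAdjoint A) (hsB : IsSelfAdjoint B)
    (hpA : ∀ x, x ≠ 0 → 0 < inner ℝ x ((1 + A) x)) (hpB : ∀ x, x ≠ 0 → 0 < inner ℝ x ((1 + B) x))
    {T : ℝ} (hTA : 1 + ‖A‖ ≤ T) (hTB : 1 + ‖B‖ ≤ T) :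
    obj B₀ l A + hsInner (objGrad B₀ l A) (B - A) + 1 / (4 * T ^ 2) * hs (B - A) ^ 2 ≤
      obj B₀ l B := by
  have h1 := logdet_gap_lower hA hB hsA hsB hpA hpB hTA hTB
  have h2 := mul_le_mul_of_nonneg_left (pen_subgradient hA hB) hl
  rw [hsInner_objGrad hB₀ hA hsA hpA (isHS_sub hB hA), hsInner_sub_right hB₀ hB hA, obj, obj]
  linarith

theorem obj_upper (hB₀ : IsHS B₀) (hl : 0 ≤ l) (hA : IsHS A) (hB : IsHS B)
    (hsA : IsSelfAdjoint A) (hsB : IsSelfAdjoint B) {c : ℝ} (hc : 0 < c)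
    (hpA : ∀ x, c * ‖x‖ ^ 2 ≤ inner ℝ x ((1 + A) x))
    (h : ∀ i j, i ≠ j → 0 < hs (entry A i j) ∨ entry B i j = 0) {t : ℝ}
    (hpB : ∀ x, c * ‖x‖ ^ 2 ≤ inner ℝ x ((1 + (A + t • B)) x)) :
    obj B₀ l (A + t • B) ≤ obj B₀ l A + t * hsInner (objGrad B₀ l A) B + t ^ 2 *
      (1 / c ^ 2 * hs B ^ 2 + l * ∑ i, ∑ j, hs (entry B i j) ^ 2 / (2 * hs (entry A i j))) := by
  have hpA' : ∀ x, x ≠ 0 → 0 < inner ℝ x ((1 + A) x) := fun x hx =>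
    (mul_pos hc (pow_pos (norm_pos_iff.2 hx) 2)).trans_le (hpA x)
  have htB := isHS_smul t hB
  have h1 := logdet_gap_upper hA (isHS_add hA htB) hsA
    (isSelfAdjoint_add hsA (isSelfAdjoint_smul t hsB)) hc hpA hpB
  have h2 := mul_le_mul_of_nonneg_left (pen_add_smul_le hA hB h t) hl
  rw [add_sub_cancel_left, hsInner_smul_right, hs_smul t hB, mul_pow, sq_abs] at h1
  rw [hsInner_objGrad hB₀ hA hsA hpA' hB, obj, obj, hsInner_add_right hB₀ hA htB,
    hsInner_smul_right]
  linarith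

end Penalty

/-! ### The restricted minimizer and the primal-dual witness. -/

section Solution

variable {p : ℕ} {H : Fin p → Type*} [∀ i, NormedAddCommGroup (H i)]
  [∀ i, InnerProductSpace ℝ (H i)] [∀ i, CompleteSpace (H i)]
  {R : ∀ i j, H j →L[ℝ] H i} {S : Finset (Fin p × Fin p)} {W : PiLp 2 H →L[ℝ] PiLp 2 H}
  {ρ w lam r : ℝ} {d : ℕ} {D : PiLp 2 H →L[ℝ] PiLp 2 H}

namespace Model

/-- The linear coefficient of the objective functional at the parameter `s`. -/
theorem isHS_coef (h : Model R S W ρ w lam r d) (s : ℝ) : IsHS (toOp R - 1 + s • W) :=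
  isHS_add h.isHS_sub_one (isHS_smul s h.isHS_pert)

theorem isSelfAdjoint_coef (h : Model R S W ρ w lam r d) (s : ℝ) :
    IsSelfAdjoint (toOp R - 1 + s • W) :=
  isSelfAdjoint_add (isSelfAdjoint_sub h.isSelfAdjoint (IsSelfAdjoint.one _))
    (isSelfAdjoint_smul s h.isSelfAdjoint_pert)

theorem hs_pos_of_mem (h : Model R S W ρ w lam r d) (hD : IsAdmissible S r D) {i j : Fin p}
    (hij : i ≠ j) (hS : (i, j) ∈ S) : 0 < hs (entry (precision R + D) i j) := by
  have h1 := h.signal i j (((h.mem_graph_iff i j).1 hS).resolve_left hij)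
  have h2 := hD.2.2.2 i j
  have h3 := hs_sub_le (isHS_entry (h.isHS_add_admissible hD) i j) (isHS_entry hD.1 i j)
  rw [← entry_sub, add_sub_cancel_right] at h3
  linarith

/-- The steepest descent direction `V = -G_S` respects support and symmetry, and from an interior
point small steps stay admissible. Minimality against the upper bound `t ⟨G, V⟩ + t² C` forces `⟨G,
V⟩ ≥ 0`, while `⟨G, V⟩ = -‖G_S‖²`. -/
theorem stationary (h : Model R S W ρ w lam r d) (hD : IsAdmissible S r D)
    (hlt : ∀ i j, hs (entry D i j) < r) {s : ℝ} (hs0 : 0 ≤ s)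
    (hmin : ∀ D', IsAdmissible S r D' → obj (toOp R - 1 + s • W) (s * lam) (precision R + D) ≤
      obj (toOp R - 1 + s • W) (s * lam) (precision R + D')) {i j : Fin p} (hij : (i, j) ∈ S) :
    entry (toOp R + s • W - Ring.inverse (1 + (precision R + D)) +
      (s * lam) • signMat (precision R + D)) i j = 0 := by
  have hA := h.isHS_add_admissible hD
  have hsA := h.isSelfAdjoint_add_admissible hD
  have hpA := h.pos_add hD
  have hl : 0 ≤ s * lam := mul_nonneg hs0 h.lam_pos.le
  set G := objGrad (toOp R - 1 + s • W) (s * lam) (precision R + D) with hG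
  have hGS : IsHS G := isHS_objGrad (h.isHS_coef s) hA hsA hpA
  have hGsa : IsSelfAdjoint G := isSelfAdjoint_objGrad (h.isSelfAdjoint_coef s) hA hsA hpA
  have hGe : G = toOp R + s • W - Ring.inverse (1 + (precision R + D)) +
      (s * lam) • signMat (precision R + D) := by
    rw [hG, objGrad, gradLog]; abel
  set V := -trunc S G with hV
  have hVS : IsHS V := isHS_neg (isHS_trunc S hGS)
  have hVsa : IsSelfAdjoint V :=
    isSelfAdjoint_neg (isSelfAdjoint_trunc (fun i j => h.symm_mem) hGsa)
  have hVent : ∀ i j, (i, j) ∉ S → entry V i j = 0 := fun i j hn => by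
    rw [hV, entry_neg, entry_trunc, if_neg hn, neg_zero]
  have hadm : ∀ᶠ t in nhdsWithin (0 : ℝ) (Set.Ioi 0), IsAdmissible S r (D + t • V) := by
    have h1 : ∀ i j, ∀ᶠ t in nhdsWithin (0 : ℝ) (Set.Ioi 0),
        hs (entry D i j) + t * hs (entry V i j) < r := by
      intro i j
      have hc : Filter.Tendsto (fun t : ℝ => hs (entry D i j) + t * hs (entry V i j))
          (nhdsWithin 0 (Set.Ioi 0)) (nhds (hs (entry D i j) + 0 * hs (entry V i j))) :=
        tendsto_nhdsWithin_of_tendsto_nhds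
          (Continuous.tendsto (by fun_prop) 0)
      refine hc.eventually_lt_const ?_
      simpa using hlt i j
    have h2 := Filter.eventually_all.2 fun i => Filter.eventually_all.2 fun j => h1 i j
    filter_upwards [h2, self_mem_nhdsWithin] with t ht ht0
    refine ⟨isHS_add hD.1 (isHS_smul t hVS), isSelfAdjoint_add hD.2.1 (isSelfAdjoint_smul t hVsa),
      fun i j hn => ?_, fun i j => ?_⟩
    · rw [entry_add, entry_smul, hVent i j hn, hD.2.2.1 i j hn, smul_zero, add_zero]
    · rw [entry_add, entry_smul]
      refine (hs_add_le (isHS_entry hD.1 i j) (isHS_smul t (isHS_entry hVS i j))).trans ?_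
      rw [hs_smul _ (isHS_entry hVS i j), abs_of_pos ht0]
      exact (ht i j).le
  have hρ : 0 < ρ := one_pos.trans_le h.one_le_rho
  have hc : 0 < 5 / 6 / ρ := by positivity
  obtain ⟨C, hC⟩ : ∃ C : ℝ, ∀ t, IsAdmissible S r (D + t • V) →
      obj (toOp R - 1 + s • W) (s * lam) (precision R + (D + t • V)) ≤
        obj (toOp R - 1 + s • W) (s * lam) (precision R + D) + t * hsInner G V + t ^ 2 * C := by
    refine ⟨1 / (5 / 6 / ρ) ^ 2 * hs V ^ 2 + s * lam *
      ∑ i, ∑ j, hs (entry V i j) ^ 2 / (2 * hs (entry (precision R + D) i j)), fun t ht => ?_⟩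
    have hp := h.lower_add ht
    rw [← add_assoc (precision R)] at hp ⊢
    exact obj_upper (h.isHS_coef s) hl hA hVS hsA hVsa hc (h.lower_add hD) (fun i j hne => by
      by_cases hS : (i, j) ∈ S
      · exact Or.inl (h.hs_pos_of_mem hD hne hS)
      · exact Or.inr (hVent i j hS)) hp
  have hge : 0 ≤ hsInner G V := by
    have hlim : Filter.Tendsto (fun t : ℝ => hsInner G V + t * C) (nhdsWithin 0 (Set.Ioi 0))
        (nhds (hsInner G V + 0 * C)) :=
      tendsto_nhdsWithin_of_tendsto_nhds (Continuous.tendsto (by fun_prop) 0)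
    rw [zero_mul, add_zero] at hlim
    refine ge_of_tendsto hlim ?_
    filter_upwards [hadm, self_mem_nhdsWithin] with t ht ht0
    have h1 := hC t ht
    have h2 := hmin _ ht
    have h3 : 0 ≤ t * (hsInner G V + t * C) := by
      have : t * (hsInner G V + t * C) = t * hsInner G V + t ^ 2 * C := by ring
      linarith
    exact nonneg_of_mul_nonneg_right h3 ht0
  have hval : hsInner G V = -hs (trunc S G) ^ 2 := by
    have e : V = (-1 : ℝ) • trunc S G := (neg_one_smul ℝ (trunc S G)).symm
    rw [e, hsInner_smul_right, ← hsInner_self (isHS_trunc S hGS),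
      hsInner_trunc_left S hGS (isHS_trunc S hGS), trunc_trunc]
    ring
  have hzero : trunc S G = 0 := by
    refine eq_zero_of_hs_eq_zero (isHS_trunc S hGS) ?_
    have : hs (trunc S G) ^ 2 ≤ 0 := by linarith
    exact pow_eq_zero_iff two_ne_zero |>.1 (le_antisymm this (sq_nonneg _))
  have : entry (trunc S G) i j = 0 := by rw [hzero, entry_zero]
  rw [entry_trunc, if_pos hij] at this
  rw [← hGe]
  exact this

/-- The admissible operators, as points of the Hilbert space of Hilbert-Schmidt operators. -/
def admissibleSet (S : Finset (Fin p × Fin p)) (r : ℝ) : Set (HSL (PiLp 2 H) (PiLp 2 H)) :=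
  {u | IsAdmissible S r (opOf u)}

theorem continuous_hs_entry (i j : Fin p) :
    Continuous fun u : HSL (PiLp 2 H) (PiLp 2 H) => hs (entry (opOf u) i j) := by
  refine (LipschitzWith.of_dist_le_mul (K := 1) fun u v => ?_).continuous
  rw [NNReal.coe_one, one_mul, dist_eq_norm, dist_eq_norm, norm_eq_hs (u - v), Real.norm_eq_abs]
  have hu := isHS_entry (isHS_opOf u) i j
  have hv := isHS_entry (isHS_opOf v) i j
  have huv := isHS_sub hu hv
  have h1 := hs_entry_le (isHS_opOf (u - v)) i j
  rw [map_sub, entry_sub] at h1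
  rw [map_sub, abs_sub_le_iff]
  constructor
  · have := hs_add_le huv hv
    rw [sub_add_cancel] at this
    linarith
  · have := hs_sub_le hu huv
    rw [sub_sub_cancel] at this
    linarith

theorem isClosed_admissibleSet (S : Finset (Fin p × Fin p)) (r : ℝ) :
    IsClosed (admissibleSet (H := H) S r) := by
  have e : admissibleSet (H := H) S r =
      {u | ContinuousLinearMap.adjoint (opOf u) = opOf u} ∩
      ((⋂ i, ⋂ j, {u | (i, j) ∉ S → hs (entry (opOf u) i j) ≤ 0}) ∩
        ⋂ i, ⋂ j, {u | hs (entry (opOf u) i j) ≤ r}) := by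
    ext u
    simp only [admissibleSet, IsAdmissible, Set.mem_ofPred_eq, Set.mem_inter_iff, Set.mem_iInter,
      ContinuousLinearMap.isSelfAdjoint_iff', isHS_opOf, true_and]
    refine and_congr Iff.rfl (and_congr (forall_congr' fun i => forall_congr' fun j =>
      imp_congr_right fun _ => ⟨fun h => by rw [h, hs_zero], fun h => ?_⟩) Iff.rfl)
    exact eq_zero_of_hs_eq_zero (isHS_entry (isHS_opOf u) i j) (le_antisymm h (hs_nonneg _))
  rw [e]
  refine IsClosed.inter (isClosed_eq ?_ continuous_opOf) (IsClosed.inter ?_ ?_)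
  · exact (LinearIsometryEquiv.continuous _).comp continuous_opOf
  · refine isClosed_iInter fun i => isClosed_iInter fun j => ?_
    by_cases hij : (i, j) ∈ S
    · simp [hij]
    · simp only [hij, not_false_eq_true, forall_const]
      exact isClosed_le (continuous_hs_entry i j) continuous_const
  · exact isClosed_iInter fun i => isClosed_iInter fun j =>
      isClosed_le (continuous_hs_entry i j) continuous_const

theorem convex_admissibleSet (S : Finset (Fin p × Fin p)) (r : ℝ) :
    Convex ℝ (admissibleSet (H := H) S r) := by
  intro u hu v hv a c ha hc hac
  change IsAdmissible S r (opOf (a • u + c • v))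
  rw [map_add, map_smul, map_smul]
  refine ⟨isHS_add (isHS_smul a hu.1) (isHS_smul c hv.1),
    isSelfAdjoint_add (isSelfAdjoint_smul a hu.2.1) (isSelfAdjoint_smul c hv.2.1),
    fun i j hij => ?_, fun i j => ?_⟩
  · rw [entry_add, entry_smul, entry_smul, hu.2.2.1 i j hij, hv.2.2.1 i j hij]
    simp
  · rw [entry_add, entry_smul, entry_smul]
    refine (hs_add_le (isHS_smul a (isHS_entry hu.1 i j))
      (isHS_smul c (isHS_entry hv.1 i j))).trans ?_
    rw [hs_smul _ (isHS_entry hu.1 i j), hs_smul _ (isHS_entry hv.1 i j), abs_of_nonneg ha,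
      abs_of_nonneg hc]
    have h1 := mul_le_mul_of_nonneg_left (hu.2.2.2 i j) ha
    have h2 := mul_le_mul_of_nonneg_left (hv.2.2.2 i j) hc
    calc _ ≤ a * r + c * r := add_le_add h1 h2
      _ = r := by rw [← add_mul, hac, one_mul]

theorem hs_admissible_le (hr : 0 ≤ r) (hD : IsAdmissible S r D) : hs D ≤ p * r := by
  refine le_of_sq_le_sq ?_ (by positivity)
  rw [hs_sq_eq_sum hD.1]
  calc ∑ i, ∑ j, hs (entry D i j) ^ 2 ≤ ∑ _i : Fin p, ∑ _j : Fin p, r ^ 2 :=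
        Finset.sum_le_sum fun i _ => Finset.sum_le_sum fun j _ =>
          pow_le_pow_left₀ (hs_nonneg _) (hD.2.2.2 i j) 2
    _ = (p * r) ^ 2 := by simp; ring

theorem isAdmissible_zero (hr : 0 ≤ r) :
    IsAdmissible S r (0 : PiLp 2 H →L[ℝ] PiLp 2 H) :=
  ⟨isHS_zero, IsSelfAdjoint.zero (R := PiLp 2 H →L[ℝ] PiLp 2 H), fun i j _ => entry_zero i j, fun i j => by
    rw [entry_zero, hs_zero]; exact hr⟩

theorem zero_mem_admissibleSet (hr : 0 ≤ r) :
    (0 : HSL (PiLp 2 H) (PiLp 2 H)) ∈ admissibleSet S r := by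
  have e : opOf (0 : HSL (PiLp 2 H) (PiLp 2 H)) = 0 := map_zero _
  rw [admissibleSet, Set.mem_ofPred_eq, e]
  exact isAdmissible_zero hr

theorem pen_le {A : PiLp 2 H →L[ℝ] PiLp 2 H} (hA : IsHS A) : pen A ≤ p * p * hs A := by
  calc pen A ≤ ∑ _i : Fin p, ∑ _j : Fin p, hs A := by
        refine Finset.sum_le_sum fun i _ => Finset.sum_le_sum fun j _ => ?_
        split_ifs
        · exact hs_nonneg A
        · exact hs_entry_le hA i j
    _ = p * p * hs A := by simp; ring

theorem pen_nonneg (A : PiLp 2 H →L[ℝ] PiLp 2 H) : 0 ≤ pen A :=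
  Finset.sum_nonneg fun i _ => Finset.sum_nonneg fun j _ => by
    split_ifs
    · exact le_rfl
    · exact hs_nonneg _

/-- For fixed `A` the objective is affine in `s`, the form `F₀ + s L` required by the continuation.
-/
theorem obj_split (h : Model R S W ρ w lam r d) {A : PiLp 2 H →L[ℝ] PiLp 2 H} (hA : IsHS A)
    (s : ℝ) : obj (toOp R - 1 + s • W) (s * lam) A =
      obj (toOp R - 1) 0 A + s * (hsInner W A + lam * pen A) := by
  rw [obj, obj, hsInner_add_left h.isHS_sub_one (isHS_smul s h.isHS_pert) hA, hsInner_smul_left]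
  ring

theorem abs_linear_le (h : Model R S W ρ w lam r d) (hD : IsAdmissible S r D) :
    |hsInner W (precision R + D) + lam * pen (precision R + D)| ≤
      (hs W + lam * (p * p)) * (hs (precision R) + p * r) := by
  have hAx := h.isHS_add_admissible hD
  have h1 : hs (precision R + D) ≤ hs (precision R) + p * r :=
    (hs_add_le h.isHS_precision hD.1).trans (by linarith [hs_admissible_le h.r_pos.le hD])
  have h2 := abs_hsInner_le h.isHS_pert hAx
  have h3 := pen_le hAx
  have h4 := pen_nonneg (precision R + D)
  have h5 := h.lam_pos
  refine (abs_add_le _ _).trans ?_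
  rw [abs_of_nonneg (mul_nonneg h5.le h4), add_mul]
  refine add_le_add (h2.trans (mul_le_mul_of_nonneg_left h1 (hs_nonneg W))) ?_
  rw [mul_assoc]
  exact mul_le_mul_of_nonneg_left (h3.trans (mul_le_mul_of_nonneg_left h1 (by positivity))) h5.le

theorem one_add_norm_le (h : Model R S W ρ w lam r d) (hD : IsAdmissible S r D) :
    1 + ‖precision R + D‖ ≤ 1 + (‖precision R‖ + p * r) := by
  have h1 := (norm_le_hs hD.1).trans (hs_admissible_le h.r_pos.le hD)
  have h2 := norm_add_le (precision R) D
  linarith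

/-- Without perturbation and penalty the precision operator is optimal. -/
theorem obj_precision_le (h : Model R S W ρ w lam r d) (hD : IsAdmissible S r D) :
    obj (toOp R - 1) 0 (precision R + 0) ≤ obj (toOp R - 1) 0 (precision R + D) := by
  have hadm0 : IsAdmissible S r (0 : PiLp 2 H →L[ℝ] PiLp 2 H) := isAdmissible_zero h.r_pos.le
  have hA0 := h.isHS_add_admissible hadm0
  have h1 := obj_lower h.isHS_sub_one le_rfl hA0 (h.isHS_add_admissible hD)
    (h.isSelfAdjoint_add_admissible hadm0) (h.isSelfAdjoint_add_admissible hD) (h.pos_add hadm0)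
    (h.pos_add hD) (h.one_add_norm_le hadm0) (h.one_add_norm_le hD)
  -- Since `1 + H* = R⁻¹`, the gradient there is `(R - 1) + (1 - R) = 0`.
  have h2 : objGrad (toOp R - 1) 0 (precision R + 0) = 0 := by
    rw [objGrad, gradLog, add_zero, one_add_precision]
    obtain ⟨U, hU⟩ := h.isUnit
    rw [← hU, Ring.inverse_unit, Ring.inverse_unit, inv_inv,
      zero_smul ℝ (signMat (precision R)), add_zero, sub_add_sub_cancel, sub_self]
  rw [h2, hsInner_zero_left, add_zero] at h1
  exact (le_add_of_nonneg_right (by positivity)).trans h1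

open Classical in
/-- The gradient of the objective functional, as a vector of the space of Hilbert-Schmidt
operators. -/
def objGradL (B₀ : PiLp 2 H →L[ℝ] PiLp 2 H) (l : ℝ) (A : PiLp 2 H →L[ℝ] PiLp 2 H) :
    HSL (PiLp 2 H) (PiLp 2 H) :=
  if h : IsHS (objGrad B₀ l A) then ofHS _ h else 0

theorem obj_lower_admissible (h : Model R S W ρ w lam r d) {s : ℝ} (hs0 : 0 ≤ s)
    {x y : HSL (PiLp 2 H) (PiLp 2 H)} (hx : IsAdmissible S r (opOf x))
    (hy : IsAdmissible S r (opOf y)) :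
    obj (toOp R - 1) 0 (precision R + opOf y) +
        s * (hsInner W (precision R + opOf y) + lam * pen (precision R + opOf y)) +
        inner ℝ (objGradL (toOp R - 1 + s • W) (s * lam) (precision R + opOf y)) (x - y) +
        1 / (4 * (1 + (‖precision R‖ + p * r)) ^ 2) * ‖x - y‖ ^ 2 ≤
      obj (toOp R - 1) 0 (precision R + opOf x) +
        s * (hsInner W (precision R + opOf x) + lam * pen (precision R + opOf x)) := by
  have hAy := h.isHS_add_admissible hy
  have hAx := h.isHS_add_admissible hx
  have hg : IsHS (objGrad (toOp R - 1 + s • W) (s * lam) (precision R + opOf y)) :=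
    isHS_objGrad (h.isHS_coef s) hAy (h.isSelfAdjoint_add_admissible hy) (h.pos_add hy)
  have := obj_lower (h.isHS_coef s) (mul_nonneg hs0 h.lam_pos.le) hAy hAx
    (h.isSelfAdjoint_add_admissible hy) (h.isSelfAdjoint_add_admissible hx) (h.pos_add hy)
    (h.pos_add hx) (h.one_add_norm_le hy) (h.one_add_norm_le hx)
  rw [add_sub_add_left_eq_sub] at this
  rw [objGradL, dif_pos hg, inner_eq_hsInner, opOf_ofHS, norm_eq_hs, map_sub, ← h.obj_split hAy,
    ← h.obj_split hAx]
  exact this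

/-- The largest entry of a Hilbert-Schmidt operator matrix. -/
def maxEntry (u : HSL (PiLp 2 H) (PiLp 2 H)) : ℝ :=
  ‖fun e : Fin p × Fin p => hs (entry (opOf u) e.1 e.2)‖

theorem continuous_maxEntry : Continuous (maxEntry (H := H)) :=
  (continuous_pi fun e : Fin p × Fin p => continuous_hs_entry e.1 e.2).norm

theorem maxEntry_le_iff (u : HSL (PiLp 2 H) (PiLp 2 H)) {q : ℝ} (hq : 0 ≤ q) :
    maxEntry u ≤ q ↔ ∀ i j, hs (entry (opOf u) i j) ≤ q := by
  rw [maxEntry, pi_norm_le_iff_of_nonneg hq]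
  simp only [Real.norm_of_nonneg (hs_nonneg _), Prod.forall]

theorem hs_entry_lt_of_maxEntry_lt {u : HSL (PiLp 2 H) (PiLp 2 H)} {q : ℝ} (hq : 0 < q)
    (hu : maxEntry u < q) (i j : Fin p) : hs (entry (opOf u) i j) < q := by
  have := (pi_norm_lt_iff hq).1 hu (i, j)
  rwa [Real.norm_of_nonneg (hs_nonneg _)] at this

theorem maxEntry_zero_le {q : ℝ} (hq : 0 ≤ q) :
    maxEntry (0 : HSL (PiLp 2 H) (PiLp 2 H)) ≤ q := by
  rw [maxEntry_le_iff _ hq]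
  intro i j
  have e : opOf (0 : HSL (PiLp 2 H) (PiLp 2 H)) = 0 := map_zero _
  rw [e, entry_zero, hs_zero]
  exact hq

theorem stationary_of_isMin (h : Model R S W ρ w lam r d) {s : ℝ} (hs0 : 0 ≤ s)
    {x₀ : HSL (PiLp 2 H) (PiLp 2 H)} (hx₀ : IsAdmissible S r (opOf x₀))
    (hmin : ∀ x ∈ admissibleSet S r, obj (toOp R - 1) 0 (precision R + opOf x₀) +
        s * (hsInner W (precision R + opOf x₀) + lam * pen (precision R + opOf x₀)) ≤
      obj (toOp R - 1) 0 (precision R + opOf x) +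
        s * (hsInner W (precision R + opOf x) + lam * pen (precision R + opOf x)))
    (hlt : maxEntry x₀ < r) {i j : Fin p} (hij : (i, j) ∈ S) :
    entry (toOp R + s • W - Ring.inverse (1 + (precision R + opOf x₀)) +
      (s * lam) • signMat (precision R + opOf x₀)) i j = 0 := by
  refine h.stationary hx₀ (hs_entry_lt_of_maxEntry_lt h.r_pos hlt) hs0 (fun D' hD' => ?_) hij
  have hmem : ofHS D' hD'.1 ∈ admissibleSet S r := by
    rw [admissibleSet, Set.mem_ofPred_eq, opOf_ofHS]
    exact hD'
  have := hmin _ hmem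
  rwa [opOf_ofHS, ← h.obj_split (h.isHS_add_admissible hx₀),
    ← h.obj_split (h.isHS_add_admissible hD')] at this

/-- Continuation from the true model at `s = 0` to the penalized estimate at `s = 1`. The convexity
constant is uniform in `s` because `‖precision R + D‖` is bounded on the admissible set, and the
step hypothesis is stationarity followed by the a priori estimate. -/
theorem exists_restricted_min (h : Model R S W ρ w lam r d) :
    ∃ x₀ ∈ admissibleSet S r, (∀ x ∈ admissibleSet S r,
      obj (toOp R - 1) 0 (precision R + opOf x₀) +
        (hsInner W (precision R + opOf x₀) + lam * pen (precision R + opOf x₀)) ≤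
      obj (toOp R - 1) 0 (precision R + opOf x) +
        (hsInner W (precision R + opOf x) + lam * pen (precision R + opOf x))) ∧
      maxEntry x₀ ≤ 7 / 10 * r := by
  have hr := h.r_pos
  have hr7 : 0 ≤ 7 / 10 * r := by positivity
  have e0 : opOf (0 : HSL (PiLp 2 H) (PiLp 2 H)) = 0 := map_zero _
  have hm : 0 < 1 / (4 * (1 + (‖precision R‖ + p * r)) ^ 2) := by positivity
  have hlt : 7 / 10 * r < r := by linarith
  refine exists_min_of_continuation (V := HSL (PiLp 2 H) (PiLp 2 H)) (K := admissibleSet S r)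
    (B := (hs W + lam * (p * p)) * (hs (precision R) + p * r))
    (F₀ := fun u => obj (toOp R - 1) 0 (precision R + opOf u))
    (L := fun u => hsInner W (precision R + opOf u) + lam * pen (precision R + opOf u))
    (N := maxEntry) (convex_admissibleSet S r) (isClosed_admissibleSet S r)
    (zero_mem_admissibleSet hr.le) hm ?_ ?_ ?_ continuous_maxEntry (maxEntry_zero_le hr7) hlt ?_
  · intro x hx
    exact h.abs_linear_le hx
  · intro s hs
    exact ⟨fun y => objGradL (toOp R - 1 + s • W) (s * lam) (precision R + opOf y),
      fun x hx y hy => h.obj_lower_admissible hs.1 hx hy⟩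
  · intro x hx
    beta_reduce
    rw [e0]
    exact h.obj_precision_le hx
  · intro s hs x₀ hx₀ hmin hlt
    exact (maxEntry_le_iff x₀ hr7).2 (h.apriori hx₀ hs.1 hs.2
      (isHS_signMat (h.isHS_add_admissible hx₀))
      (hs_entry_signMat_le (h.isHS_add_admissible hx₀))
      fun i j hij => h.stationary_of_isMin hs.1 hx₀ hmin hlt hij).2

/-- The restricted problem has a solution that satisfies the stationarity equation on `S`. -/
theorem exists_stationary (h : Model R S W ρ w lam r d) :
    ∃ D, ∃ hD : IsAdmissible S r D,
      (∀ i j, (i, j) ∈ S → entry (toOp R + W - Ring.inverse (1 + (precision R + D)) +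
        lam • signMat (precision R + D)) i j = 0) ∧
      ∀ e : S, hs (gammaSS R S (arr S D hD.1) e : H e.1.2 →L[ℝ] H e.1.1) ≤ 7 / 5 * w + lam := by
  obtain ⟨x₀, hx₀, hmin, hNx⟩ := h.exists_restricted_min
  have hlt : maxEntry x₀ < r := by linarith [h.r_pos]
  have hs1 : ∀ i j, (i, j) ∈ S → entry (toOp R + (1 : ℝ) • W -
      Ring.inverse (1 + (precision R + opOf x₀)) +
      (1 * lam) • signMat (precision R + opOf x₀)) i j = 0 := fun i j hij =>
    h.stationary_of_isMin zero_le_one hx₀ (by simpa only [one_mul] using hmin) hlt hij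
  have hmain := (h.apriori hx₀ zero_le_one le_rfl (isHS_signMat (h.isHS_add_admissible hx₀))
    (hs_entry_signMat_le (h.isHS_add_admissible hx₀)) hs1).1
  refine ⟨opOf x₀, hx₀, fun i j hij => ?_, hmain⟩
  have := hs1 i j hij
  rwa [one_smul, one_mul] at this

/-- The primal-dual witness: the penalized problem has a unique solution, with the graph `S`. -/
theorem exists_unique_min (h : Model R S W ρ w lam r d) {α : ℝ} (hα : 0 < α)
    (hinc : Incoherent R S α) (hlam : lam = 8 / α * w) :
    ∃ A ∈ feasible H, (∀ B ∈ feasible H, B ≠ A →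
      obj (toOp R - 1 + W) lam A < obj (toOp R - 1 + W) lam B) ∧
      graph A = graph (precision R) := by
  obtain ⟨D, hD, hstat, hM⟩ := h.exists_stationary
  have hA := h.isHS_add_admissible hD
  have hsA := h.isSelfAdjoint_add_admissible hD
  have hpA := h.pos_add hD
  set A := precision R + D with hAdef
  have hcoef : IsHS (toOp R - 1 + W) := isHS_add h.isHS_sub_one h.isHS_pert
  have hAoff : ∀ i j, (i, j) ∉ S → entry A i j = 0 := fun i j hij => by
    have h1 := (not_or.1 fun h2 => hij ((h.mem_graph_iff i j).2 h2)).2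
    rw [hAdef, entry_add, not_not.1 h1, hD.2.2.1 i j hij, add_zero]
  set Q := Ring.inverse (1 + A) - (toOp R + W) with hQ
  have hQg : toOp R - 1 + W + gradLog A = -Q := by
    rw [hQ, gradLog]; abel
  have hgS := (isHS_gradLog hA hsA hpA).2.1
  have hQS : IsHS Q := by
    have : Q = -(toOp R - 1 + W + gradLog A) := by rw [hQg, neg_neg]
    rw [this]
    exact isHS_neg (isHS_add hcoef hgS)
  have hQmem : ∀ i j, (i, j) ∈ S → entry Q i j = lam • entry (signMat A) i j := by
    intro i j hij
    have h1 := hstat i j hij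
    have e : toOp R + W - Ring.inverse (1 + A) + lam • signMat A = lam • signMat A - Q := by
      rw [hQ]; abel
    rw [e, entry_sub, sub_eq_zero, entry_smul] at h1
    exact h1.symm
  have hQnot : ∀ i j, (i, j) ∉ S → hs (entry Q i j) ≤ lam := fun i j hij =>
    h.dual_le hD hα hinc hlam hM hij
  refine ⟨A, ⟨hA, hsA, hpA⟩, fun B hB hne => ?_, ?_⟩
  · have hBS := hB.1
    have hBA := isHS_sub hBS hA
    -- `Q` is `lam` times a subgradient of the penalty at `A`: on `S` by stationarity, and off `S`,
    -- where `A` vanishes, because every entry of norm at most `lam` qualifies.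
    have hpen : hsInner Q (B - A) ≤ lam * (pen B - pen A) := by
      rw [hsInner_eq_sum hQS hBA, pen, pen, ← Finset.sum_sub_distrib, Finset.mul_sum]
      refine Finset.sum_le_sum fun i _ => ?_
      rw [← Finset.sum_sub_distrib, Finset.mul_sum]
      refine Finset.sum_le_sum fun j _ => ?_
      by_cases hij : (i, j) ∈ S
      · rw [hQmem i j hij, hsInner_smul_left]
        refine mul_le_mul_of_nonneg_left ?_ h.lam_pos.le
        rw [entry_signMat]
        split_ifs
        · rw [hsInner_zero_left, sub_zero]
        · have := hs_subgradient (isHS_entry hA i j) (isHS_entry hBS i j)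
          rw [entry_sub B A]
          linarith
      · have hne : i ≠ j := fun hh => hij ((h.mem_graph_iff i j).2 (Or.inl hh))
        rw [if_neg hne, if_neg hne, entry_sub B A, hAoff i j hij, sub_zero, hs_zero, sub_zero]
        refine (le_abs_self _).trans ((abs_hsInner_le (isHS_entry hQS i j)
          (isHS_entry hBS i j)).trans ?_)
        exact mul_le_mul_of_nonneg_right (hQnot i j hij) (hs_nonneg _)
    -- The competitor `B` is unbounded, so the radius depends on it; some positive curvature
    -- suffices for strictness.
    have hgap := logdet_gap_lower hA hBS hsA hB.2.1 hpA hB.2.2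
      (le_max_left (1 + ‖A‖) (1 + ‖B‖)) (le_max_right (1 + ‖A‖) (1 + ‖B‖))
    have hT : 0 < max (1 + ‖A‖) (1 + ‖B‖) := lt_max_of_lt_left (by positivity)
    have hpos : 0 < hs (B - A) := hs_pos hBA (sub_ne_zero.2 hne)
    have hstrict : 0 < 1 / (4 * max (1 + ‖A‖) (1 + ‖B‖) ^ 2) * hs (B - A) ^ 2 := by positivity
    have hlin : hsInner (toOp R - 1 + W) B - hsInner (toOp R - 1 + W) A +
        hsInner (gradLog A) (B - A) = -hsInner Q (B - A) := by
      have h1 : hsInner (toOp R - 1 + W + gradLog A) (B - A) = hsInner (-Q) (B - A) := by rw [hQg]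
      rw [hsInner_add_left hcoef hgS hBA] at h1
      have e : -Q = (-1 : ℝ) • Q := (neg_one_smul ℝ Q).symm
      rw [e, hsInner_smul_left, hsInner_sub_right hcoef hBS hA] at h1
      linarith
    rw [obj, obj]
    linarith
  · ext ⟨i, j⟩
    have h1 := h.mem_graph_iff i j
    rw [h.graph_eq] at h1
    rw [h1]
    have h2 : (i, j) ∈ graph A ↔ i = j ∨ entry A i j ≠ 0 := by
      unfold graph
      simp
    rw [h2]
    refine or_congr_right' fun hij => ?_
    have h3 := h.mem_graph_iff i j
    constructor
    · intro hne
      by_contra hcon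
      refine hne (hAoff i j fun hmem => ?_)
      rcases h3.1 hmem with h4 | h4
      · exact hij h4
      · exact h4 hcon
    · intro hne h0
      have := h.hs_pos_of_mem hD hij (h3.2 (Or.inr hne))
      rw [← hAdef, h0, hs_zero] at this
      exact lt_irrefl _ this

end Model

end Solution

/-! ### Polar decomposition and correlation operators of Gram matrices. -/

section Polar

variable {E F L : Type*}
  [NormedAddCommGroup E] [InnerProductSpace ℝ E] [CompleteSpace E]
  [NormedAddCommGroup F] [InnerProductSpace ℝ F] [CompleteSpace F]
  [NormedAddCommGroup L] [InnerProductSpace ℝ L] [CompleteSpace L] {ι κ : Type*}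

theorem IsEig.opPow {A : E →L[ℝ] E} {b : HilbertBasis ι ℝ E} {a : ι → ℝ} (h : IsEig A b a)
    (ha : ∀ k, 0 ≤ a k) {s : ℝ} (hs : 0 ≤ s) : IsEig (opPow A s) b (fun k => a k ^ s) := by
  refine h.opFun (fun x => x ^ s) (M := ‖A‖ ^ s) fun k => ?_
  rw [abs_of_nonneg (Real.rpow_nonneg (ha k) s)]
  exact Real.rpow_le_rpow (ha k) ((le_abs_self _).trans (h.abs_le k)) hs

theorem IsEig.mem_range {A : E →L[ℝ] E} {b : HilbertBasis ι ℝ E} {a : ι → ℝ} (h : IsEig A b a)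
    {k : ι} (hk : a k ≠ 0) : b k ∈ LinearMap.range (A : E →ₗ[ℝ] E) := by
  refine ⟨(a k)⁻¹ • b k, ?_⟩
  rw [ContinuousLinearMap.coe_coe, map_smul, h k, smul_smul, inv_mul_cancel₀ hk, one_smul]

theorem IsEig.mem_orthogonal {A : E →L[ℝ] E} {b : HilbertBasis ι ℝ E} {a : ι → ℝ}
    (h : IsEig A b a) {k : ι} (hk : a k = 0) :
    b k ∈ (LinearMap.range (A : E →ₗ[ℝ] E))ᗮ := by
  rw [Submodule.mem_orthogonal']
  rintro _ ⟨y, rfl⟩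
  rw [ContinuousLinearMap.coe_coe, h.inner_basis, hk, zero_mul]

theorem inner_eq_zero_of_mem_closure {K : Submodule ℝ E} {x y : E} (hx : x ∈ Kᗮ)
    (hy : y ∈ K.topologicalClosure) : inner ℝ x y = 0 := by
  rw [← Submodule.orthogonal_orthogonal_eq_closure] at hy
  exact Submodule.inner_right_of_mem_orthogonal hx hy

/-- `V` is the partial isometry of the polar decomposition of `U`. -/
structure IsPolar (U V : E →L[ℝ] L) : Prop where
  eq_comp : U = V ∘L opPow (ContinuousLinearMap.adjoint U ∘L U) (1 / 2)
  vanish : ∀ x ∈ (LinearMap.range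
    ((ContinuousLinearMap.adjoint U ∘L U : E →L[ℝ] E) : E →ₗ[ℝ] E))ᗮ, V x = 0
  norm_le : ‖V‖ ≤ 1
  mem_closure : ∀ x, V x ∈ (LinearMap.range (U : E →ₗ[ℝ] L)).topologicalClosure

theorem exists_isPolar {U : E →L[ℝ] L} (hU : IsHS U) : ∃ V, IsPolar U V := by
  set A := ContinuousLinearMap.adjoint U ∘L U with hA
  have hsa : IsSelfAdjoint A := by
    rw [ContinuousLinearMap.isSelfAdjoint_iff', hA, ContinuousLinearMap.adjoint_comp,
      ContinuousLinearMap.adjoint_adjoint]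
  obtain ⟨b, a, hb⟩ := (hU.comp_left (ContinuousLinearMap.adjoint U)).exists_isEig hsa
  have hin : ∀ k l, inner ℝ (U (b k)) (U (b l)) = a l * inner ℝ (b k) (b l) := fun k l => by
    rw [← inner_smul_right, ← hb l, ContinuousLinearMap.comp_apply,
      ContinuousLinearMap.adjoint_inner_right]
  have hbb : ∀ k, inner ℝ (b k) (b k) = (1 : ℝ) := fun k => by
    rw [real_inner_self_eq_norm_sq, b.orthonormal.1 k, one_pow]
  have hnorm : ∀ k, ‖U (b k)‖ ^ 2 = a k := fun k => by
    rw [← real_inner_self_eq_norm_sq, hin, hbb, mul_one]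
  have ha : ∀ k, 0 ≤ a k := fun k => hnorm k ▸ sq_nonneg _
  -- The vectors `U b_k / √a_k` are orthonormal where `a_k ≠ 0`, and `0` elsewhere because `0⁻¹ =
  -- 0`; so the Bessel constant is `1`, and the operator they define is a contraction.
  have hbes : ∀ (s : Finset _) (c : _ → ℝ),
      ‖∑ k ∈ s, c k • ((√(a k))⁻¹ • U (b k))‖ ^ 2 ≤ 1 ^ 2 * ∑ k ∈ s, c k ^ 2 := by
    intro s c
    rw [← real_inner_self_eq_norm_sq, sum_inner, one_pow, one_mul]
    refine Finset.sum_le_sum fun k hk => ?_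
    rw [inner_sum, Finset.sum_eq_single_of_mem k hk]
    · simp only [inner_smul_left, inner_smul_right, conj_trivial, hin, hbb]
      by_cases h0 : a k = 0
      · rw [h0]
        simp only [zero_mul, mul_zero]
        exact sq_nonneg _
      · have hp : 0 < √(a k) := Real.sqrt_pos.2 ((ha k).lt_of_ne' h0)
        have hsq := Real.mul_self_sqrt (ha k)
        refine le_of_eq ?_
        nth_rewrite 3 [← hsq]
        field_simp
    · intro l _ hlk
      simp only [inner_smul_left, inner_smul_right, hin, b.orthonormal.2 hlk.symm, mul_zero]
  obtain ⟨V, hV, hV1⟩ := exists_clm_of_bessel b (fun k => (√(a k))⁻¹ • U (b k)) zero_le_one hbes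
  refine ⟨V, ?_, fun x hx => ?_, hV1, fun x => ?_⟩
  · refine clm_ext_basis b fun k => ?_
    rw [ContinuousLinearMap.comp_apply, hb.opPow ha (by norm_num) k, map_smul, hV, smul_smul]
    beta_reduce
    rw [← Real.sqrt_eq_rpow]
    by_cases h0 : a k = 0
    · have h1 := hnorm k
      rw [h0] at h1
      rw [norm_eq_zero.1 (pow_eq_zero_iff two_ne_zero |>.1 h1), smul_zero]
    · rw [mul_inv_cancel₀ (Real.sqrt_pos.2 ((ha k).lt_of_ne' h0)).ne', one_smul]
  · refine ext_inner_left ℝ fun y => ?_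
    rw [inner_zero_right, ← ContinuousLinearMap.adjoint_inner_left]
    have h1 := b.hasSum_inner_mul_inner (ContinuousLinearMap.adjoint V y) x
    have h2 : ∀ k, inner ℝ (ContinuousLinearMap.adjoint V y) (b k) * inner ℝ (b k) x = (0 : ℝ) := by
      intro k
      by_cases h0 : a k = 0
      · rw [ContinuousLinearMap.adjoint_inner_left, hV, h0, Real.sqrt_zero, inv_zero, zero_smul,
          inner_zero_right, zero_mul]
      · rw [Submodule.inner_right_of_mem_orthogonal (hb.mem_range h0) hx, mul_zero]
    simp only [h2] at h1
    exact h1.unique hasSum_zero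
  · have h1 : (Submodule.span ℝ (Set.range b)).topologicalClosure ≤
        (LinearMap.range (U : E →ₗ[ℝ] L)).topologicalClosure.comap (V : E →ₗ[ℝ] L) := by
      refine Submodule.topologicalClosure_minimal _ (Submodule.span_le.2 ?_)
        ((Submodule.isClosed_topologicalClosure _).preimage V.continuous)
      rintro _ ⟨k, rfl⟩
      change V (b k) ∈ (LinearMap.range (U : E →ₗ[ℝ] L)).topologicalClosure
      rw [hV]
      exact Submodule.le_topologicalClosure _
        (Submodule.smul_mem _ _ (LinearMap.mem_range_self (U : E →ₗ[ℝ] L) (b k)))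
    rw [b.dense_span] at h1
    exact h1 (Submodule.mem_top (x := x))

theorem IsPolar.adjoint_mem {U V : E →L[ℝ] L} (h : IsPolar U V) (y : L) :
    ContinuousLinearMap.adjoint V y ∈ (LinearMap.range
      ((ContinuousLinearMap.adjoint U ∘L U : E →L[ℝ] E) : E →ₗ[ℝ] E)).topologicalClosure := by
  rw [← Submodule.orthogonal_orthogonal_eq_closure, Submodule.mem_orthogonal]
  intro x hx
  rw [ContinuousLinearMap.adjoint_inner_right, h.vanish x hx, inner_zero_left]

/-- In eigenbases of `A` and `B`, coefficients at a zero eigenvalue vanish by the range and kernel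
conditions; at the others the nonzero factors of `A^{1/2} R B^{1/2}` can be cancelled. -/
theorem isCorrelation_unique {A : E →L[ℝ] E} {B : F →L[ℝ] F} {b : HilbertBasis ι ℝ E}
    {f : HilbertBasis κ ℝ F} {a : ι → ℝ} {a' : κ → ℝ} (hA : IsEig A b a) (hB : IsEig B f a')
    (ha : ∀ k, 0 ≤ a k) (ha' : ∀ k, 0 ≤ a' k) {K R R' : F →L[ℝ] E}
    (h : IsCorrelation A B K R) (h' : IsCorrelation A B K R') : R = R' := by
  refine clm_ext_basis f fun l => ext_inner_basis b fun k => ?_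
  by_cases hl : a' l = 0
  · rw [h.2.2 _ (hB.mem_orthogonal hl), h'.2.2 _ (hB.mem_orthogonal hl)]
  by_cases hk : a k = 0
  · rw [inner_eq_zero_of_mem_closure (hA.mem_orthogonal hk) (h.2.1 _),
      inner_eq_zero_of_mem_closure (hA.mem_orthogonal hk) (h'.2.1 _)]
  have h1 := h.1.symm.trans h'.1
  have h2 := congrArg (fun T : F →L[ℝ] E => inner ℝ (b k) (T (f l))) h1
  have hp : a k ^ (1 / 2 : ℝ) ≠ 0 := (Real.rpow_pos_of_pos ((ha k).lt_of_ne' hk) _).ne'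
  have hq : a' l ^ (1 / 2 : ℝ) ≠ 0 := (Real.rpow_pos_of_pos ((ha' l).lt_of_ne' hl) _).ne'
  simp only [ContinuousLinearMap.comp_apply, hB.opPow ha' (by norm_num : (0 : ℝ) ≤ 1 / 2) l,
    (hA.opPow ha (by norm_num : (0 : ℝ) ≤ 1 / 2)).inner_basis, map_smul, inner_smul_right] at h2
  exact mul_left_cancel₀ hp (mul_left_cancel₀ hq h2)

theorem isSelfAdjoint_gram (U : E →L[ℝ] L) :
    IsSelfAdjoint (ContinuousLinearMap.adjoint U ∘L U) := by
  rw [ContinuousLinearMap.isSelfAdjoint_iff', ContinuousLinearMap.adjoint_comp,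
    ContinuousLinearMap.adjoint_adjoint]

theorem IsEig.nonneg_of_gram {U : E →L[ℝ] L} {b : HilbertBasis ι ℝ E} {a : ι → ℝ}
    (h : IsEig (ContinuousLinearMap.adjoint U ∘L U) b a) (k : ι) : 0 ≤ a k := by
  have h1 : inner ℝ (b k) ((ContinuousLinearMap.adjoint U ∘L U) (b k)) = ‖U (b k)‖ ^ 2 := by
    rw [ContinuousLinearMap.comp_apply, ContinuousLinearMap.adjoint_inner_right,
      real_inner_self_eq_norm_sq]
  rw [h k, inner_smul_right, real_inner_self_eq_norm_sq, b.orthonormal.1 k, one_pow, mul_one] at h1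
  rw [h1]
  exact sq_nonneg _

/-- Writing `U = V |U|` on both sides gives `U* U' = |U| V* V' |U'|`; the range and kernel
conditions are those of the partial isometries. -/
theorem isCorrelation_gram {U V : E →L[ℝ] L} {U' V' : F →L[ℝ] L} (hU : IsHS U)
    (hV : IsPolar U V) (hV' : IsPolar U' V') :
    IsCorrelation (ContinuousLinearMap.adjoint U ∘L U) (ContinuousLinearMap.adjoint U' ∘L U')
      (ContinuousLinearMap.adjoint U ∘L U') (ContinuousLinearMap.adjoint V ∘L V') := by
  obtain ⟨b, a, hb⟩ :=
    (hU.comp_left (ContinuousLinearMap.adjoint U)).exists_isEig (isSelfAdjoint_gram U)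
  refine ⟨?_, fun x => hV.adjoint_mem _, fun x hx => ?_⟩
  · have h1 := (hb.opPow hb.nonneg_of_gram (by norm_num : (0 : ℝ) ≤ 1 / 2)).isSelfAdjoint
    rw [ContinuousLinearMap.comp_assoc, ← hV'.eq_comp, ← ContinuousLinearMap.comp_assoc]
    congr 1
    conv_lhs => rw [hV.eq_comp]
    rw [ContinuousLinearMap.adjoint_comp, ContinuousLinearMap.isSelfAdjoint_iff'.1 h1]
  · rw [ContinuousLinearMap.comp_apply, hV'.vanish x hx, map_zero]

/-- The correlation operator of a Gram matrix. -/
theorem correlation_gram {U V : E →L[ℝ] L} {U' V' : F →L[ℝ] L} (hU : IsHS U) (hU' : IsHS U')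
    (hV : IsPolar U V) (hV' : IsPolar U' V') :
    correlation (ContinuousLinearMap.adjoint U ∘L U) (ContinuousLinearMap.adjoint U' ∘L U')
      (ContinuousLinearMap.adjoint U ∘L U') = ContinuousLinearMap.adjoint V ∘L V' := by
  obtain ⟨b, a, hb⟩ :=
    (hU.comp_left (ContinuousLinearMap.adjoint U)).exists_isEig (isSelfAdjoint_gram U)
  obtain ⟨f, a', hf⟩ :=
    (hU'.comp_left (ContinuousLinearMap.adjoint U')).exists_isEig (isSelfAdjoint_gram U')
  have hex : ∃ R, IsCorrelation (ContinuousLinearMap.adjoint U ∘L U)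
    (ContinuousLinearMap.adjoint U' ∘L U') (ContinuousLinearMap.adjoint U ∘L U') R :=
    ⟨_, isCorrelation_gram hU hV hV'⟩
  rw [correlation, dif_pos hex]
  exact isCorrelation_unique hb hf hb.nonneg_of_gram hf.nonneg_of_gram hex.choose_spec
    (isCorrelation_gram hU hV hV')

end Polar

/-! ### Positivity and kernel of the correlation matrix. -/

section GramMatrix

variable {p : ℕ} {H : Fin p → Type*} [∀ i, NormedAddCommGroup (H i)]
  [∀ i, InnerProductSpace ℝ (H i)] [∀ i, CompleteSpace (H i)]
  {L : Type*} [NormedAddCommGroup L] [InnerProductSpace ℝ L] [CompleteSpace L]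
  {U V : ∀ i, H i →L[ℝ] L} {C R : ∀ i j, H j →L[ℝ] H i}

theorem corrMat_gram (hU : ∀ i, IsHS (U i)) (hV : ∀ i, IsPolar (U i) (V i))
    (hC : ∀ i j, C i j = ContinuousLinearMap.adjoint (U i) ∘L U j) (i j : Fin p) :
    corrMat C i j = if i = j then entry 1 i j else ContinuousLinearMap.adjoint (V i) ∘L V j := by
  rw [corrMat]
  split_ifs
  · rfl
  · rw [hC, hC, hC, correlation_gram (hU i) (hU j) (hV i) (hV j)]

theorem isSelfAdjoint_corr
    (hR : ∀ i j, R i j = if i = j then entry 1 i j else ContinuousLinearMap.adjoint (V i) ∘L V j) :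
    IsSelfAdjoint (toOp R) := by
  refine isSelfAdjoint_of_entry fun i j => ?_
  rw [entry_toOp, entry_toOp, hR, hR]
  by_cases h : i = j
  · subst h
    rw [if_pos rfl, entry_one_self]
    exact (ContinuousLinearMap.isSelfAdjoint_iff'.1 (IsSelfAdjoint.one (H i →L[ℝ] H i))).symm
  · rw [if_neg h, if_neg (Ne.symm h), ContinuousLinearMap.adjoint_comp,
      ContinuousLinearMap.adjoint_adjoint]

/-- Off the diagonal `R` is the Gram matrix of the `V i`, but on the diagonal it is the identity
instead of `V_i* V_i`; the second sum is this discrepancy. -/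
theorem inner_corr
    (hR : ∀ i j, R i j = if i = j then entry 1 i j else ContinuousLinearMap.adjoint (V i) ∘L V j)
    (x : PiLp 2 H) : inner ℝ x (toOp R x) =
      ‖∑ i, V i (x i)‖ ^ 2 + ∑ i, (‖x i‖ ^ 2 - ‖V i (x i)‖ ^ 2) := by
  rw [PiLp.inner_apply]
  have h1 : ∀ i, inner ℝ (x i) (toOp R x i) =
      inner ℝ (V i (x i)) (∑ j, V j (x j)) + (‖x i‖ ^ 2 - ‖V i (x i)‖ ^ 2) := by
    intro i
    rw [apply_eq_sum_entry, inner_sum, inner_sum, ← sub_eq_iff_eq_add', ← Finset.sum_sub_distrib,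
      Finset.sum_eq_single i]
    · rw [entry_toOp, hR, if_pos rfl, entry_one_self, one_apply_eq_self,
        real_inner_self_eq_norm_sq, real_inner_self_eq_norm_sq]
    · intro j _ hj
      rw [entry_toOp, hR, if_neg (Ne.symm hj), ContinuousLinearMap.comp_apply,
        ContinuousLinearMap.adjoint_inner_right, sub_self]
    · simp
  rw [Finset.sum_congr rfl fun i _ => h1 i, Finset.sum_add_distrib, ← sum_inner,
    real_inner_self_eq_norm_sq]

theorem norm_polar_le (hV : ∀ i, ‖V i‖ ≤ 1) (i : Fin p) (x : H i) : ‖V i x‖ ^ 2 ≤ ‖x‖ ^ 2 :=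
  pow_le_pow_left₀ (norm_nonneg _) (((V i).le_opNorm x).trans
    (mul_le_of_le_one_left (norm_nonneg x) (hV i))) 2

theorem inner_corr_nonneg
    (hR : ∀ i j, R i j = if i = j then entry 1 i j else ContinuousLinearMap.adjoint (V i) ∘L V j)
    (hV : ∀ i, ‖V i‖ ≤ 1) (x : PiLp 2 H) : 0 ≤ inner ℝ x (toOp R x) := by
  rw [inner_corr hR]
  exact add_nonneg (sq_nonneg _)
    (Finset.sum_nonneg fun i _ => sub_nonneg.2 (norm_polar_le hV i (x i)))

/-- A vector in the kernel of the correlation operator. -/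
theorem norm_polar_eq_of_corr_eq_zero
    (hR : ∀ i j, R i j = if i = j then entry 1 i j else ContinuousLinearMap.adjoint (V i) ∘L V j)
    (hV : ∀ i, ‖V i‖ ≤ 1) {x : PiLp 2 H} (hx : toOp R x = 0) :
    ∑ i, V i (x i) = 0 ∧ ∀ i, ‖V i (x i)‖ = ‖x i‖ := by
  have h1 := inner_corr hR x
  rw [hx, inner_zero_right] at h1
  have h2 : ∀ i ∈ Finset.univ, 0 ≤ ‖x i‖ ^ 2 - ‖V i (x i)‖ ^ 2 :=
    fun i _ => sub_nonneg.2 (norm_polar_le hV i (x i))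
  have h3 := Finset.sum_nonneg h2
  have h4 := sq_nonneg ‖∑ i, V i (x i)‖
  constructor
  · rw [← norm_eq_zero, ← sq_eq_zero_iff]
    linarith
  · intro i
    have h5 := (Finset.sum_eq_zero_iff_of_nonneg h2).1 (by linarith) i (Finset.mem_univ i)
    exact ((pow_left_inj₀ (norm_nonneg _) (norm_nonneg _) two_ne_zero).1 (by linarith)).symm

end GramMatrix

/-! ### Score operators into `L²` and the covariance as their Gram matrix. -/

section Score

variable {E F Ω : Type*} [NormedAddCommGroup E] [InnerProductSpace ℝ E] [CompleteSpace E]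
  [NormedAddCommGroup F] [InnerProductSpace ℝ F] [CompleteSpace F]
  [MeasurableSpace Ω] {μ : Measure Ω} {Y : Ω → E} {Z : Ω → F}

/-- The operator that maps `x` to the random variable `⟨x, Y⟩`. -/
def scoreOp (hY : MemLp Y 2 μ) : E →L[ℝ] Lp ℝ 2 μ :=
  LinearMap.mkContinuous
    { toFun := fun x => (hY.const_inner (𝕜 := ℝ) x).toLp _
      map_add' := fun x y => by
        rw [← MemLp.toLp_add]
        exact MemLp.toLp_congr _ _ (Filter.Eventually.of_forall fun ω => inner_add_left _ _ _)
      map_smul' := fun c x => by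
        rw [← MemLp.toLp_const_smul]
        exact MemLp.toLp_congr _ _ (Filter.Eventually.of_forall fun ω => inner_smul_left _ _ _) }
    (eLpNorm Y 2 μ).toReal fun x => by
      rw [LinearMap.coe_mk, AddHom.coe_mk, Lp.norm_toLp, mul_comm]
      have h1 := eLpNorm_le_mul_eLpNorm_of_ae_le_mul (μ := μ) (f := fun ω => inner ℝ x (Y ω))
        (g := Y) (c := ‖x‖) (Filter.Eventually.of_forall fun ω => norm_inner_le_norm x (Y ω)) 2
      have h2 := ENNReal.toReal_mono (ENNReal.mul_ne_top ENNReal.ofReal_ne_top hY.2.ne) h1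
      rwa [ENNReal.toReal_mul, ENNReal.toReal_ofReal (norm_nonneg x)] at h2

theorem scoreOp_apply (hY : MemLp Y 2 μ) (x : E) :
    scoreOp hY x = (hY.const_inner (𝕜 := ℝ) x).toLp _ := rfl

theorem coeFn_scoreOp (hY : MemLp Y 2 μ) (x : E) :
    scoreOp hY x =ᵐ[μ] fun ω => inner ℝ x (Y ω) := by
  rw [scoreOp_apply]
  exact MemLp.coeFn_toLp _

theorem inner_scoreOp (hY : MemLp Y 2 μ) (hZ : MemLp Z 2 μ) (x : E) (y : F) :
    inner ℝ (scoreOp hY x) (scoreOp hZ y) = ∫ ω, inner ℝ x (Y ω) * inner ℝ y (Z ω) ∂μ := by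
  rw [L2.inner_def]
  refine integral_congr_ae ?_
  filter_upwards [coeFn_scoreOp hY x, coeFn_scoreOp hZ y] with ω h1 h2
  rw [h1, h2, real_inner_eq_re_inner]
  simp [mul_comm]

theorem norm_sq_scoreOp (hY : MemLp Y 2 μ) (x : E) :
    ‖scoreOp hY x‖ ^ 2 = ∫ ω, inner ℝ x (Y ω) ^ 2 ∂μ := by
  rw [← real_inner_self_eq_norm_sq, inner_scoreOp]
  simp_rw [sq]

/-- By Bessel under the integral, every partial sum of the squared norms is at most the second
moment of `Y`. -/
theorem isHS_scoreOp (hY : MemLp Y 2 μ) : IsHS (scoreOp hY) := by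
  refine isHS_of_summable (onb E) (summable_of_sum_le (fun _ => sq_nonneg _)
    (c := ∫ ω, ‖Y ω‖ ^ 2 ∂μ) fun s => ?_)
  simp_rw [norm_sq_scoreOp]
  rw [← integral_finsetSum _ fun k _ => (hY.const_inner (𝕜 := ℝ) (onb E k)).integrable_sq]
  refine integral_mono (integrable_finsetSum _ fun k _ =>
    (hY.const_inner (𝕜 := ℝ) (onb E k)).integrable_sq) hY.norm.integrable_sq fun ω => ?_
  have := (onb E).orthonormal.sum_inner_products_le (Y ω) (s := s)
  simpa using this

theorem integrable_rankOne (hY : MemLp Y 2 μ) (hZ : MemLp Z 2 μ) :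
    Integrable (fun ω => InnerProductSpace.rankOne ℝ (Y ω) (Z ω)) μ := by
  have hc : Continuous fun q : E × F => InnerProductSpace.rankOne ℝ q.1 q.2 :=
    (ContinuousLinearMap.smulRightL ℝ F E).continuous₂.comp
      (((innerSL ℝ).continuous.comp continuous_snd).prodMk continuous_fst)
  have h1 := hc.comp_aestronglyMeasurable (hY.1.prodMk hZ.1)
  refine (hY.norm.integrable_mul hZ.norm).mono h1 (Filter.Eventually.of_forall fun ω => ?_)
  simp

theorem integral_rankOne (hY : MemLp Y 2 μ) (hZ : MemLp Z 2 μ) :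
    ∫ ω, InnerProductSpace.rankOne ℝ (Y ω) (Z ω) ∂μ =
      ContinuousLinearMap.adjoint (scoreOp hY) ∘L scoreOp hZ := by
  ext y
  refine ext_inner_left ℝ fun x => ?_
  rw [ContinuousLinearMap.comp_apply, ContinuousLinearMap.adjoint_inner_right, inner_scoreOp,
    ContinuousLinearMap.integral_apply (integrable_rankOne hY hZ) y]
  have hi := (integrable_rankOne hY hZ).apply_continuousLinearMap y
  rw [← integral_inner hi x]
  refine integral_congr_ae (Filter.Eventually.of_forall fun ω => ?_)
  simp only [InnerProductSpace.rankOne_apply, inner_smul_right, real_inner_comm y]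
  ring

theorem coeFn_finset_sum {ι : Type*} (s : Finset ι) (g : ι → Lp ℝ 2 μ) :
    ((∑ i ∈ s, g i : Lp ℝ 2 μ) : Ω → ℝ) =ᵐ[μ] fun ω => ∑ i ∈ s, g i ω := by
  classical
  induction s using Finset.induction_on with
  | empty =>
    simp only [Finset.sum_empty]
    exact Lp.coeFn_zero ℝ 2 μ
  | insert a s ha ih =>
    rw [Finset.sum_insert ha]
    filter_upwards [Lp.coeFn_add (g a) (∑ i ∈ s, g i), ih] with ω h1 h2
    rw [h1, Pi.add_apply, h2, Finset.sum_insert ha]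

end Score

/-! ### Independence of limits of Gaussian scores under absolute continuity. -/

section Gaussian

variable {p : ℕ} {H : Fin p → Type*} [∀ i, NormedAddCommGroup (H i)]
  [∀ i, InnerProductSpace ℝ (H i)] [∀ i, CompleteSpace (H i)]
  [∀ i, TopologicalSpace.SeparableSpace (H i)] [∀ i, MeasurableSpace (H i)]
  [∀ i, BorelSpace (H i)] {Ω : Type*} [MeasurableSpace Ω] {μ : Measure Ω} [IsProbabilityMeasure μ]
  {X : ∀ i, Ω → H i}

theorem memLp_centered (hX : ∀ i, MemLp (X i) 2 μ) (i : Fin p) :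
    MemLp (fun ω => X i ω - ∫ ω', X i ω' ∂μ) 2 μ := (hX i).sub (memLp_const _)

theorem covMat_eq_gram (hX : ∀ i, MemLp (X i) 2 μ) (i j : Fin p) :
    covMat μ X i j = ContinuousLinearMap.adjoint (scoreOp (memLp_centered hX i)) ∘L
      scoreOp (memLp_centered hX j) :=
  integral_rankOne (memLp_centered hX i) (memLp_centered hX j)

/-- The characteristic function of the scores of a Gaussian random element. -/
theorem integral_cexp_score (hX : ∀ i, MemLp (X i) 2 μ)
    (hG : IsGaussian (μ.map fun ω i => X i ω)) (i : Fin p) (y : H i) :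
    ∫ x, Complex.exp ((inner ℝ y (x - ∫ ω', X i ω' ∂μ) : ℝ) * Complex.I) ∂(μ.map (X i)) =
      Real.exp (-(‖scoreOp (memLp_centered hX i) y‖ ^ 2 / 2)) := by
  have hXm : ∀ i, AEMeasurable (X i) μ := fun i => (hX i).1.aemeasurable
  have hXm' : AEMeasurable (fun ω i => X i ω) μ := aemeasurable_pi_iff.2 hXm
  set c := ∫ ω', X i ω' ∂μ with hc
  let L : StrongDual ℝ (∀ i, H i) := innerSL ℝ y ∘L ContinuousLinearMap.proj i
  have hL : ∀ x, L x = inner ℝ y (x i) := fun x => rfl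
  have hLm : Measurable L := by
    have : (L : (∀ i, H i) → ℝ) = (innerSL ℝ y) ∘ fun x => x i := rfl
    rw [this]
    exact (innerSL ℝ y).measurable.comp (measurable_pi_apply i)
  have h1 := hG.map_eq_gaussianReal L
  have hm : ∫ x, L x ∂(μ.map fun ω i => X i ω) = inner ℝ y c := by
    rw [integral_map hXm' hLm.aestronglyMeasurable]
    simp only [hL]
    exact integral_inner ((hX i).integrable one_le_two) y
  have hv : Var[L; μ.map fun ω i => X i ω] = ‖scoreOp (memLp_centered hX i) y‖ ^ 2 := by
    rw [variance_map hLm.aemeasurable hXm', variance_eq_integral (hLm.comp_aemeasurable hXm'),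
      norm_sq_scoreOp]
    have e : ∫ ω, (L ∘ fun ω i => X i ω) ω ∂μ = inner ℝ y c := by
      rw [← hm, integral_map hXm' hLm.aestronglyMeasurable]
      rfl
    rw [e]
    refine integral_congr_ae (Filter.Eventually.of_forall fun ω => ?_)
    simp only [Function.comp_apply, hL, inner_sub_right]
    rfl
  rw [AEMeasurable.map_map_of_aemeasurable hLm.aemeasurable hXm', hm, hv] at h1
  have h2 := charFun_gaussianReal (μ := inner ℝ y c)
    (v := (‖scoreOp (memLp_centered hX i) y‖ ^ 2).toNNReal) 1
  rw [← h1, charFun_apply_real, integral_map (hLm.comp_aemeasurable hXm') (by fun_prop)] at h2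
  rw [integral_map (hXm i) (by fun_prop)]
  have e : ∀ ω, Complex.exp ((inner ℝ y (X i ω - c) : ℝ) * Complex.I) =
      Complex.exp (-((inner ℝ y c : ℝ) * Complex.I)) *
        Complex.exp ((1 : ℝ) * ((L ∘ fun ω i => X i ω) ω : ℝ) * Complex.I) := by
    intro ω
    rw [← Complex.exp_add, Function.comp_apply, hL, inner_sub_right]
    congr 1
    push_cast
    ring
  refine (integral_congr_ae (Filter.Eventually.of_forall e)).trans ?_
  rw [integral_const_mul, h2, ← Complex.exp_add, Complex.ofReal_exp,
    Real.coe_toNNReal _ (sq_nonneg _)]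
  congr 1
  push_cast
  ring

/-- If the law of a Gaussian random element dominates the product of the laws of its components,
then a relation between limits of scores is trivial. -/
theorem eq_zero_of_sum_scores_eq_zero (hX : ∀ i, MemLp (X i) 2 μ)
    (hG : IsGaussian (μ.map fun ω i => X i ω))
    (hac : Measure.pi (fun i => μ.map (X i)) ≪ μ.map fun ω i => X i ω)
    {z : Fin p → Lp ℝ 2 μ} (hz : ∀ i, z i ∈ (LinearMap.range
      (scoreOp (memLp_centered hX i) : H i →ₗ[ℝ] Lp ℝ 2 μ)).topologicalClosure)
    (h0 : ∑ i, z i = 0) (i : Fin p) : z i = 0 := by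
  have hXm : ∀ i, AEMeasurable (X i) μ := fun i => (hX i).1.aemeasurable
  have hXm' : AEMeasurable (fun ω i => X i ω) μ := aemeasurable_pi_iff.2 hXm
  have : ∀ i, IsProbabilityMeasure (μ.map (X i)) := fun i => Measure.isProbabilityMeasure_map (hXm i)
  have hy : ∀ i, ∃ y : ℕ → H i, Filter.Tendsto (fun m => scoreOp (memLp_centered hX i) (y m))
      Filter.atTop (nhds (z i)) := by
    intro i
    obtain ⟨u, hu, hlim⟩ := mem_closure_iff_seq_limit.1 (hz i)
    choose y hy using hu
    refine ⟨y, hlim.congr fun m => (hy m).symm⟩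
  choose y hy using hy
  set c : ∀ i, H i := fun i => ∫ ω', X i ω' ∂μ with hc
  have hsum : Filter.Tendsto (fun m => ∑ i, scoreOp (memLp_centered hX i) (y i m)) Filter.atTop
      (nhds 0) := by
    rw [← h0]
    exact tendsto_finsetSum _ fun i _ => hy i
  -- Convergence in `L²` does not pass to another law, but almost everywhere convergence of a
  -- subsequence does.
  obtain ⟨ns, hns, hae⟩ := (tendstoInMeasure_of_tendsto_Lp hsum).exists_seq_tendsto_ae
  let g : ℕ → (∀ i, H i) → ℝ := fun m x => ∑ i, inner ℝ (y i m) (x i - c i)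
  have hgm : ∀ m, Measurable (g m) := fun m => Finset.measurable_sum _ fun i _ =>
    (innerSL ℝ (y i m)).measurable.comp ((measurable_pi_apply i).sub_const (c i))
  have hcoe : ∀ᵐ ω ∂μ, ∀ m, (∑ i, scoreOp (memLp_centered hX i) (y i m) : Lp ℝ 2 μ) ω =
      g m fun i => X i ω := by
    rw [ae_all_iff]
    intro m
    have h1 : ∀ᵐ ω ∂μ, ∀ i, scoreOp (memLp_centered hX i) (y i m) ω =
        inner ℝ (y i m) (X i ω - c i) := by
      rw [ae_all_iff]
      exact fun i => coeFn_scoreOp _ _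
    filter_upwards [coeFn_finset_sum Finset.univ
      fun i => scoreOp (memLp_centered hX i) (y i m), h1] with ω h2 h3
    rw [h2]
    exact Finset.sum_congr rfl fun i _ => h3 i
  have hν : ∀ᵐ x ∂(μ.map fun ω i => X i ω),
      Filter.Tendsto (fun k => g (ns k) x) Filter.atTop (nhds 0) := by
    rw [ae_map_iff hXm' (measurableSet_tendsto _ fun k => hgm (ns k))]
    filter_upwards [hae, hcoe, Lp.coeFn_zero ℝ 2 μ] with ω h1 h2 h3
    rw [h3] at h1
    exact h1.congr fun k => h2 (ns k)
  have hπ := hac.ae_le hν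
  have hlim1 : Filter.Tendsto (fun k => ∫ x, Complex.exp ((g (ns k) x : ℝ) * Complex.I)
      ∂(Measure.pi fun i => μ.map (X i))) Filter.atTop (nhds 1) := by
    have h1 : (1 : ℂ) = ∫ _x, (1 : ℂ) ∂(Measure.pi fun i => μ.map (X i)) := by simp
    rw [h1]
    refine tendsto_integral_of_dominated_convergence (fun _ => 1) (fun k => ?_)
      (integrable_const 1) (fun k => ?_) ?_
    · have := hgm (ns k)
      exact Measurable.aestronglyMeasurable (by fun_prop)
    · exact Filter.Eventually.of_forall fun x => (Complex.norm_exp_ofReal_mul_I _).le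
    · filter_upwards [hπ] with x hx
      have hcont : Continuous fun t : ℝ => Complex.exp ((t : ℂ) * Complex.I) := by fun_prop
      have := (hcont.tendsto 0).comp hx
      rwa [Complex.ofReal_zero, zero_mul, Complex.exp_zero] at this
  -- Under the product law the components are independent, so the characteristic function
  -- factorizes. It depends only on the marginals, and so on norms computed in `L²(μ)`.
  have hprod : ∀ m, ∫ x, Complex.exp ((g m x : ℝ) * Complex.I)
      ∂(Measure.pi fun i => μ.map (X i)) =
      (Real.exp (-(∑ i, ‖scoreOp (memLp_centered hX i) (y i m)‖ ^ 2 / 2)) : ℝ) := by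
    intro m
    have e : ∀ x : ∀ i, H i, Complex.exp ((g m x : ℝ) * Complex.I) =
        ∏ i, Complex.exp ((inner ℝ (y i m) (x i - c i) : ℝ) * Complex.I) := by
      intro x
      rw [← Complex.exp_sum, ← Finset.sum_mul]
      simp only [g]
      push_cast
      rfl
    simp_rw [e]
    rw [integral_fintype_prod_eq_prod
      (f := fun i (x : H i) => Complex.exp ((inner ℝ (y i m) (x - c i) : ℝ) * Complex.I)),
      Finset.prod_congr rfl fun i _ => integral_cexp_score hX hG i (y i m), ← Complex.ofReal_prod,
      ← Real.exp_sum, Finset.sum_neg_distrib]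
  have hlim2 : Filter.Tendsto (fun k => ∫ x, Complex.exp ((g (ns k) x : ℝ) * Complex.I)
      ∂(Measure.pi fun i => μ.map (X i))) Filter.atTop
      (nhds (Real.exp (-(∑ i, ‖z i‖ ^ 2 / 2)) : ℝ)) := by
    simp_rw [hprod]
    refine (Complex.continuous_ofReal.tendsto _).comp ((Real.continuous_exp.tendsto _).comp ?_)
    exact (tendsto_finsetSum _ fun i _ =>
      (((hy i).comp hns.tendsto_atTop).norm.pow 2).div_const 2).neg
  -- The two limits give `exp (-∑ ‖z i‖² / 2) = 1`.
  have hone := tendsto_nhds_unique hlim1 hlim2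
  have hexp : Real.exp (-(∑ i, ‖z i‖ ^ 2 / 2)) = 1 := by exact_mod_cast hone.symm
  rw [Real.exp_eq_one_iff, neg_eq_zero, Finset.sum_eq_zero_iff_of_nonneg
    fun i _ => by positivity] at hexp
  have := hexp i (Finset.mem_univ i)
  rw [div_eq_zero_iff, or_iff_left two_ne_zero, sq_eq_zero_iff, norm_eq_zero] at this
  exact this

end Gaussian

/-! ### Lower bound for the correlation operator. -/

section Correlation

variable {p : ℕ} {H : Fin p → Type*} [∀ i, NormedAddCommGroup (H i)]
  [∀ i, InnerProductSpace ℝ (H i)] [∀ i, CompleteSpace (H i)]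
  [∀ i, TopologicalSpace.SeparableSpace (H i)] [∀ i, MeasurableSpace (H i)]
  [∀ i, BorelSpace (H i)] {Ω : Type*} [MeasurableSpace Ω] {μ : Measure Ω} [IsProbabilityMeasure μ]
  {X : ∀ i, Ω → H i} {C R Φ : ∀ i j, H j →L[ℝ] H i} {β : ℝ}

theorem isHS_of_regular (hReg : Regular C R β Φ) : IsHS (toOp R - 1) := by
  refine isHS_of_entry fun i j => ?_
  rw [hReg.2.2]
  exact ((hReg.2.1 i j).comp_right _).comp_left _

/-- The correlation operator is self-adjoint and bounded below. -/
theorem isSelfAdjoint_corr_and_lower (hX : ∀ i, MemLp (X i) 2 μ) (hC : C = covMat μ X)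
    (hR : R = corrMat C) (hEquiv : GaussianEquivalence μ X ∨ EigenvalueGap R)
    (hHS : IsHS (toOp R - 1)) :
    IsSelfAdjoint (toOp R) ∧ ∃ c > 0, ∀ x, c * ‖x‖ ^ 2 ≤ inner ℝ x (toOp R x) := by
  choose V hV using fun i => exists_isPolar (isHS_scoreOp (memLp_centered hX i))
  have hRV : ∀ i j, R i j = if i = j then entry 1 i j else
      ContinuousLinearMap.adjoint (V i) ∘L V j := fun i j => by
    rw [hR]
    exact corrMat_gram (fun i => isHS_scoreOp (memLp_centered hX i)) hV
      (fun i j => by rw [hC, covMat_eq_gram hX]) i j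
  have hsa := isSelfAdjoint_corr hRV
  refine ⟨hsa, ?_⟩
  obtain ⟨b, a, hb⟩ := hHS.exists_isEig (isSelfAdjoint_sub hsa (IsSelfAdjoint.one _))
  have hb1 : IsEig (toOp R) b (fun k => 1 + a k) := by
    have := (isEig_one b).add hb
    rwa [add_sub_cancel] at this
  suffices ∃ c > 0, ∀ k, c ≤ 1 + a k by
    obtain ⟨c, hc, hca⟩ := this
    exact ⟨c, hc, hb1.le_inner hca⟩
  rcases hEquiv with hG | ⟨-, c, hc, hgap⟩
  -- Gaussian case: if `1 + a k = 0`, then `b k` is in the kernel of `R`, so the `V i` preserve the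
  -- norms of its components and map them to limits of scores with sum zero. Such limits vanish,
  -- contradicting `b k ≠ 0`.
  · refine hb.exists_gap hHS fun k => ?_
    have h0 : 0 ≤ 1 + a k := hb1.le_of_forall (fun x => by
      rw [zero_mul]; exact inner_corr_nonneg hRV (fun i => (hV i).norm_le) x) k
    refine h0.lt_of_ne' fun hk => b.orthonormal.ne_zero k ?_
    have hker : toOp R (b k) = 0 := (hb1 k).trans (by beta_reduce; rw [hk, zero_smul])
    obtain ⟨h1, h2⟩ := norm_polar_eq_of_corr_eq_zero hRV (fun i => (hV i).norm_le) hker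
    ext i
    rw [PiLp.zero_apply, ← norm_eq_zero, ← h2 i,
      eq_zero_of_sum_scores_eq_zero hX hG.1 hG.2.2 (fun i => (hV i).mem_closure _) h1 i, norm_zero]
  · refine ⟨c, hc, fun k => hgap _ ?_⟩
    exact Module.End.hasEigenvalue_of_hasEigenvector
      (Module.End.hasEigenvector_iff.2 ⟨Module.End.mem_eigenspace_iff.2 (hb k),
        b.orthonormal.ne_zero k⟩)

theorem isHS_covMat (hX : ∀ i, MemLp (X i) 2 μ) (i j : Fin p) : IsHS (covMat μ X i j) := by
  rw [covMat_eq_gram hX]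
  exact (isHS_scoreOp _).comp_left _

theorem exists_isEig_covMat (hX : ∀ i, MemLp (X i) 2 μ) (i : Fin p) :
    ∃ (b : HilbertBasis (Σ c : ℝ, onbIndex
        (Module.End.eigenspace (covMat μ X i i : H i →ₗ[ℝ] H i) c)) ℝ (H i))
      (a : (Σ c : ℝ, onbIndex (Module.End.eigenspace (covMat μ X i i : H i →ₗ[ℝ] H i) c)) → ℝ),
      IsEig (covMat μ X i i) b a ∧ ∀ k, 0 ≤ a k := by
  have h1 := covMat_eq_gram hX i i
  obtain ⟨b, a, hb⟩ := (isHS_covMat hX i i).exists_isEig (by rw [h1]; exact isSelfAdjoint_gram _)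
  exact ⟨b, a, hb, (h1 ▸ hb : IsEig (ContinuousLinearMap.adjoint
    (scoreOp (memLp_centered hX i)) ∘L scoreOp (memLp_centered hX i)) b a).nonneg_of_gram⟩

theorem covMat_eq_comp_corrMat (hX : ∀ i, MemLp (X i) 2 μ) {i j : Fin p} (hij : i ≠ j) :
    covMat μ X i j = opPow (covMat μ X i i) (1 / 2) ∘L corrMat (covMat μ X) i j ∘L
      opPow (covMat μ X j j) (1 / 2) := by
  obtain ⟨V, hV⟩ := exists_isPolar (isHS_scoreOp (memLp_centered hX i))
  obtain ⟨V', hV'⟩ := exists_isPolar (isHS_scoreOp (memLp_centered hX j))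
  have h1 := isHS_scoreOp (memLp_centered hX i)
  have h2 := isHS_scoreOp (memLp_centered hX j)
  rw [corrMat, if_neg hij, covMat_eq_gram hX i j, covMat_eq_gram hX i i, covMat_eq_gram hX j j,
    correlation_gram h1 h2 hV hV']
  exact (isCorrelation_gram h1 hV hV').1

end Correlation

/-! ### Perturbation and bias of the regularized inverse square root. -/

section Regularization

variable {E F : Type*} [NormedAddCommGroup E] [InnerProductSpace ℝ E] [CompleteSpace E]
  [NormedAddCommGroup F] [InnerProductSpace ℝ F] [CompleteSpace F] {ι ι' κ κ' : Type*}
  {A A' : E →L[ℝ] E} {b : HilbertBasis ι ℝ E} {b' : HilbertBasis ι' ℝ E} {a : ι → ℝ} {a' : ι' → ℝ}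
  {ε β : ℝ}

theorem IsEig.opPow_half (h : IsEig A b a) (ha : ∀ k, 0 ≤ a k) :
    IsEig (FGL.opPow A (1 / 2)) b (fun k => √(a k)) := by
  simp_rw [Real.sqrt_eq_rpow]
  exact h.opPow ha (by norm_num)

theorem IsEig.opPow_add (h : IsEig A b a) (ha : ∀ k, 0 ≤ a k) (hε : 0 < ε) :
    IsEig (FGL.opPow (ε • 1 + A) (-1 / 2)) b (fun k => (√(ε + a k))⁻¹) := by
  have e : ∀ k, (ε + a k) ^ (-1 / 2 : ℝ) = (√(ε + a k))⁻¹ := fun k => by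
    rw [neg_div, Real.rpow_neg (by linarith [ha k]), Real.sqrt_eq_rpow]
  have h1 := ((isEig_smul_one ε b).add h).opFun (fun x => x ^ (-1 / 2 : ℝ)) (M := (√ε)⁻¹)
    fun k => by
      rw [e k, abs_of_nonneg (by positivity)]
      exact inv_anti₀ (Real.sqrt_pos.2 hε) (Real.sqrt_le_sqrt (by linarith [ha k]))
  simp only [e] at h1
  exact h1

theorem norm_opPow_add_le (h : IsEig A b a) (ha : ∀ k, 0 ≤ a k) (hε : 0 < ε) :
    ‖opPow (ε • 1 + A) (-1 / 2)‖ ≤ (√ε)⁻¹ := by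
  refine (h.opPow_add ha hε).norm_le (by positivity) fun k => ?_
  rw [abs_of_nonneg (by positivity)]
  exact inv_anti₀ (Real.sqrt_pos.2 hε) (Real.sqrt_le_sqrt (by linarith [ha k]))

theorem sqrt_div_sqrt_add_le_one {x : ℝ} (hε : 0 < ε) (hx : 0 ≤ x) :
    (√(ε + x))⁻¹ * √x ≤ 1 := by
  rw [inv_mul_le_iff₀ (Real.sqrt_pos.2 (by linarith)), mul_one]
  exact Real.sqrt_le_sqrt (by linarith)

theorem norm_opPow_add_comp_le (h : IsEig A b a) (ha : ∀ k, 0 ≤ a k) (hε : 0 < ε) :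
    ‖opPow (ε • 1 + A) (-1 / 2) ∘L opPow A (1 / 2)‖ ≤ 1 := by
  refine ((h.opPow_add ha hε).comp (h.opPow_half ha)).norm_le zero_le_one fun k => ?_
  rw [abs_of_nonneg (by positivity)]
  exact sqrt_div_sqrt_add_le_one hε (ha k)

/-- The perturbation of the regularized inverse square root. -/
theorem hs_regularized_sub_le (h : IsEig A b a) (ha : ∀ k, 0 ≤ a k) (h' : IsEig A' b' a')
    (ha' : ∀ k, 0 ≤ a' k) (hε : 0 < ε) (hd : IsHS (A' - A)) :
    IsHS ((opPow (ε • 1 + A') (-1 / 2) - opPow (ε • 1 + A) (-1 / 2)) ∘L opPow A (1 / 2)) ∧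
    hs ((opPow (ε • 1 + A') (-1 / 2) - opPow (ε • 1 + A) (-1 / 2)) ∘L opPow A (1 / 2)) ≤
      1 / (2 * ε) * hs (A' - A) := by
  -- Between the eigenbases of `A` and `A'` both operators have explicit coefficients, whose ratio
  -- is in modulus `√a / (u v (u + v))` with `u = √(ε + a')`, `v = √(ε + a)`. It is at most `1 /
  -- (2ε)`, as `√a ≤ v` and `u, v ≥ √ε`. No commutation of `A` and `A'` is needed.
  refine isHS_and_hs_le_of_matrix_le b b' (by positivity) hd fun k l => ?_
  have hk := ha k
  have hl := ha' l
  rw [ContinuousLinearMap.comp_apply, h.opPow_half ha k, map_smul, inner_smul_right,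
    sub_apply, inner_sub_right, (h'.opPow_add ha' hε).inner_basis, h.opPow_add ha hε k,
    inner_smul_right, sub_apply, inner_sub_right, h'.inner_basis, h k, inner_smul_right,
    ← sub_mul, ← sub_mul, abs_mul, abs_mul, abs_mul, ← mul_assoc, ← mul_assoc]
  refine mul_le_mul_of_nonneg_right ?_ (abs_nonneg _)
  set u := √(ε + a' l) with hu
  set v := √(ε + a k) with hv
  have hu0 : √ε ≤ u := Real.sqrt_le_sqrt (by linarith)
  have hv0 : √ε ≤ v := Real.sqrt_le_sqrt (by linarith)
  have hε0 : 0 < √ε := Real.sqrt_pos.2 hε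
  have hu1 : 0 < u := hε0.trans_le hu0
  have hv1 : 0 < v := hε0.trans_le hv0
  have hav : √(a k) ≤ v := Real.sqrt_le_sqrt (by linarith)
  have e1 : a' l - a k = (u - v) * (u + v) := by
    have h1 : u ^ 2 = ε + a' l := Real.sq_sqrt (by linarith)
    have h2 : v ^ 2 = ε + a k := Real.sq_sqrt (by linarith)
    linear_combination h2 - h1
  have e2 : u⁻¹ - v⁻¹ = -(u - v) / (u * v) := by
    field_simp
    ring
  have e3 : ε = √ε * √ε := (Real.mul_self_sqrt hε.le).symm
  rw [e1, e2, abs_div, abs_neg, abs_mul (u - v), abs_of_pos (mul_pos hu1 hv1),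
    abs_of_pos (add_pos hu1 hv1), abs_of_nonneg (Real.sqrt_nonneg _)]
  have h3 : 2 * ε ≤ u * (u + v) := by
    rw [e3]
    nlinarith
  have h4 : √(a k) * (|u - v| / (u * v)) ≤ |u - v| / u := by
    rw [mul_div_assoc', div_le_div_iff₀ (mul_pos hu1 hv1) hu1]
    have := mul_le_mul_of_nonneg_right hav (mul_nonneg (abs_nonneg (u - v)) hu1.le)
    linarith
  refine h4.trans ?_
  rw [one_div, ← div_eq_inv_mul, div_le_div_iff₀ hu1 (by positivity)]
  have := mul_le_mul_of_nonneg_left h3 (abs_nonneg (u - v))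
  linarith

/-- The bias of the regularized inverse square root on the range of a power. -/
theorem norm_regularized_bias_le (h : IsEig A b a) (ha : ∀ k, 0 ≤ a k) (hε : 0 < ε) (hβ : 0 < β)
    (hβ' : β ≤ 1) :
    ‖(1 - opPow (ε • 1 + A) (-1 / 2) ∘L opPow A (1 / 2)) ∘L opPow A β‖ ≤ ε ^ β := by
  refine (((isEig_one b).sub ((h.opPow_add ha hε).comp (h.opPow_half ha))).comp
    (h.opPow ha hβ.le)).norm_le (by positivity) fun k => ?_
  have hk := ha k
  have h1 := sqrt_div_sqrt_add_le_one hε hk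
  have h2 : 0 ≤ (√(ε + a k))⁻¹ * √(a k) := by positivity
  rw [abs_mul, abs_of_nonneg (sub_nonneg.2 h1), abs_of_nonneg (Real.rpow_nonneg hk β)]
  have hεa : 0 < ε + a k := by linarith
  -- For `y = √a / √(ε + a) ≤ 1` one has `y ≥ y² = 1 - ε / (ε + a)`.
  have h3 : 1 - (√(ε + a k))⁻¹ * √(a k) ≤ ε / (ε + a k) := by
    have e : ((√(ε + a k))⁻¹ * √(a k)) ^ 2 = 1 - ε / (ε + a k) := by
      rw [mul_pow, inv_pow, Real.sq_sqrt hεa.le, Real.sq_sqrt hk]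
      field_simp
      ring
    nlinarith
  rcases hk.eq_or_lt with h0 | hpos
  · rw [← h0, Real.zero_rpow hβ.ne', mul_zero]
    positivity
  calc (1 - (√(ε + a k))⁻¹ * √(a k)) * a k ^ β ≤ ε / (ε + a k) * (ε + a k) ^ β := by
        gcongr
        linarith
    _ = ε * (ε + a k) ^ (β - 1) := by
        rw [Real.rpow_sub_one hεa.ne']
        ring
    _ ≤ ε * ε ^ (β - 1) := by
        refine mul_le_mul_of_nonneg_left ?_ hε.le
        exact Real.rpow_le_rpow_of_nonpos hε (by linarith) (by linarith)
    _ = ε ^ β := by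
        rw [Real.rpow_sub_one hε.ne']
        field_simp

theorem norm_opPow_le (h : IsEig A b a) (ha : ∀ k, 0 ≤ a k) (hβ : 0 ≤ β) :
    ‖opPow A β‖ ≤ ‖A‖ ^ β := by
  refine (h.opPow ha hβ).norm_le (by positivity) fun k => ?_
  rw [abs_of_nonneg (Real.rpow_nonneg (ha k) β)]
  exact Real.rpow_le_rpow (ha k) ((le_abs_self _).trans (h.abs_le k)) hβ

theorem adjoint_comp_of_isSelfAdjoint {P Q : E →L[ℝ] E} (hP : IsSelfAdjoint P)
    (hQ : IsSelfAdjoint Q) : ContinuousLinearMap.adjoint (P ∘L Q) = Q ∘L P := by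
  rw [ContinuousLinearMap.adjoint_comp, ContinuousLinearMap.isSelfAdjoint_iff'.1 hP,
    ContinuousLinearMap.isSelfAdjoint_iff'.1 hQ]

variable {B B' : F →L[ℝ] F} {f : HilbertBasis κ ℝ F} {f' : HilbertBasis κ' ℝ F} {c : κ → ℝ}
  {c' : κ' → ℝ} {K K' T Φ : F →L[ℝ] E} {δ m : ℝ}

/-- The error of the regularized estimator of a correlation operator. -/
theorem hs_corrEst_sub_le (hA : IsEig A b a) (ha : ∀ k, 0 ≤ a k) (hA' : IsEig A' b' a')
    (ha' : ∀ k, 0 ≤ a' k) (hB : IsEig B f c) (hc : ∀ k, 0 ≤ c k) (hB' : IsEig B' f' c')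
    (hc' : ∀ k, 0 ≤ c' k) (hε : 0 < ε) (hβ : 0 < β) (hβ' : β ≤ 1)
    (hK : K = opPow A (1 / 2) ∘L T ∘L opPow B (1 / 2))
    (hT : T = opPow A β ∘L Φ ∘L opPow B β) (hΦ : IsHS Φ)
    (hdA : IsHS (A' - A)) (hdB : IsHS (B' - B)) (hdK : IsHS (K' - K))
    (hδA : hs (A' - A) ≤ δ) (hδB : hs (B' - B) ≤ δ) (hδK : hs (K' - K) ≤ δ) (hm : ‖T‖ ≤ m) :
    IsHS (opPow (ε • 1 + A') (-1 / 2) ∘L K' ∘L opPow (ε • 1 + B') (-1 / 2) - T) ∧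
    hs (opPow (ε • 1 + A') (-1 / 2) ∘L K' ∘L opPow (ε • 1 + B') (-1 / 2) - T) ≤
      δ / ε + (δ / (2 * ε) * m * (1 + δ / (2 * ε)) + m * (δ / (2 * ε))) +
        ε ^ β * hs Φ * (‖B‖ ^ β + ‖A‖ ^ β) := by
  set P := opPow A (1 / 2) with hP
  set Q := opPow B (1 / 2) with hQ
  set M := opPow (ε • 1 + A) (-1 / 2) with hM
  set M' := opPow (ε • 1 + A') (-1 / 2) with hM'
  set N := opPow (ε • 1 + B) (-1 / 2) with hN
  set N' := opPow (ε • 1 + B') (-1 / 2) with hN'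
  have hδ0 : 0 ≤ δ := (hs_nonneg _).trans hδA
  have hm0 : 0 ≤ m := (norm_nonneg _).trans hm
  obtain ⟨hDA, hDA1⟩ := hs_regularized_sub_le hA ha hA' ha' hε hdA
  obtain ⟨hDB, hDB1⟩ := hs_regularized_sub_le hB hc hB' hc' hε hdB
  have hq : 0 ≤ δ / (2 * ε) := by positivity
  have hDA2 : hs ((M' - M) ∘L P) ≤ δ / (2 * ε) := hDA1.trans (by
    rw [one_div_mul_eq_div]
    gcongr)
  have hDB2 : hs ((N' - N) ∘L Q) ≤ δ / (2 * ε) := hDB1.trans (by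
    rw [one_div_mul_eq_div]
    gcongr)
  have hsQ := (hB.opPow_half hc).isSelfAdjoint
  have hsN := (hB.opPow_add hc hε).isSelfAdjoint
  have hsN' := (hB'.opPow_add hc' hε).isSelfAdjoint
  have eDB : Q ∘L (N' - N) = ContinuousLinearMap.adjoint ((N' - N) ∘L Q) :=
    (adjoint_comp_of_isSelfAdjoint (isSelfAdjoint_sub hsN' hsN) hsQ).symm
  have hDB3 : IsHS (Q ∘L (N' - N)) := eDB ▸ hDB.adjoint
  have hDB4 : hs (Q ∘L (N' - N)) ≤ δ / (2 * ε) := by rw [eDB, hs_adjoint]; exact hDB2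
  have hMP : ‖M ∘L P‖ ≤ 1 := norm_opPow_add_comp_le hA ha hε
  have hQN : ‖Q ∘L N‖ ≤ 1 := by
    rw [← adjoint_comp_of_isSelfAdjoint hsN hsQ, LinearIsometryEquiv.norm_map]
    exact norm_opPow_add_comp_le hB hc hε
  have hQN' : ‖Q ∘L N'‖ ≤ 1 + δ / (2 * ε) := by
    have e : Q ∘L N' = Q ∘L N + Q ∘L (N' - N) := by
      rw [← ContinuousLinearMap.comp_add, add_sub_cancel]
    rw [e]
    exact (norm_add_le _ _).trans (add_le_add hQN ((norm_le_hs hDB3).trans hDB4))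
  have hsβ := (hB.opPow hc hβ.le).isSelfAdjoint
  have hbias : ‖opPow B β ∘L (1 - Q ∘L N)‖ ≤ ε ^ β := by
    have e : opPow B β ∘L (1 - Q ∘L N) =
        ContinuousLinearMap.adjoint ((1 - N ∘L Q) ∘L opPow B β) := by
      have h1 : ContinuousLinearMap.adjoint (1 - N ∘L Q) = 1 - Q ∘L N := by
        rw [map_sub, adjoint_comp_of_isSelfAdjoint hsN hsQ,
          ContinuousLinearMap.isSelfAdjoint_iff'.1 (IsSelfAdjoint.one (F →L[ℝ] F))]
      rw [ContinuousLinearMap.adjoint_comp, h1, ContinuousLinearMap.isSelfAdjoint_iff'.1 hsβ]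
    rw [e, LinearIsometryEquiv.norm_map]
    exact norm_regularized_bias_le hB hc hε hβ hβ'
  have hε2 : (√ε)⁻¹ * (√ε)⁻¹ = 1 / ε := by
    rw [← mul_inv, Real.mul_self_sqrt hε.le, one_div]
  -- the three parts of the error
  have h1 : IsHS (M' ∘L (K' - K) ∘L N') ∧ hs (M' ∘L (K' - K) ∘L N') ≤ δ / ε := by
    refine ⟨(hdK.comp_right _).comp_left _, ?_⟩
    calc hs (M' ∘L (K' - K) ∘L N') ≤ ‖M'‖ * (hs (K' - K) * ‖N'‖) :=
          (hs_comp_left_le _ (hdK.comp_right _)).trans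
            (mul_le_mul_of_nonneg_left (hs_comp_right_le hdK _) (norm_nonneg _))
      _ ≤ (√ε)⁻¹ * (δ * (√ε)⁻¹) := by
          gcongr
          · exact mul_nonneg (hs_nonneg _) (norm_nonneg _)
          · exact norm_opPow_add_le hA' ha' hε
          · exact norm_opPow_add_le hB' hc' hε
      _ = δ / ε := by rw [mul_left_comm, hε2, mul_one_div]
  have h2 : IsHS (((M' - M) ∘L P) ∘L T ∘L (Q ∘L N')) ∧
      hs (((M' - M) ∘L P) ∘L T ∘L (Q ∘L N')) ≤ δ / (2 * ε) * m * (1 + δ / (2 * ε)) := by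
    refine ⟨hDA.comp_right _, (hs_comp_right_le hDA _).trans ?_⟩
    rw [mul_assoc]
    refine mul_le_mul hDA2 ((ContinuousLinearMap.opNorm_comp_le _ _).trans ?_) (norm_nonneg _) hq
    exact mul_le_mul hm hQN' (norm_nonneg _) hm0
  have h3 : IsHS ((M ∘L P) ∘L T ∘L (Q ∘L (N' - N))) ∧
      hs ((M ∘L P) ∘L T ∘L (Q ∘L (N' - N))) ≤ m * (δ / (2 * ε)) := by
    refine ⟨(hDB3.comp_left _).comp_left _, (hs_comp_left_le _ (hDB3.comp_left _)).trans ?_⟩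
    refine (mul_le_of_le_one_left (hs_nonneg _) hMP).trans ((hs_comp_left_le _ hDB3).trans ?_)
    exact mul_le_mul hm hDB4 (hs_nonneg _) hm0
  have h4 : IsHS (((1 - M ∘L P) ∘L opPow A β) ∘L Φ ∘L (opPow B β ∘L (Q ∘L N))) ∧
      hs (((1 - M ∘L P) ∘L opPow A β) ∘L Φ ∘L (opPow B β ∘L (Q ∘L N))) ≤
        ε ^ β * hs Φ * ‖B‖ ^ β := by
    refine ⟨(hΦ.comp_right _).comp_left _, (hs_comp_left_le _ (hΦ.comp_right _)).trans ?_⟩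
    rw [mul_assoc]
    refine mul_le_mul (norm_regularized_bias_le hA ha hε hβ hβ')
      ((hs_comp_right_le hΦ _).trans ?_) (hs_nonneg _) (by positivity)
    refine mul_le_mul_of_nonneg_left ((ContinuousLinearMap.opNorm_comp_le _ _).trans ?_)
      (hs_nonneg _)
    exact (mul_le_of_le_one_right (norm_nonneg _) hQN).trans (norm_opPow_le hB hc hβ.le)
  have h5 : IsHS (opPow A β ∘L Φ ∘L (opPow B β ∘L (1 - Q ∘L N))) ∧
      hs (opPow A β ∘L Φ ∘L (opPow B β ∘L (1 - Q ∘L N))) ≤ ε ^ β * hs Φ * ‖A‖ ^ β := by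
    refine ⟨(hΦ.comp_right _).comp_left _, (hs_comp_left_le _ (hΦ.comp_right _)).trans ?_⟩
    calc ‖opPow A β‖ * hs (Φ ∘L (opPow B β ∘L (1 - Q ∘L N))) ≤ ‖A‖ ^ β * (hs Φ * ε ^ β) := by
          gcongr
          · exact hs_nonneg _
          · exact norm_opPow_le hA ha hβ.le
          · exact (hs_comp_right_le hΦ _).trans (mul_le_mul_of_nonneg_left hbias (hs_nonneg _))
      _ = ε ^ β * hs Φ * ‖A‖ ^ β := by ring
  -- Telescoping: `K'` is replaced by `K = P T Q`, then `M'` and `N'` by `M` and `N`; the remaining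
  -- bias `T - M P T Q N` splits into a left and a right part through `T = A^β Φ B^β`.
  have e : M' ∘L K' ∘L N' - T = M' ∘L (K' - K) ∘L N' + (((M' - M) ∘L P) ∘L T ∘L (Q ∘L N') +
      (M ∘L P) ∘L T ∘L (Q ∘L (N' - N))) -
      (((1 - M ∘L P) ∘L opPow A β) ∘L Φ ∘L (opPow B β ∘L (Q ∘L N)) +
        opPow A β ∘L Φ ∘L (opPow B β ∘L (1 - Q ∘L N))) := by
    ext x
    rw [hK]
    have eT : ∀ y, T y = opPow A β (Φ (opPow B β y)) := fun y => by rw [hT]; rfl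
    simp only [ContinuousLinearMap.comp_apply, sub_apply, add_apply, map_sub, one_apply_eq_self, eT]
    abel
  have h6 := isHS_add h1.1 (isHS_add h2.1 h3.1)
  have h7 := isHS_add h4.1 h5.1
  rw [e]
  refine ⟨isHS_sub h6 h7, (hs_sub_le h6 h7).trans (add_le_add ?_ ?_)⟩
  · exact (hs_add_le h1.1 (isHS_add h2.1 h3.1)).trans
      (add_le_add h1.2 ((hs_add_le h2.1 h3.1).trans (add_le_add h2.2 h3.2)))
  · rw [mul_add]
    exact (hs_add_le h4.1 h5.1).trans (add_le_add h4.2 h5.2)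

end Regularization

/-! ### Reduction to a self-adjoint perturbation. -/

section Symmetrization

variable {E : Type*} [NormedAddCommGroup E] [InnerProductSpace ℝ E] [CompleteSpace E]
  {A B D : E →L[ℝ] E}

/-- The symmetric part of an operator. -/
def symmPart (D : E →L[ℝ] E) : E →L[ℝ] E := (1 / 2 : ℝ) • (D + ContinuousLinearMap.adjoint D)

theorem isHS_symmPart (hD : IsHS D) : IsHS (symmPart D) := isHS_smul _ (isHS_add hD hD.adjoint)

theorem isSelfAdjoint_symmPart (D : E →L[ℝ] E) : IsSelfAdjoint (symmPart D) := by
  refine isSelfAdjoint_smul _ ?_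
  rw [ContinuousLinearMap.isSelfAdjoint_iff', map_add, ContinuousLinearMap.adjoint_adjoint,
    add_comm]

/-- The estimated correlation matrix need not be symmetric; against a self-adjoint argument only its
symmetric part counts, so the model may assume a self-adjoint perturbation. -/
theorem hsInner_symmPart (hD : IsHS D) (hA : IsHS A) (hsA : IsSelfAdjoint A) :
    hsInner (symmPart D) A = hsInner D A := by
  have h1 := hsInner_adjoint hD hA
  rw [ContinuousLinearMap.isSelfAdjoint_iff'.1 hsA] at h1
  rw [symmPart, hsInner_smul_left, hsInner_add_left hD hD.adjoint hA, h1]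
  ring

theorem opTrace_comp (hsA : IsSelfAdjoint A) (B : E →L[ℝ] E) : opTrace (A ∘L B) = hsInner A B :=
  tsum_congr fun _ => (inner_apply_self_comm hsA _ _).symm

end Symmetrization

/-! ### From the constants of the theorem to the deterministic model. -/

section Estimate

variable {p : ℕ} {H : Fin p → Type*} [∀ i, NormedAddCommGroup (H i)]
  [∀ i, InnerProductSpace ℝ (H i)] [∀ i, CompleteSpace (H i)]
  {C R Rhat Φ : ∀ i j, H j →L[ℝ] H i} {S : Finset (Fin p × Fin p)}
  {A D W : PiLp 2 H →L[ℝ] PiLp 2 H} {ρ w lam r α β : ℝ} {d : ℕ}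

theorem hs_entry_symmPart_le (hD : IsHS D) (h : ∀ i j, hs (entry D i j) ≤ w) (i j : Fin p) :
    hs (entry (symmPart D) i j) ≤ w := by
  have h1 := isHS_entry hD i j
  have h2 := isHS_entry hD.adjoint i j
  rw [symmPart, entry_smul, entry_add, hs_smul _ (isHS_add h1 h2), abs_of_pos one_half_pos]
  have h3 := hs_add_le h1 h2
  have h4 := h i j
  have h5 := h j i
  rw [← hs_adjoint, ← entry_adjoint] at h5
  linarith

theorem pen_eq_sum_subtype (A : PiLp 2 H →L[ℝ] PiLp 2 H) :
    ∑ e : {e : Fin p × Fin p // e.1 ≠ e.2}, (hsNorm (entry A e.1.1 e.1.2)).toReal = pen A := by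
  rw [← Finset.sum_subtype (Finset.univ.filter fun e : Fin p × Fin p => e.1 ≠ e.2) (by simp)
    (fun e => (hsNorm (entry A e.1 e.2)).toReal), Finset.sum_filter, Fintype.sum_prod_type, pen]
  refine Finset.sum_congr rfl fun i _ => Finset.sum_congr rfl fun j _ => ?_
  rw [ite_not]
  rfl

theorem objective_eq (hHS : IsHS (toOp R - 1)) (hD : IsHS (toOp Rhat - toOp R)) (hA : IsHS A)
    (hsA : IsSelfAdjoint A) :
    objective Rhat lam A = obj (toOp R - 1 + symmPart (toOp Rhat - toOp R)) lam A := by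
  have e : toOp R - 1 + (toOp Rhat - toOp R) = toOp Rhat - 1 := by abel
  rw [objective, obj, pen_eq_sum_subtype, opTrace_comp hsA, hsInner_comm A,
    hsInner_add_left hHS (isHS_symmPart hD) hA, hsInner_symmPart hD hA hsA,
    ← hsInner_add_left hHS hD hA, e]
  ring

theorem exists_estimate (h : Model R S (symmPart (toOp Rhat - toOp R)) ρ w lam r d)
    (hD : IsHS (toOp Rhat - toOp R)) (hα : 0 < α) (hinc : Incoherent R S α)
    (hlam : lam = 8 / α * w) :
    ∃ Hhat : PiLp 2 H →L[ℝ] PiLp 2 H, (∀ B, IsEstimate Rhat lam B ↔ B = Hhat) ∧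
      graph Hhat = graph (precision R) := by
  obtain ⟨A, hA, hmin, hgraph⟩ := h.exists_unique_min hα hinc hlam
  refine ⟨A, fun B => ⟨fun hB => ?_, ?_⟩, hgraph⟩
  · by_contra hne
    have h1 := hmin B hB.1 hne
    have h2 := hB.2 hA
    rw [Set.mem_ofPred_eq, objective_eq h.isHS_sub_one hD hA.1 hA.2.1,
      objective_eq h.isHS_sub_one hD hB.1.1 hB.1.2.1] at h2
    exact absurd h2 (not_le.2 h1)
  · rintro rfl
    refine ⟨hA, fun B' hB' => ?_⟩
    rw [Set.mem_ofPred_eq, objective_eq h.isHS_sub_one hD hA.1 hA.2.1,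
      objective_eq h.isHS_sub_one hD hB'.1 hB'.2.1]
    by_cases hne : B' = B
    · rw [hne]
    · exact (hmin B' hB' hne).le

/-- Isolates one number `m` that dominates both the correlations and the bias factors. For `β ≤ 1`,
`‖C i i‖ ^ β ≤ max 1 ‖C i i‖`, which removes `β` from the constant. -/
theorem kappa_spec (C R Φ : ∀ i j, H j →L[ℝ] H i) : ∃ m, kappa C R Φ = 16 * √2 * m ∧ 1 ≤ m ∧
    (∀ i j, i ≠ j → hs (R i j) ≤ m) ∧ ∀ β : ℝ, 0 < β → β ≤ 1 → ∀ i j, i ≠ j →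
      hs (Φ i j) * (‖C j j‖ ^ β + ‖C i i‖ ^ β) ≤ m := by
  refine ⟨_, rfl, (le_max_left _ _).trans (le_max_left _ _), fun i j hij => ?_,
    fun β hβ hβ' i j hij => ?_⟩
  · refine le_trans ?_ ((le_max_right _ _).trans (le_max_left _ _))
    exact le_ciSup (f := fun e : {e : Fin p × Fin p // e.1 ≠ e.2} => (hsNorm (R e.1.1 e.1.2)).toReal)
      (Set.finite_range _).bddAbove ⟨(i, j), hij⟩
  · refine le_trans ?_ (le_max_right _ _)
    have h1 : hs (Φ i j) ≤ _ :=
      le_ciSup (f := fun e : {e : Fin p × Fin p // e.1 ≠ e.2} => (hsNorm (Φ e.1.1 e.1.2)).toReal)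
        (Set.finite_range _).bddAbove ⟨(i, j), hij⟩
    have h2 : ∀ i, ‖C i i‖ ^ β ≤ max 1 (⨆ j, ‖C j j‖) := by
      intro i
      have h3 : ‖C i i‖ ≤ max 1 (⨆ j, ‖C j j‖) :=
        (le_ciSup (f := fun j => ‖C j j‖) (Set.finite_range _).bddAbove i).trans (le_max_right _ _)
      refine (Real.rpow_le_rpow (norm_nonneg _) h3 hβ.le).trans ?_
      exact (Real.rpow_le_rpow_of_exponent_le (le_max_left _ _) hβ').trans (Real.rpow_one _).le
    refine mul_le_mul h1 ?_ (by positivity) ((hs_nonneg _).trans h1)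
    have h4 : max (2 : ℝ) (2 * ⨆ j, ‖C j j‖) = 2 * max 1 (⨆ j, ‖C j j‖) := by
      rw [mul_max_of_nonneg _ _ zero_le_two, mul_one]
    rw [h4, two_mul]
    exact add_le_add (h2 j) (h2 i)

theorem sixteen_le_kappa (C R Φ : ∀ i j, H j →L[ℝ] H i) : 16 ≤ kappa C R Φ := by
  obtain ⟨m, hm, h1, -⟩ := kappa_spec C R Φ
  have h2 : 1 ≤ √2 := Real.one_le_sqrt.2 one_le_two
  have := one_le_mul_of_one_le_of_one_le h2 h1
  rw [hm, mul_assoc]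
  linarith

theorem isHS_and_hs_le_of_hsNorm_le {E F : Type*} [NormedAddCommGroup E] [InnerProductSpace ℝ E]
    [CompleteSpace E] [NormedAddCommGroup F] [InnerProductSpace ℝ F] [CompleteSpace F]
    {T : E →L[ℝ] F} {δ : ℝ} (hδ : 0 ≤ δ) (h : hsNorm T ≤ ENNReal.ofReal δ) :
    IsHS T ∧ hs T ≤ δ :=
  ⟨h.trans_lt ENNReal.ofReal_lt_top, ENNReal.toReal_le_of_le_ofReal hδ h⟩

theorem row_le_rho (hHS : IsHS (toOp R - 1)) (i : Fin p) :
    ∑ j, ‖entry (toOp R) i j‖ ≤ rho R := by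
  have h1 : ∀ j, ‖entry (toOp R) i j‖ ≤ (if i = j then 1 else 0) + hs (entry (toOp R - 1) i j) := by
    intro j
    have e : entry (toOp R) i j = entry 1 i j + entry (toOp R - 1) i j := by
      rw [← entry_add, add_sub_cancel]
    rw [e]
    refine (norm_add_le _ _).trans (add_le_add ?_ (norm_le_hs (isHS_entry hHS i j)))
    split_ifs with hij
    · subst hij
      rw [entry_one_self]
      exact ContinuousLinearMap.norm_id_le
    · rw [entry_one_ne hij, norm_zero]
  refine (Finset.sum_le_sum fun j _ => h1 j).trans ?_
  rw [Finset.sum_add_distrib, rho, rowNorm]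
  refine add_le_add (by simp) ?_
  have hfin : ∀ i j, hsNorm (entry (toOp R - 1) i j) ≠ ∞ := fun i j => (isHS_entry hHS i j).ne
  have h2 := toReal_le_toReal_iSup (f := fun i => ∑ j, hsNorm (entry (toOp R - 1) i j))
    (fun i => ENNReal.sum_ne_top.2 fun j _ => hfin i j) i
  rwa [ENNReal.toReal_sum fun j _ => hfin i j] at h2

theorem one_le_rho (R : ∀ i j, H j →L[ℝ] H i) : 1 ≤ rho R :=
  le_add_of_nonneg_right ENNReal.toReal_nonneg

theorem degree_le_maxDegree (S : Finset (Fin p × Fin p)) (i : Fin p) :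
    (Finset.univ.filter fun j : Fin p => (i, j) ∈ S).card ≤ maxDegree S :=
  Finset.le_sup (f := fun i : Fin p => (Finset.univ.filter fun j : Fin p => (i, j) ∈ S).card)
    (Finset.mem_univ i)

theorem one_le_maxDegree_graph (hp : 1 ≤ p) (A : PiLp 2 H →L[ℝ] PiLp 2 H) :
    1 ≤ maxDegree (graph A) := by
  refine le_trans ?_ (degree_le_maxDegree (graph A) ⟨0, hp⟩)
  rw [Nat.one_le_iff_ne_zero, ← Nat.pos_iff_ne_zero, Finset.card_pos]
  exact ⟨⟨0, hp⟩, Finset.mem_filter.2 ⟨Finset.mem_univ _,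
    by simp [graph]⟩⟩

/-- The smallest entry is attained. -/
theorem minEntry_spec (hA : IsHS A) {i j : Fin p} (hij : entry A i j ≠ 0) :
    0 < minEntry A ∧ minEntry A ≤ hs (entry A i j) := by
  set T := {t | ∃ i j, entry A i j ≠ 0 ∧ t = (hsNorm (entry A i j)).toReal} with hT
  have hmem : hs (entry A i j) ∈ T := ⟨i, j, hij, rfl⟩
  have hfin : T.Finite := by
    refine (Set.finite_range fun e : Fin p × Fin p => hs (entry A e.1 e.2)).subset ?_
    rintro t ⟨i, j, -, rfl⟩
    exact ⟨(i, j), rfl⟩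
  have h1 : minEntry A ∈ T := Set.Nonempty.csInf_mem ⟨_, hmem⟩ hfin
  refine ⟨?_, csInf_le hfin.bddBelow hmem⟩
  obtain ⟨k, l, hkl, he⟩ := h1
  rw [he]
  exact hs_pos (isHS_entry hA k l) hkl

/-- The conditions on the constants. -/
theorem model_of_bounds (hHS : IsHS (toOp R - 1)) (hsa : IsSelfAdjoint (toOp R))
    (hlow : ∃ c > 0, ∀ x, c * ‖x‖ ^ 2 ≤ inner ℝ x (toOp R x)) (hS : S = graph (precision R))
    (hW : IsHS W) (hsW : IsSelfAdjoint W) {κ t : ℝ} (hκ : 0 < κ) (ht : 0 < t) (hα : 0 < α)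
    (hWle : ∀ i j, hs (entry W i j) ≤ κ * t)
    (h1 : 2 * gammaConst R S * κ / minEntry (precision R) * (1 + 8 / α) * t < 1)
    (h2 : 12 * maxDegree S * κ * (1 + 8 / α) ^ 2 *
      max (rho R * gammaConst R S) (rho R ^ 3 * gammaConst R S ^ 2) * t < 1) :
    Model R S W (rho R) (κ * t) (8 / α * (κ * t))
      (2 * gammaConst R S * (κ * t + 8 / α * (κ * t))) (maxDegree S) := by
  obtain ⟨b, a, c, hb, hc, hca⟩ := exists_isEig_of_lower hHS hsa hlow
  have hPS := isHS_precision_of_isUnit hHS (hb.inverse hc hca).1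
  have hγ := one_le_gammaConst R S
  have hρ := one_le_rho R
  set γ := gammaConst R S
  set ρ := rho R
  set d : ℝ := ((maxDegree S : ℕ) : ℝ) with hd
  have hd0 : 0 ≤ d := Nat.cast_nonneg _
  set u := 1 + 8 / α with hu
  have hu1 : 1 ≤ u := le_add_of_nonneg_right (by positivity)
  have hr : 2 * γ * (κ * t + 8 / α * (κ * t)) = 2 * γ * (κ * t) * u := by rw [hu]; ring
  have hw : 0 < κ * t := mul_pos hκ ht
  have h3 : 12 * d * κ * u ^ 2 * (ρ * γ) * t < 1 := by
    refine lt_of_le_of_lt ?_ h2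
    gcongr
    exact le_max_left _ _
  have h4 : 12 * d * κ * u ^ 2 * (ρ ^ 3 * γ ^ 2) * t < 1 := by
    refine lt_of_le_of_lt ?_ h2
    gcongr
    exact le_max_right _ _
  refine ⟨hHS, hsa, hlow, row_le_rho hHS, hρ, hS, degree_le_maxDegree S, hW, hsW, hWle, hw,
    by positivity, rfl, ?_, ?_, fun i j hij => ?_⟩
  · rw [hr]
    have h5 : d * κ * (ρ * γ) * t * u ≤ d * κ * (ρ * γ) * t * u ^ 2 := by
      gcongr
      exact le_self_pow₀ hu1 two_ne_zero
    have e1 : d * ρ * (2 * γ * (κ * t) * u) = 2 * (d * κ * (ρ * γ) * t * u) := by ring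
    have e2 : 12 * d * κ * u ^ 2 * (ρ * γ) * t = 12 * (d * κ * (ρ * γ) * t * u ^ 2) := by ring
    rw [e1]
    rw [e2] at h3
    linarith
  · rw [hr]
    -- Here `6/5 · 2² = 2/5 · 12`; the linear condition needs the same factor, `2 · 6 = 12`.
    have e1 : 6 / 5 * ρ ^ 3 * d * (2 * γ * (κ * t) * u) ^ 2 =
        2 / 5 * (κ * t) * (12 * d * κ * u ^ 2 * (ρ ^ 3 * γ ^ 2) * t) := by ring
    rw [e1]
    exact mul_le_of_le_one_right (by positivity) h4.le
  · obtain ⟨hθ, hθ1⟩ := minEntry_spec hPS hij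
    refine lt_of_lt_of_le ?_ hθ1
    rw [hr]
    have e1 : 2 * γ * (κ * t) * u = 2 * γ * κ / minEntry (precision R) * u * t *
        minEntry (precision R) := by
      field_simp
    rw [e1]
    exact mul_lt_of_lt_one_left hθ h1

end Estimate

/-! ### Error of the estimated correlation operators. -/

section Deviation

variable {p : ℕ} {H : Fin p → Type*} [∀ i, NormedAddCommGroup (H i)]
  [∀ i, InnerProductSpace ℝ (H i)] [∀ i, CompleteSpace (H i)]
  [∀ i, TopologicalSpace.SeparableSpace (H i)] [∀ i, MeasurableSpace (H i)]
  [∀ i, BorelSpace (H i)] {Ω : Type*} [MeasurableSpace Ω] {μ : Measure Ω} [IsProbabilityMeasure μ]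
  {X : ∀ i, Ω → H i} {C R Φ Chat : ∀ i j, H j →L[ℝ] H i} {β δ ε : ℝ}

theorem exists_isEig_of_isPositive {E : Type*} [NormedAddCommGroup E] [InnerProductSpace ℝ E]
    [CompleteSpace E] {A : E →L[ℝ] E} (hA : IsHS A) (hpos : A.IsPositive) :
    ∃ (b : HilbertBasis (Σ c : ℝ, onbIndex (Module.End.eigenspace (A : E →ₗ[ℝ] E) c)) ℝ E)
      (a : (Σ c : ℝ, onbIndex (Module.End.eigenspace (A : E →ₗ[ℝ] E) c)) → ℝ),
      IsEig A b a ∧ ∀ k, 0 ≤ a k := by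
  obtain ⟨b, a, hb⟩ := hA.exists_isEig hpos.isSelfAdjoint
  refine ⟨b, a, hb, hb.le_of_forall fun x => ?_⟩
  rw [zero_mul]
  exact hpos.inner_nonneg_right x

/-- The error of the estimator of the correlation operator matrix. -/
theorem hs_corrEst_entry_sub_le (hX : ∀ i, MemLp (X i) 2 μ) (hC : C = covMat μ X)
    (hR : R = corrMat C) (hβ : 0 < β) (hβ' : β ≤ 1) (hReg : Regular C R β Φ) (hδ : 0 < δ)
    (hδ1 : δ ≤ 1) (hε : ε = δ ^ (1 / (1 + β))) (hpos : ∀ i, (Chat i i).IsPositive)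
    (hgood : ∀ i j, hsNorm (Chat i j - C i j) ≤ ENNReal.ofReal δ) (i j : Fin p) :
    IsHS (entry (toOp (corrEst ε Chat) - toOp R) i j) ∧
      hs (entry (toOp (corrEst ε Chat) - toOp R) i j) ≤ kappa C R Φ * δ ^ (β / (1 + β)) := by
  obtain ⟨m, hκ, hm1, hmR, hmΦ⟩ := kappa_spec C R Φ
  have ht0 : 0 < δ ^ (β / (1 + β)) := Real.rpow_pos_of_pos hδ _
  rw [entry_sub, entry_toOp, entry_toOp]
  by_cases hij : i = j
  · have e : corrEst ε Chat i j - R i j = 0 := by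
      rw [hR, corrEst, corrMat, if_pos hij, if_pos hij, sub_self]
    rw [e, hs_zero]
    refine ⟨isHS_zero, ?_⟩
    have := sixteen_le_kappa C R Φ
    positivity
  have hdiff := fun i j => isHS_and_hs_le_of_hsNorm_le hδ.le (hgood i j)
  have hCi : ∀ i, IsHS (Chat i i) := fun i => by
    have := isHS_add (hdiff i i).1 (hC ▸ isHS_covMat hX i i : IsHS (C i i))
    rwa [sub_add_cancel] at this
  have heig : ∀ i, ∃ (b : HilbertBasis (Σ c : ℝ, onbIndex
        (Module.End.eigenspace (C i i : H i →ₗ[ℝ] H i) c)) ℝ (H i))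
      (a : (Σ c : ℝ, onbIndex (Module.End.eigenspace (C i i : H i →ₗ[ℝ] H i) c)) → ℝ),
      IsEig (C i i) b a ∧ ∀ k, 0 ≤ a k := by
    rw [hC]
    exact exists_isEig_covMat hX
  obtain ⟨b, a, hb, ha⟩ := heig i
  obtain ⟨f, c, hf, hc⟩ := heig j
  obtain ⟨b', a', hb', ha'⟩ := exists_isEig_of_isPositive (hCi i) (hpos i)
  obtain ⟨f', c', hf', hc'⟩ := exists_isEig_of_isPositive (hCi j) (hpos j)
  have hε0 : 0 < ε := hε ▸ Real.rpow_pos_of_pos hδ _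
  have hβ1 : 0 < 1 + β := by linarith
  have hK : C i j = opPow (C i i) (1 / 2) ∘L R i j ∘L opPow (C j j) (1 / 2) := by
    rw [hR, hC]
    exact covMat_eq_comp_corrMat hX hij
  have hT : R i j = opPow (C i i) β ∘L Φ i j ∘L opPow (C j j) β := by
    rw [← hReg.2.2, entry_sub, entry_toOp, entry_one_ne hij, sub_zero]
  have hRHS : IsHS (R i j) := by
    rw [hT]
    exact ((hReg.2.1 i j).comp_right _).comp_left _
  have hest : corrEst ε Chat i j = opPow (ε • 1 + Chat i i) (-1 / 2) ∘L Chat i j ∘L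
      opPow (ε • 1 + Chat j j) (-1 / 2) := by rw [corrEst, if_neg hij]
  obtain ⟨h1, h2⟩ := hs_corrEst_sub_le hb ha hb' ha' hf hc hf' hc' hε0 hβ hβ' hK hT (hReg.2.1 i j)
    (hdiff i i).1 (hdiff j j).1 (hdiff i j).1 (hdiff i i).2 (hdiff j j).2 (hdiff i j).2
    ((norm_le_hs hRHS).trans (hmR i j hij))
  rw [← hest] at h1 h2
  refine ⟨h1, h2.trans ?_⟩
  -- The choice of `ε` makes the stochastic error `δ / ε` and the bias `ε ^ β` equal.
  have e1 : δ / ε = δ ^ (β / (1 + β)) := by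
    rw [hε]
    nth_rewrite 1 [← Real.rpow_one δ]
    rw [← Real.rpow_sub hδ]
    congr 1
    field_simp
    ring
  have e2 : ε ^ β = δ ^ (β / (1 + β)) := by
    rw [hε, ← Real.rpow_mul hδ.le]
    congr 1
    ring
  have e3 : δ / (2 * ε) = δ ^ (β / (1 + β)) / 2 := by rw [← e1]; ring
  rw [e1, e2, e3, hκ]
  set t := δ ^ (β / (1 + β))
  have ht1 : t ≤ 1 := Real.rpow_le_one hδ.le hδ1 (by positivity)
  have h3 := mul_le_mul_of_nonneg_left (hmΦ β hβ hβ' i j hij) ht0.le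
  have h4 : 1 ≤ √2 := Real.one_le_sqrt.2 one_le_two
  have h5 : m * t ≤ √2 * (m * t) := le_mul_of_one_le_left (by positivity) h4
  have h6 : t / 2 * m * (1 + t / 2) ≤ t / 2 * m * 2 := by
    gcongr
    linarith
  have h7 : t ≤ m * t := le_mul_of_one_le_left ht0.le hm1
  -- The error terms add up to at most `7/2 · m t`, well within `κ t`.
  have e4 : 16 * √2 * m * t = 16 * (√2 * (m * t)) := by ring
  rw [mul_assoc t, e4]
  linarith

/-- The exponents `1 + 1/β` and `β / (1 + β)` are reciprocal. -/
theorem mul_rpow_lt_one {y δ β : ℝ} (hy : 0 ≤ y) (hδ : 0 < δ) (hβ : 0 < β)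
    (h : y ^ (1 + 1 / β) * δ < 1) : y * δ ^ (β / (1 + β)) < 1 := by
  have hβ1 : 0 < 1 + β := by linarith
  have e : y * δ ^ (β / (1 + β)) = (y ^ (1 + 1 / β) * δ) ^ (β / (1 + β)) := by
    rw [Real.mul_rpow (by positivity) hδ.le, ← Real.rpow_mul hy]
    have : (1 + 1 / β) * (β / (1 + β)) = 1 := by
      field_simp
      ring
    rw [this, Real.rpow_one]
  rw [e]
  exact Real.rpow_lt_one (by positivity) h (by positivity)

end Deviation

/-! ### Tail bounds and the union bound. -/

section Tail

variable {Ω : Type*} [MeasurableSpace Ω] {μ : Measure Ω}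

/-- The strict event is the increasing union of the events at levels decreasing to `δ`; continuity
from below applies. Thus the bound holds at `δ` although the tail function may jump there. -/
theorem measure_lt_le_of_forall {g : Ω → ℝ≥0∞} {q : ℝ≥0∞} {δ δ' : ℝ} (hδ : 0 < δ) (hlt : δ < δ')
    (h : ∀ s, δ < s → s < δ' → μ {ω | ENNReal.ofReal s ≤ g ω} ≤ q) :
    μ {ω | ENNReal.ofReal δ < g ω} ≤ q := by
  obtain ⟨u, hu, hu1, hu2⟩ := exists_seq_strictAnti_tendsto' hlt
  have hset : {ω | ENNReal.ofReal δ < g ω} = ⋃ k, {ω | ENNReal.ofReal (u k) ≤ g ω} := by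
    ext ω
    simp only [Set.mem_ofPred_eq, Set.mem_iUnion]
    constructor
    · intro hω
      have h1 := ENNReal.tendsto_ofReal hu2
      obtain ⟨k, hk⟩ := (h1.eventually_lt_const hω).exists
      exact ⟨k, hk.le⟩
    · rintro ⟨k, hk⟩
      exact ((ENNReal.ofReal_lt_ofReal_iff (hδ.trans (hu1 k).1)).2 (hu1 k).1).trans_le hk
  have hmono : Monotone fun k => {ω | ENNReal.ofReal (u k) ≤ g ω} := by
    intro k l hkl ω hω
    exact (ENNReal.ofReal_le_ofReal (hu.antitone hkl)).trans hω
  rw [hset, hmono.measure_iUnion]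
  exact iSup_le fun k => h _ (hu1 k).1 (hu1 k).2

/-- The bad sets are not assumed measurable, so their union is replaced by a measurable hull of the
same measure. -/
theorem exists_event [IsProbabilityMeasure μ] {ι : Type*} [Fintype ι] {P : Ω → Prop}
    (hP : ∀ᵐ ω ∂μ, P ω) {g : ι → Ω → ℝ≥0∞} {a : ℝ≥0∞} {q : ℝ} (hq : 0 ≤ q)
    (h : ∀ i, μ {ω | a < g i ω} ≤ ENNReal.ofReal q) :
    ∃ A, MeasurableSet A ∧ 1 - Fintype.card ι * q ≤ μ.real A ∧
      ∀ ω ∈ A, (∀ i, g i ω ≤ a) ∧ P ω := by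
  set B := (⋃ i, {ω | a < g i ω}) ∪ {ω | ¬P ω} with hB
  have hBle : μ B ≤ ENNReal.ofReal (Fintype.card ι * q) := by
    refine (measure_union_le _ _).trans ?_
    rw [ae_iff.1 hP, add_zero]
    refine (measure_iUnion_fintype_le μ _).trans ((Finset.sum_le_sum fun i _ => h i).trans ?_)
    rw [Finset.sum_const, nsmul_eq_mul, ENNReal.ofReal_mul (Nat.cast_nonneg _),
      ENNReal.ofReal_natCast, Finset.card_univ]
  refine ⟨(toMeasurable μ B)ᶜ, (measurableSet_toMeasurable μ B).compl, ?_, fun ω hω => ?_⟩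
  · rw [probReal_compl_eq_one_sub (measurableSet_toMeasurable μ B), measureReal_def,
      measure_toMeasurable]
    exact sub_le_sub_left (ENNReal.toReal_le_of_le_ofReal (by positivity) hBle) 1
  · have hωB : ω ∉ B := fun h => hω (subset_toMeasurable μ B h)
    simp only [hB, Set.mem_union, Set.mem_iUnion, Set.mem_ofPred_eq, not_or, not_exists, not_lt,
      not_not] at hωB
    exact hωB

/-- If `δ₀ ≤ δ`, monotonicity gives `f n δ₀ ≤ r`, so `n` itself would be counted in `nBar f δ₀ r`.
-/
theorem lt_of_nBar_lt {f : ℕ → ℝ → ℝ} (hf : IsTailFunction f) {n : ℕ} {δ₀ δ r : ℝ} (hδ₀ : 0 < δ₀)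
    (hn : nBar f δ₀ r < (n : ℕ∞)) (hδ : f n δ ≤ r) : δ < δ₀ := by
  by_contra hcon
  have h1 : f n δ₀ ≤ r := (hf.2 n n δ₀ δ le_rfl hδ₀ (not_lt.1 hcon)).trans hδ
  exact absurd hn (not_lt.2 (le_iSup₂ (f := fun (k : ℕ) (_ : f k δ₀ ≤ r) => (k : ℕ∞)) n h1))

end Tail

end

end FGL

/-! ### Assembly of the main theorem. -/

theorem mainTheorem4 {p : ℕ} (hp : 1 ≤ p)
    {H : Fin p → Type*} [∀ i, NormedAddCommGroup (H i)] [∀ i, InnerProductSpace ℝ (H i)]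
    [∀ i, CompleteSpace (H i)] [∀ i, TopologicalSpace.SeparableSpace (H i)]
    [∀ i, MeasurableSpace (H i)] [∀ i, BorelSpace (H i)]
    {Ω : Type*} [MeasurableSpace Ω] (μ : Measure Ω) [IsProbabilityMeasure μ]
    (X : ∀ i, Ω → H i) (hX : ∀ i, MemLp (X i) 2 μ)
    (C R : ∀ i j, H j →L[ℝ] H i) (hC : C = covMat μ X) (hR : R = corrMat C)
    (hEquiv : GaussianEquivalence μ X ∨ EigenvalueGap R)
    (Hstar : PiLp 2 H →L[ℝ] PiLp 2 H) (hH : Hstar = precision R)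
    (S : Finset (Fin p × Fin p)) (hS : S = graph Hstar)
    (α : ℝ) (hα : 0 < α) (hInc : Incoherent R S α)
    (β : ℝ) (hβ : 0 < β) (hβ' : β ≤ 1)
    (Φ : ∀ i j, H j →L[ℝ] H i) (hReg : Regular C R β Φ)
    (f : ℕ → ℝ → ℝ) (hf : IsTailFunction f) (δstar : ℝ) (hδ : 0 < δstar)
    (Chat : ℕ → Ω → ∀ i j, H j →L[ℝ] H i) (hTail : TailCondition μ C Chat f δstar)
    (hpos : ∀ n, 1 ≤ n → ∀ᵐ ω ∂μ, ∀ i, (Chat n ω i i).IsPositive)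
    (τ : ℝ) (hτ : 2 < τ)
    (d : ℕ) (hd : d = maxDegree S)
    (κ ρ γ θ : ℝ) (hκ : κ = kappa C R Φ) (hρ : ρ = rho R) (hγ : γ = gammaConst R S)
    (hθ : θ = minEntry Hstar)
    (n : ℕ)
    (hn : nBar f (1 / max (1 / δstar) (max
        ((2 * γ * κ / θ * (1 + 8 / α)) ^ (1 + 1 / β))
        ((12 * d * κ * (1 + 8 / α) ^ 2 * max (ρ * γ) (ρ ^ 3 * γ ^ 2)) ^ (1 + 1 / β))))
        ((p : ℝ) ^ τ) < (n : ℕ∞))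
    (δbar : ℝ) (hδbar : IsGreatest {δ : ℝ | 0 < δ ∧ f n δ ≤ (p : ℝ) ^ τ} δbar)
    (ε lam : ℝ) (hε : ε = δbar ^ (1 / (1 + β)))
    (hlam : lam = 8 / α * κ * δbar ^ (β / (1 + β))) :
    ∃ A : Set Ω, MeasurableSet A ∧ 1 - 1 / (p : ℝ) ^ (τ - 2) ≤ μ.real A ∧
      ∀ ω ∈ A, ∃ Hhat : PiLp 2 H →L[ℝ] PiLp 2 H,
        (∀ B, IsEstimate (corrEst ε (Chat n ω)) lam B ↔ B = Hhat) ∧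
        graph Hhat = graph Hstar := by
  subst hκ hρ hγ hd hε
  have hθ' : θ = minEntry (precision R) := by rw [hθ, hH]
  have hS' : S = graph (precision R) := by rw [hS, hH]
  have hHS := isHS_of_regular hReg
  obtain ⟨hsa, hlow⟩ := isSelfAdjoint_corr_and_lower hX hC hR hEquiv hHS
  set κ := kappa C R Φ with hκ
  have hκ16 : 16 ≤ κ := sixteen_le_kappa C R Φ
  have hκ0 : 0 < κ := by linarith
  have hγ1 := one_le_gammaConst R S
  have hρ1 := one_le_rho R
  have hd1 : (1 : ℝ) ≤ maxDegree S := by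
    rw [hS']
    exact_mod_cast one_le_maxDegree_graph hp (precision R)
  have hu1 : 1 ≤ 1 + 8 / α := le_add_of_nonneg_right (by positivity)
  have hθ0 : 0 ≤ θ := by
    rw [hθ]
    refine Real.sInf_nonneg ?_
    rintro t ⟨i, j, -, rfl⟩
    exact ENNReal.toReal_nonneg
  set γ := gammaConst R S
  set ρ := rho R
  set y₁ := 2 * γ * κ / θ * (1 + 8 / α) with hy₁
  set y₂ := 12 * (maxDegree S : ℝ) * κ * (1 + 8 / α) ^ 2 * max (ρ * γ) (ρ ^ 3 * γ ^ 2) with hy₂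
  -- If `H* = 0`, then `θ = 0` and `y₁ = 0` by division by zero, in accordance with `1/θ = 0`.
  have hy₁0 : 0 ≤ y₁ := by positivity
  have hy₂1 : 1 ≤ y₂ := by
    have h1 : 1 ≤ max (ρ * γ) (ρ ^ 3 * γ ^ 2) :=
      (one_le_mul_of_one_le_of_one_le hρ1 hγ1).trans (le_max_left _ _)
    have h2 : 1 ≤ (1 + 8 / α) ^ 2 := one_le_pow₀ hu1
    have h3 : 1 ≤ 12 * (maxDegree S : ℝ) * κ :=
      one_le_mul_of_one_le_of_one_le (by linarith) (by linarith)
    exact one_le_mul_of_one_le_of_one_le (one_le_mul_of_one_le_of_one_le h3 h2) h1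
  have hδ0 := hδbar.1.1
  have hβ1 : 0 < 1 + 1 / β := by positivity
  set M := max (1 / δstar) (max (y₁ ^ (1 + 1 / β)) (y₂ ^ (1 + 1 / β))) with hM
  have hM1 : 1 / δstar ≤ M := le_max_left _ _
  have hM2 : y₁ ^ (1 + 1 / β) ≤ M := (le_max_left _ _).trans (le_max_right _ _)
  have hM3 : y₂ ^ (1 + 1 / β) ≤ M := (le_max_right _ _).trans (le_max_right _ _)
  have hM0 : 0 < M := (one_div_pos.2 hδ).trans_le hM1
  have hδM : δbar < 1 / M := lt_of_nBar_lt hf (one_div_pos.2 hM0) hn hδbar.1.2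
  have hMδ : M * δbar < 1 := by
    rwa [lt_div_iff₀ hM0, mul_comm] at hδM
  have hδstar : δbar < δstar := hδM.trans_le ((one_div_le hδ hM0).1 hM1)
  have h1 : y₁ * δbar ^ (β / (1 + β)) < 1 :=
    mul_rpow_lt_one hy₁0 hδ0 hβ ((mul_le_mul_of_nonneg_right hM2 hδ0.le).trans_lt hMδ)
  have h2 : y₂ * δbar ^ (β / (1 + β)) < 1 :=
    mul_rpow_lt_one (by linarith) hδ0 hβ ((mul_le_mul_of_nonneg_right hM3 hδ0.le).trans_lt hMδ)
  -- `y₂ ≥ 1` forces `M ≥ 1`; the error estimate for the correlations requires `δbar ≤ 1` to absorb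
  -- the quadratic term.
  have hδ1 : δbar ≤ 1 := by
    have h3 : 1 ≤ M := (Real.one_le_rpow hy₂1 hβ1.le).trans hM3
    exact (le_mul_of_one_le_left hδ0.le h3).trans hMδ.le
  have hn1 : 1 ≤ n := by
    rw [Nat.one_le_iff_ne_zero]
    rintro rfl
    exact absurd hn (by simp)
  have hp0 : (0 : ℝ) < p := by exact_mod_cast hp
  have hpτ : 0 < (p : ℝ) ^ τ := Real.rpow_pos_of_pos hp0 τ
  -- At `δbar` itself `f` is at most `p ^ τ`, the wrong direction; by maximality it exceeds `p ^ τ`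
  -- at every larger level, which bounds the strict event.
  have htail : ∀ e : Fin p × Fin p, μ {ω | ENNReal.ofReal δbar <
      hsNorm (Chat n ω e.1 e.2 - C e.1 e.2)} ≤ ENNReal.ofReal (1 / (p : ℝ) ^ τ) := by
    intro e
    refine measure_lt_le_of_forall hδ0 hδstar fun s hs hs' => ?_
    refine (hTail n hn1 s (hδ0.trans hs) hs' e.1 e.2).trans ?_
    have h3 : (p : ℝ) ^ τ ≤ f n s := by
      by_contra hcon
      exact absurd (hδbar.2 ⟨hδ0.trans hs, (not_le.1 hcon).le⟩) (not_le.2 hs)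
    rw [ENNReal.ofReal_div_of_pos hpτ, ENNReal.ofReal_one]
    exact ENNReal.div_le_div_left (ENNReal.ofReal_le_ofReal h3) 1
  obtain ⟨A, hA, hAμ, hAω⟩ := exists_event (hpos n hn1) (by positivity) htail
  -- There are `p ^ 2` entries, each failing with probability at most `1 / p ^ τ`.
  refine ⟨A, hA, le_trans (le_of_eq ?_) hAμ, fun ω hω => ?_⟩
  · have h3 : (p : ℝ) ^ (τ - 2) = (p : ℝ) ^ τ / (p : ℝ) ^ 2 := by
      rw [Real.rpow_sub hp0, Real.rpow_two]
    rw [Fintype.card_prod, Fintype.card_fin, h3]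
    push_cast
    field_simp
  obtain ⟨hgood, hposω⟩ := hAω ω hω
  have hest := hs_corrEst_entry_sub_le hX hC hR hβ hβ' hReg hδ0 hδ1 rfl hposω
    fun i j => hgood (i, j)
  have hD := isHS_of_entry fun i j => (hest i j).1
  have hlam' : lam = 8 / α * (κ * δbar ^ (β / (1 + β))) := by rw [hlam, mul_assoc]
  have hmodel := model_of_bounds hHS hsa hlow hS' (isHS_symmPart hD) (isSelfAdjoint_symmPart _) hκ0
    (Real.rpow_pos_of_pos hδ0 _) hα (hs_entry_symmPart_le hD fun i j => (hest i j).2)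
    (by rw [← hθ']; exact h1) h2
  rw [← hlam'] at hmodel
  rw [hH]
  exact exists_estimate hmodel hD hα hInc hlam'
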